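/- **Lemma 4.2 (Carleman estimate).** Let $T>0$, $Q_T=(0,T)\times(0,1)$, and let $d\in W^{1,\infty}(0,1)$ (identified with its continuous representative on $[0,1]$) satisfy $d(x)\ge M$ for all $x\in[0,1]$, for some constant $M>0$. Let $\omega\subset(0,1)$ be a nonempty open set, and let $\omega'$ be a nonempty open set with $\overline{\omega'}\subset\omega$. Let $\eta_0\in C^2([0,1])$ satisfy $\eta_0>0$ in $(0,1)$, $\eta_0(0)=\eta_0(1)=0$, $|\eta_0'|>0$ on $\overline{(0,1)\setminus\omega'}$, and $(-1)^{j+1}\eta_0'(j)<0$ for $j=0,1$. Let $m>1$ and, for $\lambda\ge1$ and $(t,x)\in(0,T)\times[0,1]$, put $$\alpha(t,x)=\frac{e^{2\lambda m\|\eta_0\|_\infty}-e^{\lambda(m\|\eta_0\|_\infty+\eta_0(x))}}{t(T-t)},\qquad \xi(t,x)=\frac{e^{\lambda(m\|\eta_0\|_\infty+\eta_0(x))}}{t(T-t)}.$$ Let $\mathbb L^2=L^2(0,1)\times\mathbb R^2$, $\mathbb H^2=\{(y,y(0),y(1)):y\in H^2(0,1)\}$ and $\mathbb E_1=H^1(0,T;\mathbb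 L^2)\cap L^2(0,T;\mathbb H^2)$ (all functions real-valued). Then for every $R>0$ there exist constants $C>0$ and $\lambda_1,s_1\ge1$, such that for all $a\in L^\infty(Q_T)$ and $b_0,b_1\in L^\infty(0,T)$ with $\|a\|_\infty,\|b_0\|_\infty,\|b_1\|_\infty\le R$ (so the constants depend on $a,b_0,b_1$ only through $R$), all $\lambda\ge\lambda_1$, all $s\ge s_1$ and all $(\varphi,\varphi(\cdot,0),\varphi(\cdot,1))\in\mathbb E_1$, $$\begin{aligned} &s^{-1}\int_{Q_T}\xi^{-1}e^{-2s\alpha}|\partial_t\varphi|^2\,dx\,dt+s^{-1}\int_{Q_T}\xi^{-1}e^{-2s\alpha}|\partial_x(d\,\partial_x\varphi)|^2\,dx\,dt+s^{-1}\sum_{j=0,1}\int_0^T\xi^{-1}(t,j)e^{-2s\alpha(t,j)}|\partial_t\varphi(t,j)|^2\,dt\\ &+s^3\lambda^4\int_{Q_T}\xi^3e^{-2s\alpha}|\varphi|^2\,dx\,dt+s\lambda^2\int_{Q_T}\xi e^{-2s\alpha}|\partial_x\varphi|^2\,dx\,dt\\ &+s^3\lambda^3\sum_{j=0,1}\int_0^T\xi^3(t,j)e^{-2s\alpha(t,j)}|\varphi(t,j)|^2\,dt+s\lambda\sum_{j=0,1}\int_0^T\xi(t,j)e^{-2s\alpha(t,j)}|\partial_x\varphi(t,j)|^2\,dt\\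 &\le C\Big(\int_{Q_T}e^{-2s\alpha}|L\varphi|^2\,dx\,dt+\sum_{j=0,1}\int_0^Te^{-2s\alpha(t,j)}|K\varphi(t,j)|^2\,dt+s^3\lambda^4\int_{(0,T)\times\omega}\xi^3e^{-2s\alpha}|\varphi|^2\,dx\,dt\Big), \end{aligned}$$ where $\partial_t\varphi(t,j)$ denotes the derivative of $t\mapsto\varphi(t,j)$ and $$L\varphi=\partial_t\varphi+\partial_x(d\,\partial_x\varphi)-a\varphi,\qquad K\varphi(t,j)=\partial_t\varphi(t,j)-(-1)^{j+1}d(j)\,\partial_x\varphi(t,j)-b_j(t)\varphi(t,j),\quad j=0,1.$$ -/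

import Mathlib

open MeasureTheory Set
open scoped ENNReal

noncomputable section

/-- `v` is the weak derivative of `u` on the interval `(a, b)`: both are locally integrable there,
and `∫ u θ' = - ∫ v θ` for every test function `θ ∈ C_c^∞(a, b)`. -/
def HasWeakDerivOn (a b : ℝ) (u v : ℝ → ℝ) : Prop :=
  LocallyIntegrableOn u (Ioo a b) ∧ LocallyIntegrableOn v (Ioo a b) ∧
    ∀ θ : ℝ → ℝ, ContDiff ℝ ((⊤ : ℕ∞) : WithTop ℕ∞) θ → HasCompactSupport θ →
      tsupport θ ⊆ Ioo a b →
      ∫ x in Ioo a b, u x * deriv θ x = - ∫ x in Ioo a b, v x * θ x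

/-- `d ∈ W^{1,∞}(a, b)`: `d` is essentially bounded and has an essentially bounded weak
derivative. -/
def MemW1Infty (a b : ℝ) (d : ℝ → ℝ) : Prop :=
  MemLp d ∞ (volume.restrict (Ioo a b)) ∧
    ∃ d' : ℝ → ℝ, MemLp d' ∞ (volume.restrict (Ioo a b)) ∧ HasWeakDerivOn a b d d'

/-- The endpoint `j ∈ {0, 1}` of `(0, 1)`, as a real number. -/
def endpt (j : Fin 2) : ℝ := ((j : ℕ) : ℝ)

/-- The sign `(-1)^{j+1}` of the outward normal of `(0, 1)` at the endpoint `j`, so that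
`∂_ν u (j) = (-1)^{j+1} u'(j)`. -/
def normalSign (j : Fin 2) : ℝ := (-1) ^ ((j : ℕ) + 1)

/-- The cylinder `Q_T = (0, T) × (0, 1)`, points being written `(t, x)`. -/
def heatCylinder (T : ℝ) : Set (ℝ × ℝ) := Ioo 0 T ×ˢ Ioo 0 1

/-- The auxiliary function `η₀ ∈ C²([0, 1])` attached to the open set `ω'`: positive inside `(0, 1)`,
zero at the endpoints, without critical points in the closure of `(0, 1) \ ω'`, and with strictly
negative outward normal derivative at both endpoints. -/
structure IsAuxFunction (ω' : Set ℝ) (η : ℝ → ℝ) : Prop where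
  contDiffOn : ContDiffOn ℝ 2 η (Icc 0 1)
  pos : ∀ x ∈ Ioo (0 : ℝ) 1, 0 < η x
  boundary : ∀ j : Fin 2, η (endpt j) = 0
  deriv_pos : ∀ x ∈ closure (Ioo (0 : ℝ) 1 \ ω'), 0 < |derivWithin η (Icc 0 1) x|
  normal_deriv_neg : ∀ j : Fin 2, normalSign j * derivWithin η (Icc 0 1) (endpt j) < 0

/-- The sup norm of `η` over `[0, 1]`. -/
def supNorm01 (η : ℝ → ℝ) : ℝ := sSup ((fun x => |η x|) '' Icc 0 1)

/-- The weight `α(t, x) = (t(T-t))⁻¹ (e^{2λm‖η‖} - e^{λ(m‖η‖ + η(x))})`. -/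
def weightAlpha (T m : ℝ) (η : ℝ → ℝ) (lam t x : ℝ) : ℝ :=
  (t * (T - t))⁻¹ *
    (Real.exp (2 * lam * m * supNorm01 η) - Real.exp (lam * (m * supNorm01 η + η x)))

/-- The weight `ξ(t, x) = (t(T-t))⁻¹ e^{λ(m‖η‖ + η(x))}`. -/
def weightXi (T m : ℝ) (η : ℝ → ℝ) (lam t x : ℝ) : ℝ :=
  (t * (T - t))⁻¹ * Real.exp (lam * (m * supNorm01 η + η x))

/-- `(φ, φ(·,0), φ(·,1))` belongs to
`𝔼₁ = H¹(0, T; L²(0,1) × ℝ²) ∩ L²(0, T; ℍ²)`, `ℍ² = {(y, y(0), y(1)) : y ∈ H²(0,1)}`,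
with time derivative `φt`, and space derivatives `φx`, `φxx`.

Here `L²(0, T; L²(0, 1))` is identified with `L²(Q_T)`. An element of `L²(0, 1) × ℝ²` is written as a
single function on `[0, 1]`, whose values at the (null) points `0` and `1` are the two boundary
components. Thus `φ t j` is the boundary value of `φ(t, ·)` at `j`, and `φt t j` is the time
derivative of that boundary value; the latter is not required to be a trace of `φt(t, ·)`.
For almost every `t`, `φ(t, ·)` and `φx(t, ·)` are the continuous representatives on `[0, 1]` of the
`H²(0, 1)` function and of its derivative, so that `φ t j` and `φx t j` are traces. -/
structure IsE1 (T : ℝ) (φ φt φx φxx : ℝ → ℝ → ℝ) : Prop where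
  memLp : MemLp (Function.uncurry φ) 2 (volume.restrict (heatCylinder T))
  memLp_t : MemLp (Function.uncurry φt) 2 (volume.restrict (heatCylinder T))
  memLp_x : MemLp (Function.uncurry φx) 2 (volume.restrict (heatCylinder T))
  memLp_xx : MemLp (Function.uncurry φxx) 2 (volume.restrict (heatCylinder T))
  memLp_boundary : ∀ j : Fin 2,
    MemLp (fun t => φ t (endpt j)) 2 (volume.restrict (Ioo 0 T))
  memLp_boundary_t : ∀ j : Fin 2,
    MemLp (fun t => φt t (endpt j)) 2 (volume.restrict (Ioo 0 T))
  weakDeriv_t : ∀ᵐ x ∂(volume.restrict (Ioo (0 : ℝ) 1)),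
    HasWeakDerivOn 0 T (fun t => φ t x) (fun t => φt t x)
  weakDeriv_boundary_t : ∀ j : Fin 2,
    HasWeakDerivOn 0 T (fun t => φ t (endpt j)) (fun t => φt t (endpt j))
  weakDeriv_x : ∀ᵐ t ∂(volume.restrict (Ioo (0 : ℝ) T)), HasWeakDerivOn 0 1 (φ t) (φx t)
  weakDeriv_xx : ∀ᵐ t ∂(volume.restrict (Ioo (0 : ℝ) T)), HasWeakDerivOn 0 1 (φx t) (φxx t)
  continuousOn : ∀ᵐ t ∂(volume.restrict (Ioo (0 : ℝ) T)), ContinuousOn (φ t) (Icc 0 1)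
  continuousOn_x : ∀ᵐ t ∂(volume.restrict (Ioo (0 : ℝ) T)), ContinuousOn (φx t) (Icc 0 1)

/-- `q ∈ L²(Q_T)` is the function `∂_x (d ∂_x φ)`: for almost every `t`, `q(t, ·)` is the weak
derivative of `d φx(t, ·)` on `(0, 1)`. -/
def IsFluxDeriv (T : ℝ) (d : ℝ → ℝ) (φx q : ℝ → ℝ → ℝ) : Prop :=
  MemLp (Function.uncurry q) 2 (volume.restrict (heatCylinder T)) ∧
    ∀ᵐ t ∂(volume.restrict (Ioo (0 : ℝ) T)), HasWeakDerivOn 0 1 (fun x => d x * φx t x) (q t)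

/-- `Lφ = ∂_t φ + ∂_x (d ∂_x φ) - a φ`, where `q = ∂_x (d ∂_x φ)`. -/
def opL (a φ φt q : ℝ → ℝ → ℝ) (t x : ℝ) : ℝ := φt t x + q t x - a t x * φ t x

/-- `Kφ(t, j) = ∂_t φ(t, j) - (-1)^{j+1} d(j) ∂_x φ(t, j) - b_j(t) φ(t, j)`. -/
def opK (d : ℝ → ℝ) (b : Fin 2 → ℝ → ℝ) (φ φt φx : ℝ → ℝ → ℝ) (t : ℝ) (j : Fin 2) : ℝ :=
  φt t (endpt j) - normalSign j * d (endpt j) * φx t (endpt j) - b j t * φ t (endpt j)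

end

/-!
The proof is the classical one by conjugation, carried out with the boundary terms kept. Put
`ρ = e^{-sα}`, `ψ = ρφ`, `β = sλη'ξ = -s∂ₓα` and let `w = d∂ₓψ` be the flux of `ψ`. Multiplying
`Lφ` by `ρ` gives `M₁ + M₂` up to lower order terms, where

  `M₁ = ∂ₜψ - 2βw - γψ`,  `M₂ = ∂ₓw + Vψ`,  `γ = 2sλ²dη'²ξ`,  `V = dβ² + s∂ₜα`.

Expanding `2M₁M₂` produces `2∂ₜψ ∂ₓw`, the divergence `∂ₜ(Vψ²) - 2∂ₓ(βw² + γψw + dβVψ²)`, and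
quadratic terms in `ψ` and `w` that are positive, of sizes `s³λ⁴ξ³` and `sλ²ξ`, wherever `η'` stays
away from zero. Elsewhere a cutoff `χ`, equal to one on `ω'` and supported in `ω`, is used: the
divergence of `sλ²ξχψw` provides the square of `w`, at the cost of the observation term. All errors
are smaller by a factor `1/λ` or `1/s`, hence absorbed (`interior_estimate`).

At the endpoints `ν∂ₓη < 0` makes the boundary terms in `w²` and `ψ²` positive, and the dynamic
boundary condition rewrites `2ν∂ₜψ w` as `2w²` plus lower order terms (`boundary_estimate`). Once
integrated, the flux terms of the interior and of the boundary estimate cancel, and so do the terms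
in `∂ₜψ`, because `∬ ∂ₜψ ∂ₓw = ∑ ν ∫ ∂ₜψ w` over the two endpoints
(`integral_timeDeriv_mul_spaceDeriv`).

The last identity is delicate for `φ ∈ 𝔼₁`, since `∂ₓ∂ₜψ` need not be a function. It is obtained
from time shifts: `τ ↦ ∬ d⁻¹ w(t + τ, x) w(t, x)` is an even function of `τ`, and integration by
parts in `x` shows that it is differentiable at `0`, where its derivative, the difference of the
two sides, must therefore vanish.

Everything is integrable up to `t = 0` and `t = T` because `ρ` beats every power of
`1 / (t(T - t))`; coefficients are tracked through `PolyBounded` and functions through `RapidL2`.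
Weak derivatives are converted into absolutely continuous sections (`HasACDerivOn`) by the du
Bois-Reymond lemma.
-/

noncomputable section

/-! ### Absolutely continuous functions and weak derivatives on an interval -/

/-- `f` is absolutely continuous on `[a, b]`, with almost everywhere derivative `f'` on `(a, b)`. -/
structure HasACDerivOn (a b : ℝ) (f f' : ℝ → ℝ) : Prop where
  ac : AbsolutelyContinuousOnInterval f a b
  hasDerivAt : ∀ᵐ x ∂(volume.restrict (Ioo a b)), HasDerivAt f (f' x) x

theorem AbsolutelyContinuousOnInterval.congr {a b : ℝ} {f g : ℝ → ℝ}
    (hf : AbsolutelyContinuousOnInterval f a b) (h : ∀ x ∈ uIcc a b, g x = f x) :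
    AbsolutelyContinuousOnInterval g a b := by
  rw [absolutelyContinuousOnInterval_iff] at hf ⊢
  intro ε hε
  obtain ⟨δ, hδ, H⟩ := hf ε hε
  refine ⟨δ, hδ, fun E hE hE' => ?_⟩
  have := H E hE hE'
  rwa [Finset.sum_congr rfl (fun i hi => ?_)]
  rw [h _ (hE.1 i hi).1, h _ (hE.1 i hi).2]

namespace HasACDerivOn

variable {a b : ℝ} {f g f' g' : ℝ → ℝ}

theorem congr_deriv (hf : HasACDerivOn a b f f')
    (h : ∀ᵐ x ∂(volume.restrict (Ioo a b)), g' x = f' x) : HasACDerivOn a b f g' := by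
  refine ⟨hf.ac, ?_⟩
  filter_upwards [hf.hasDerivAt, h] with x hx hx'
  rwa [hx']

theorem congr (hab : a ≤ b) (hf : HasACDerivOn a b f f')
    (h : ∀ x ∈ Icc a b, g x = f x) : HasACDerivOn a b g f' := by
  refine ⟨hf.ac.congr (by rwa [uIcc_of_le hab]), ?_⟩
  filter_upwards [hf.hasDerivAt, ae_restrict_mem measurableSet_Ioo] with x hx hx'
  refine hx.congr_of_eventuallyEq ?_
  filter_upwards [Icc_mem_nhds hx'.1 hx'.2] with y hy using h y hy

theorem mul (hf : HasACDerivOn a b f f') (hg : HasACDerivOn a b g g') :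
    HasACDerivOn a b (fun x => f x * g x) (fun x => f' x * g x + f x * g' x) := by
  refine ⟨hf.ac.fun_mul hg.ac, ?_⟩
  filter_upwards [hf.hasDerivAt, hg.hasDerivAt] with x hx hx' using hx.mul hx'

theorem add (hf : HasACDerivOn a b f f') (hg : HasACDerivOn a b g g') :
    HasACDerivOn a b (fun x => f x + g x) (fun x => f' x + g' x) := by
  refine ⟨hf.ac.fun_add hg.ac, ?_⟩
  filter_upwards [hf.hasDerivAt, hg.hasDerivAt] with x hx hx' using hx.add hx'

theorem sub (hf : HasACDerivOn a b f f') (hg : HasACDerivOn a b g g') :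
    HasACDerivOn a b (fun x => f x - g x) (fun x => f' x - g' x) := by
  refine ⟨hf.ac.fun_sub hg.ac, ?_⟩
  filter_upwards [hf.hasDerivAt, hg.hasDerivAt] with x hx hx' using hx.sub hx'

theorem const_mul (c : ℝ) (hf : HasACDerivOn a b f f') :
    HasACDerivOn a b (fun x => c * f x) (fun x => c * f' x) := by
  refine ⟨hf.ac.const_mul c, ?_⟩
  filter_upwards [hf.hasDerivAt] with x hx using hx.const_mul c

theorem neg (hf : HasACDerivOn a b f f') :
    HasACDerivOn a b (fun x => -f x) (fun x => -f' x) := by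
  refine ⟨hf.ac.fun_neg, ?_⟩
  filter_upwards [hf.hasDerivAt] with x hx using hx.neg

theorem const (c : ℝ) : HasACDerivOn a b (fun _ => c) (fun _ => 0) := by
  refine ⟨((LipschitzWith.const c).lipschitzOnWith
    (s := uIcc a b)).absolutelyContinuousOnInterval, ?_⟩
  filter_upwards with x using hasDerivAt_const x c

theorem continuousOn (hab : a ≤ b) (hf : HasACDerivOn a b f f') : ContinuousOn f (Icc a b) := by
  rw [← uIcc_of_le hab]
  exact hf.ac.continuousOn

theorem integrableOn (hab : a ≤ b) (hf : HasACDerivOn a b f f') : IntegrableOn f' (Ioo a b) := by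
  have h := hf.ac.intervalIntegrable_deriv
  rw [intervalIntegrable_iff_integrableOn_Ioo_of_le hab] at h
  refine h.congr ?_
  filter_upwards [hf.hasDerivAt] with x hx using hx.deriv

/-- The fundamental theorem of calculus. -/
theorem integral_eq_sub (hab : a ≤ b) (hf : HasACDerivOn a b f f') :
    ∫ x in Ioo a b, f' x = f b - f a := by
  rw [← hf.ac.integral_deriv_eq_sub, intervalIntegral.integral_of_le hab,
    integral_Ioc_eq_integral_Ioo]
  refine integral_congr_ae ?_
  filter_upwards [hf.hasDerivAt] with x hx using hx.deriv.symm

theorem of_integral (hab : a ≤ b) (hf' : IntegrableOn f' (Ioo a b))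
    (h : ∀ x ∈ Icc a b, f x = f a + ∫ y in a..x, f' y) : HasACDerivOn a b f f' := by
  have hi : IntervalIntegrable f' volume a b :=
    (intervalIntegrable_iff_integrableOn_Ioo_of_le hab).2 hf'
  have h1 : HasACDerivOn a b (fun x => ∫ y in a..x, f' y) f' := by
    refine ⟨hi.absolutelyContinuousOnInterval_intervalIntegral (by simp), ?_⟩
    rw [ae_restrict_iff' measurableSet_Ioo]
    filter_upwards [hi.ae_hasDerivAt_integral] with x hx hx'
    exact hx (by rw [uIcc_of_le hab]; exact Ioo_subset_Icc_self hx') a (by simp)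
  have h2 := ((HasACDerivOn.const (a := a) (b := b) (f a)).add h1).congr hab h
  simpa using h2

theorem of_hasDerivAt (hab : a ≤ b) (hf : ContinuousOn f (Icc a b))
    (h : ∀ x ∈ Ioo a b, HasDerivAt f (f' x) x) (hf' : IntegrableOn f' (Ioo a b)) :
    HasACDerivOn a b f f' := by
  refine of_integral hab hf' fun x hx => ?_
  have hi : IntervalIntegrable f' volume a b :=
    (intervalIntegrable_iff_integrableOn_Ioo_of_le hab).2 hf'
  rw [intervalIntegral.integral_eq_sub_of_hasDerivAt_of_le hx.1
    (hf.mono (Icc_subset_Icc_right hx.2)) (fun y hy => h y ⟨hy.1, hy.2.trans_le hx.2⟩)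
    (hi.mono_set ?_)]
  · ring
  · rw [uIcc_of_le hab, uIcc_of_le hx.1]
    exact Icc_subset_Icc_right hx.2

end HasACDerivOn

/-- The du Bois-Reymond lemma: a locally integrable function on `(a, b)` with vanishing weak
derivative is almost everywhere constant. -/
theorem ae_eq_const_of_integral_mul_deriv_eq_zero {a b : ℝ} (hab : a < b) {g : ℝ → ℝ}
    (hg : LocallyIntegrableOn g (Ioo a b))
    (h : ∀ θ : ℝ → ℝ, ContDiff ℝ ((⊤ : ℕ∞) : WithTop ℕ∞) θ → HasCompactSupport θ →
      tsupport θ ⊆ Ioo a b → ∫ x in Ioo a b, g x * deriv θ x = 0) :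
    ∃ c, ∀ᵐ x ∂(volume.restrict (Ioo a b)), g x = c := by
  obtain ⟨p₀, hp₀, hp₀c, hp₀s, hp₀r, hp₀1⟩ := exists_contDiff_tsupport_subset (n := ⊤)
    (Ioo_mem_nhds (show a < (a + b) / 2 by linarith) (show (a + b) / 2 < b by linarith))
  have hI : 0 < ∫ x, p₀ x := by
    refine Continuous.integral_pos_of_hasCompactSupport_nonneg_nonzero hp₀s.continuous hp₀c
      (fun x => (hp₀r (mem_range_self x)).1) (x := (a + b) / 2) (by rw [hp₀1]; exact one_ne_zero)
  set p : ℝ → ℝ := fun x => (∫ x, p₀ x)⁻¹ * p₀ x with hpdef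
  have hps : ContDiff ℝ ((⊤ : ℕ∞) : WithTop ℕ∞) p := contDiff_const.mul hp₀s
  have hpc : HasCompactSupport p := hp₀c.mul_left
  have hpt : tsupport p ⊆ Ioo a b := (tsupport_mul_subset_right).trans hp₀
  have hp1 : ∫ x, p x = 1 := by
    rw [hpdef, integral_const_mul, inv_mul_cancel₀ hI.ne']
  have hint : ∀ θ : ℝ → ℝ, Continuous θ → HasCompactSupport θ → tsupport θ ⊆ Ioo a b →
      Integrable (fun x => g x * θ x) := by
    intro θ hθ hθc hθs
    have h1 : IntegrableOn g (tsupport θ) :=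
      hg.integrableOn_compact_subset hθs hθc.isCompact
    have h2 : IntegrableOn (fun x => g x * θ x) (tsupport θ) :=
      h1.mul_continuousOn hθ.continuousOn hθc.isCompact
    refine (integrableOn_iff_integrable_of_support_subset ?_).1 h2
    intro x hx
    exact subset_tsupport _ (right_ne_zero_of_mul hx)
  refine ⟨∫ x, g x * p x, ?_⟩
  set c := ∫ x, g x * p x
  have hset : ∀ θ : ℝ → ℝ, tsupport θ ⊆ Ioo a b →
      ∀ k : ℝ → ℝ, ∫ x in Ioo a b, k x * θ x = ∫ x, k x * θ x := by
    intro θ hθs k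
    refine setIntegral_eq_integral_of_forall_compl_eq_zero fun x hx => ?_
    rw [image_eq_zero_of_notMem_tsupport (fun hx' => hx (hθs hx')), mul_zero]
  have key := isOpen_Ioo.ae_eq_zero_of_integral_contDiff_smul_eq_zero
    (U := Ioo a b) (f := fun x => g x - c) (μ := volume)
    (hg.sub ((locallyIntegrable_const c).locallyIntegrableOn _)) ?_
  · rw [ae_restrict_iff' measurableSet_Ioo]
    filter_upwards [key] with x hx hx'
    linarith [hx hx']
  intro θ hθ hθc hθs
  -- `θ` minus the multiple of `p` with the same integral is the derivative of a test function `Z`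
  set κ := ∫ x, θ x
  set ζ : ℝ → ℝ := fun x => θ x - κ * p x with hζdef
  have hζs : ContDiff ℝ ((⊤ : ℕ∞) : WithTop ℕ∞) ζ := hθ.sub (contDiff_const.mul hps)
  have hθi : Integrable θ := hθ.continuous.integrable_of_hasCompactSupport hθc
  have hpi : Integrable p := hps.continuous.integrable_of_hasCompactSupport hpc
  have hζi : Integrable ζ := hθi.sub (hpi.const_mul κ)
  have hζ0 : ∫ x, ζ x = 0 := by
    rw [hζdef, integral_sub hθi (hpi.const_mul κ), integral_const_mul, hp1]
    simp [κ]
  -- A compact interval inside `(a, b)` containing both supports.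
  have hK : IsCompact (tsupport θ ∪ tsupport p) := hθc.isCompact.union hpc.isCompact
  have hKs : tsupport θ ∪ tsupport p ⊆ Ioo a b := union_subset hθs hpt
  have hKne : (tsupport θ ∪ tsupport p).Nonempty := by
    by_contra hne
    rw [not_nonempty_iff_eq_empty, union_empty_iff, tsupport_eq_empty_iff,
      tsupport_eq_empty_iff] at hne
    rw [hne.2] at hp1
    simp at hp1
  obtain ⟨a', ha', hla⟩ := hK.exists_isLeast hKne
  obtain ⟨b', hb', hlb⟩ := hK.exists_isGreatest hKne
  have hζout : ∀ x, x ∉ Icc a' b' → ζ x = 0 := by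
    intro x hx
    have hx' : x ∉ tsupport θ ∪ tsupport p := fun h' => hx ⟨hla h', hlb h'⟩
    rw [hζdef]
    simp only
    rw [image_eq_zero_of_notMem_tsupport (fun h' => hx' (Or.inl h')),
      image_eq_zero_of_notMem_tsupport (f := p) (fun h' => hx' (Or.inr h'))]
    ring
  set Z : ℝ → ℝ := fun x => ∫ y in a..x, ζ y with hZdef
  have hZd : ∀ x, HasDerivAt Z (ζ x) x := fun x =>
    intervalIntegral.integral_hasDerivAt_right (hζi.intervalIntegrable)
      (hζs.continuous.stronglyMeasurableAtFilter _ _) hζs.continuous.continuousAt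
  have hZderiv : deriv Z = ζ := funext fun x => (hZd x).deriv
  have hZs : ContDiff ℝ ((⊤ : ℕ∞) : WithTop ℕ∞) Z := by
    rw [contDiff_infty_iff_deriv]
    exact ⟨fun x => (hZd x).differentiableAt, by rwa [hZderiv]⟩
  have hZout : ∀ x, x ∉ Icc a' b' → Z x = 0 := by
    intro x hx
    rw [mem_Icc, not_and_or, not_le, not_le] at hx
    rcases hx with hx | hx
    · rw [hZdef]
      simp only
      rw [intervalIntegral.integral_congr (g := fun _ => (0 : ℝ))]
      · simp
      · intro y hy
        refine hζout y fun hy' => ?_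
        have := hy.2
        have h3 : max a x < a' := max_lt (hKs ha').1 hx
        linarith [hy'.1]
    · have hax : a ≤ x := by linarith [(hKs hb').1]
      rw [hZdef]
      simp only
      rw [intervalIntegral.integral_of_le hax, ← hζ0]
      refine setIntegral_eq_integral_of_forall_compl_eq_zero fun y hy => hζout y fun hy' => ?_
      exact hy ⟨(hKs ha').1.trans_le hy'.1, hy'.2.trans hx.le⟩
  have hZt : tsupport Z ⊆ Icc a' b' := closure_minimal
    (fun x hx => by by_contra hx'; exact hx (hZout x hx')) isClosed_Icc
  have hsub : Icc a' b' ⊆ Ioo a b := fun x hx =>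
    ⟨(hKs ha').1.trans_le hx.1, hx.2.trans_lt (hKs hb').2⟩
  have hZc : HasCompactSupport Z := HasCompactSupport.of_support_subset_isCompact isCompact_Icc
    ((subset_tsupport _).trans hZt)
  have h0 := h Z hZs hZc (hZt.trans hsub)
  have hζt : tsupport ζ ⊆ Ioo a b := (closure_minimal
    (fun x hx => by by_contra hx'; exact hx (hζout x hx')) isClosed_Icc).trans hsub
  rw [hZderiv, hset ζ hζt] at h0
  have e1 := hint θ hθ.continuous hθc hθs
  have e2 := hint p hps.continuous hpc hpt
  have h4 : ∫ x, g x * ζ x = (∫ x, g x * θ x) - κ * c := by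
    have : (fun x => g x * ζ x) = fun x => g x * θ x - κ * (g x * p x) := by
      funext x; simp only [hζdef]; ring
    rw [this, integral_sub e1 (e2.const_mul κ), integral_const_mul]
  have h5 : ∫ x, θ x • (g x - c) = (∫ x, g x * θ x) - c * κ := by
    have : (fun x => θ x • (g x - c)) = fun x => g x * θ x - c * θ x := by
      funext x; simp only [smul_eq_mul]; ring
    rw [this, integral_sub e1 (hθi.const_mul c), integral_const_mul]
  rw [h5]
  linarith

/-- A weakly differentiable function whose weak derivative is integrable up to the endpoints has an
absolutely continuous representative. -/
theorem HasWeakDerivOn.exists_hasACDerivOn {a b : ℝ} (hab : a < b) {u v : ℝ → ℝ}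
    (h : HasWeakDerivOn a b u v) (hv : IntegrableOn v (Ioo a b)) :
    ∃ w, HasACDerivOn a b w v ∧ ∀ᵐ x ∂(volume.restrict (Ioo a b)), u x = w x := by
  have hV : HasACDerivOn a b (fun x => ∫ y in a..x, v y) v :=
    HasACDerivOn.of_integral hab.le hv fun x _ => by simp
  set V : ℝ → ℝ := fun x => ∫ y in a..x, v y
  have hVloc : LocallyIntegrableOn V (Ioo a b) :=
    ((hV.continuousOn hab.le).mono Ioo_subset_Icc_self).locallyIntegrableOn measurableSet_Ioo
  suffices hmain : ∀ θ : ℝ → ℝ, ContDiff ℝ ((⊤ : ℕ∞) : WithTop ℕ∞) θ → HasCompactSupport θ →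
      tsupport θ ⊆ Ioo a b → ∫ x in Ioo a b, (u - V) x * deriv θ x = 0 by
    obtain ⟨c, hc⟩ := ae_eq_const_of_integral_mul_deriv_eq_zero hab (h.1.sub hVloc) hmain
    · refine ⟨fun x => c + V x, ?_, ?_⟩
      · simpa using (HasACDerivOn.const (a := a) (b := b) c).add hV
      · filter_upwards [hc] with x hx
        simp only [Pi.sub_apply] at hx
        linarith
  intro θ hθ hθc hθs
  have hθd : ContDiff ℝ ((⊤ : ℕ∞) : WithTop ℕ∞) (deriv θ) :=
    ((contDiff_infty_iff_deriv (𝕜 := ℝ)).1 hθ).2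
  have hint : ∀ k : ℝ → ℝ, LocallyIntegrableOn k (Ioo a b) → ∀ θ : ℝ → ℝ, Continuous θ →
      HasCompactSupport θ → tsupport θ ⊆ Ioo a b →
      IntegrableOn (fun x => k x * θ x) (Ioo a b) := by
    intro k hk θ hθ hθc hθs
    have h1 : IntegrableOn k (tsupport θ) := hk.integrableOn_compact_subset hθs hθc.isCompact
    have h2 : IntegrableOn (fun x => k x * θ x) (tsupport θ) :=
      h1.mul_continuousOn hθ.continuousOn hθc.isCompact
    refine ((integrableOn_iff_integrable_of_support_subset ?_).1 h2).integrableOn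
    intro x hx
    exact subset_tsupport _ (right_ne_zero_of_mul hx)
  have hdt : tsupport (deriv θ) ⊆ Ioo a b := (tsupport_deriv_subset (𝕜 := ℝ)).trans hθs
  have e1 := hint u h.1 (deriv θ) hθd.continuous hθc.deriv hdt
  have e2 := hint V hVloc (deriv θ) hθd.continuous hθc.deriv hdt
  have hθ' : HasACDerivOn a b θ (deriv θ) :=
    HasACDerivOn.of_hasDerivAt hab.le hθ.continuous.continuousOn
      (fun x _ => (hθ.differentiable (by simp) x).hasDerivAt)
      (hθd.continuous.integrable_of_hasCompactSupport hθc.deriv).integrableOn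
  have h6 := (hV.mul hθ').integral_eq_sub hab.le
  have za : θ a = 0 := image_eq_zero_of_notMem_tsupport fun h' => (lt_irrefl a (hθs h').1)
  have zb : θ b = 0 := image_eq_zero_of_notMem_tsupport fun h' => (lt_irrefl b (hθs h').2)
  rw [integral_add (hint v h.2.1 θ hθ.continuous hθc hθs) e2, za, zb] at h6
  have h7 := h.2.2 θ hθ hθc hθs
  have : (fun x => (u - V) x * deriv θ x) = fun x => u x * deriv θ x - V x * deriv θ x := by
    funext x; simp only [Pi.sub_apply]; ring
  rw [this, integral_sub e1 e2]
  linarith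

/-- A continuous weakly differentiable function is its own absolutely continuous representative. -/
theorem HasWeakDerivOn.hasACDerivOn {a b : ℝ} (hab : a < b) {u v : ℝ → ℝ}
    (h : HasWeakDerivOn a b u v) (hv : IntegrableOn v (Ioo a b)) (hu : ContinuousOn u (Icc a b)) :
    HasACDerivOn a b u v := by
  obtain ⟨w, hw, huw⟩ := h.exists_hasACDerivOn hab hv
  refine hw.congr hab.le ?_
  have h1 : EqOn u w (Ioo a b) := by
    refine Measure.eqOn_open_of_ae_eq (μ := volume) huw isOpen_Ioo
      (hu.mono Ioo_subset_Icc_self) ((hw.continuousOn hab.le).mono Ioo_subset_Icc_self)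
  have h2 : EqOn u w (closure (Ioo a b)) := by
    refine h1.of_subset_closure ?_ ?_ subset_closure le_rfl
    · rwa [closure_Ioo hab.ne]
    · rw [closure_Ioo hab.ne]; exact hw.continuousOn hab.le
  rwa [closure_Ioo hab.ne] at h2

/-! ### Correlations under time shifts -/

theorem ae_ae_swap_of_ae_prod {μ ν : Measure ℝ} [SFinite μ] [SFinite ν] {p : ℝ × ℝ → Prop}
    (h : ∀ᵐ z ∂(μ.prod ν), p z) : ∀ᵐ x ∂ν, ∀ᵐ t ∂μ, p (t, x) :=
  Measure.ae_ae_of_ae_prod (p := fun z : ℝ × ℝ => p z.swap)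
    (Measure.measurePreserving_swap.quasiMeasurePreserving.ae h)

theorem ae_eq_prod_of_ae_ae_swap {μ ν : Measure ℝ} [SFinite μ] [SFinite ν] {f g : ℝ × ℝ → ℝ}
    (hf : AEStronglyMeasurable f (μ.prod ν)) (hg : AEStronglyMeasurable g (μ.prod ν))
    (h : ∀ᵐ x ∂ν, ∀ᵐ t ∂μ, f (t, x) = g (t, x)) : f =ᵐ[μ.prod ν] g := by
  have e : hf.mk f =ᵐ[μ.prod ν] hg.mk g := by
    have hm : MeasurableSet {z | hf.mk f z = hg.mk g z} :=
      measurableSet_eq_fun hf.stronglyMeasurable_mk.measurable hg.stronglyMeasurable_mk.measurable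
    have h' : ∀ᵐ z ∂(ν.prod μ), Prod.swap z ∈ {z | hf.mk f z = hg.mk g z} := by
      refine (Measure.ae_prod_iff_ae_ae (measurable_swap hm)).2 ?_
      filter_upwards [h, ae_ae_swap_of_ae_prod hf.ae_eq_mk, ae_ae_swap_of_ae_prod hg.ae_eq_mk]
        with x h1 h2 h3
      filter_upwards [h1, h2, h3] with t e1 e2 e3
      exact e2.symm.trans (e1.trans e3)
    exact Measure.measurePreserving_swap.quasiMeasurePreserving.ae h'
  exact hf.ae_eq_mk.trans (e.trans hg.ae_eq_mk.symm)

variable {ν : Measure ℝ} [IsFiniteMeasure ν]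

theorem measurePreserving_timeShift (ν : Measure ℝ) [IsFiniteMeasure ν] (τ : ℝ) :
    MeasurePreserving (fun z : ℝ × ℝ => (z.1 + τ, z.2))
      ((volume : Measure ℝ).prod ν) ((volume : Measure ℝ).prod ν) :=
  (measurePreserving_add_right volume τ).prod (MeasurePreserving.id ν)

theorem continuous_integral_timeShift_mul {f g : ℝ × ℝ → ℝ}
    (hf : MemLp f 2 ((volume : Measure ℝ).prod ν)) (hg : MemLp g 2 ((volume : Measure ℝ).prod ν)) :
    Continuous fun τ : ℝ => ∫ z, f (z.1 + τ, z.2) * g z ∂((volume : Measure ℝ).prod ν) := by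
  set μ := (volume : Measure ℝ).prod ν
  let S : C(ℝ, C(ℝ × ℝ, ℝ × ℝ)) :=
    (ContinuousMap.mk (fun p : ℝ × (ℝ × ℝ) => (p.2.1 + p.1, p.2.2)) (by fun_prop)).curry
  have h1 : Continuous fun τ : ℝ =>
      Lp.compMeasurePreserving (S τ) (measurePreserving_timeShift ν τ) (hf.toLp f) :=
    continuous_const.compMeasurePreservingLp S.continuous
      (fun τ => measurePreserving_timeShift ν τ) (by simp)
  have h2 : Continuous fun τ : ℝ => inner ℝ (hg.toLp g)
      (Lp.compMeasurePreserving (S τ) (measurePreserving_timeShift ν τ) (hf.toLp f)) :=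
    continuous_const.inner h1
  refine h2.congr fun τ => ?_
  rw [L2.inner_def]
  refine integral_congr_ae ?_
  have e1 := hg.coeFn_toLp
  have e2 := Lp.coeFn_compMeasurePreserving (hf.toLp f) (measurePreserving_timeShift ν τ)
  have e3 := (measurePreserving_timeShift ν τ).quasiMeasurePreserving.ae_eq_comp hf.coeFn_toLp
  filter_upwards [e1, e2, e3] with z h1 h2 h3
  rw [h1]
  erw [h2, h3]
  rfl

/-- If `P(·, x)` is a primitive of `Pₜ(·, x)`, then the correlation of `P` with any `q ∈ L²`
is differentiable in the time shift. -/
theorem hasDerivAt_integral_timeShift_mul {P Pt q : ℝ × ℝ → ℝ}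
    (hP : MemLp P 2 ((volume : Measure ℝ).prod ν)) (hPt : MemLp Pt 2 ((volume : Measure ℝ).prod ν))
    (hq : MemLp q 2 ((volume : Measure ℝ).prod ν))
    (h : ∀ᵐ x ∂ν, ∃ u : ℝ → ℝ, (∀ᵐ t, P (t, x) = u t) ∧
      ∀ t t', u t' - u t = ∫ r in t..t', Pt (r, x)) :
    HasDerivAt (fun τ : ℝ => ∫ z, P (z.1 + τ, z.2) * q z ∂((volume : Measure ℝ).prod ν))
      (∫ z, Pt z * q z ∂((volume : Measure ℝ).prod ν)) 0 := by
  set μ := (volume : Measure ℝ).prod ν with hμ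
  set G : ℝ → ℝ := fun σ => ∫ z, Pt (z.1 + σ, z.2) * q z ∂μ with hG
  have hGc : Continuous G := continuous_integral_timeShift_mul hPt hq
  have hsh : ∀ {f : ℝ × ℝ → ℝ}, MemLp f 2 μ → ∀ τ, MemLp (fun z => f (z.1 + τ, z.2)) 2 μ :=
    fun hf τ => hf.comp_measurePreserving (measurePreserving_timeShift ν τ)
  have hint : ∀ {f : ℝ × ℝ → ℝ}, MemLp f 2 μ → ∀ τ,
      Integrable (fun z => f (z.1 + τ, z.2) * q z) μ :=
    fun hf τ => (hsh hf τ).integrable_mul hq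
  have hPint : Integrable (fun z => P z * q z) μ := hP.integrable_mul hq
  have hprim : ∀ τ : ℝ, (∫ z, P (z.1 + τ, z.2) * q z ∂μ) =
      (∫ z, P z * q z ∂μ) + ∫ σ in (0 : ℝ)..τ, G σ := by
    intro τ
    rw [← sub_eq_iff_eq_add', ← integral_sub (hint hP τ) hPint]
    have hjoint : Integrable (Function.uncurry fun (σ : ℝ) (z : ℝ × ℝ) =>
        Pt (z.1 + σ, z.2) * q z) ((volume.restrict (uIoc 0 τ)).prod μ) := by
      have hqm : Measure.QuasiMeasurePreserving (fun p : ℝ × (ℝ × ℝ) => (p.2.1 + p.1, p.2.2))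
          ((volume.restrict (uIoc 0 τ)).prod μ) μ :=
        QuasiMeasurePreserving.prod_of_right (by fun_prop)
          (ae_of_all _ fun σ => (measurePreserving_timeShift ν σ).quasiMeasurePreserving)
      have hm : AEStronglyMeasurable (Function.uncurry fun (σ : ℝ) (z : ℝ × ℝ) =>
          Pt (z.1 + σ, z.2) * q z) ((volume.restrict (uIoc 0 τ)).prod μ) :=
        (hPt.1.comp_quasiMeasurePreserving hqm).mul hq.1.comp_snd
      rw [integrable_prod_iff hm]
      refine ⟨ae_of_all _ fun σ => hint hPt σ, ?_⟩
      have hc := continuous_integral_timeShift_mul hPt.abs hq.abs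
      have : (fun σ : ℝ => ∫ z, ‖(Function.uncurry fun (σ : ℝ) (z : ℝ × ℝ) =>
          Pt (z.1 + σ, z.2) * q z) (σ, z)‖ ∂μ) =
          fun σ => ∫ z, |Pt| (z.1 + σ, z.2) * |q| z ∂μ := by
        funext σ
        simp [Function.uncurry]
      rw [this]
      exact (hc.intervalIntegrable 0 τ).def'
    have hswap : ∫ σ in (0 : ℝ)..τ, G σ = ∫ z, (∫ σ in (0 : ℝ)..τ, Pt (z.1 + σ, z.2) * q z) ∂μ := by
      rw [intervalIntegral.intervalIntegral_eq_integral_uIoc, smul_eq_mul]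
      simp_rw [intervalIntegral.intervalIntegral_eq_integral_uIoc, smul_eq_mul]
      rw [integral_const_mul]
      exact congrArg _ (integral_integral_swap hjoint)
    rw [hswap]
    refine integral_congr_ae ?_
    have hae : ∀ᵐ x ∂ν, ∀ᵐ t, P (t + τ, x) * q (t, x) - P (t, x) * q (t, x) =
        ∫ σ in (0 : ℝ)..τ, Pt (t + σ, x) * q (t, x) := by
      filter_upwards [h] with x hx
      obtain ⟨u, hu, hu'⟩ := hx
      have hu2 : ∀ᵐ t, P (t + τ, x) = u (t + τ) :=
        (measurePreserving_add_right volume τ).quasiMeasurePreserving.ae hu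
      filter_upwards [hu, hu2] with t h1 h2
      rw [intervalIntegral.integral_mul_const, h1, h2, ← sub_mul, hu']
      congr 1
      rw [intervalIntegral.integral_comp_add_left (fun r => Pt (r, x)), add_zero]
    have hm1 : AEStronglyMeasurable (fun z : ℝ × ℝ => P (z.1 + τ, z.2) * q z - P z * q z) μ :=
      ((hint hP τ).sub hPint).1
    have hm2 : AEStronglyMeasurable
        (fun z : ℝ × ℝ => ∫ σ in (0 : ℝ)..τ, Pt (z.1 + σ, z.2) * q z) μ := by
      simp_rw [intervalIntegral.intervalIntegral_eq_integral_uIoc, smul_eq_mul]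
      exact hjoint.integral_prod_right.1.const_mul _
    exact ae_eq_prod_of_ae_ae_swap hm1 hm2 hae
  have hd := (intervalIntegral.integral_hasDerivAt_right (hGc.intervalIntegrable 0 0)
    (hGc.stronglyMeasurableAtFilter _ _) hGc.continuousAt).const_add (∫ z, P z * q z ∂μ)
  have hG0 : G 0 = ∫ z, Pt z * q z ∂μ := by simp [hG]
  rw [hG0] at hd
  exact hd.congr_of_eventuallyEq (Filter.Eventually.of_forall hprim)

/-! ### Integration by parts of the mixed term -/

/-- `w` belongs to `W^{1,1}_0(0, T)` in time (up to modification on a null set), with derivative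
`w'`. -/
def HasZeroTraceDeriv (T : ℝ) (w w' : ℝ → ℝ) : Prop :=
  ∃ u : ℝ → ℝ, HasACDerivOn 0 T u w' ∧ u 0 = 0 ∧ u T = 0 ∧
    ∀ᵐ t ∂(volume.restrict (Ioo 0 T)), w t = u t

/-- Extension of `p(t, x)` by zero to all times outside `(0, T)`. -/
def zeroExt (T : ℝ) (p : ℝ → ℝ → ℝ) (z : ℝ × ℝ) : ℝ := (Ioo 0 T).indicator (fun t => p t z.2) z.1

theorem zeroExt_eq_indicator (T : ℝ) (p : ℝ → ℝ → ℝ) :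
    zeroExt T p = (Ioo (0 : ℝ) T ×ˢ (univ : Set ℝ)).indicator (Function.uncurry p) := by
  funext z
  by_cases h : z.1 ∈ Ioo 0 T
  · rw [zeroExt, indicator_of_mem h, indicator_of_mem (mk_mem_prod h (mem_univ _))]
    rfl
  · rw [zeroExt, indicator_of_notMem h, indicator_of_notMem (fun h' => h h'.1)]

theorem restrict_Ioo_prod_univ (T : ℝ) (ν : Measure ℝ) [SFinite ν] :
    ((volume : Measure ℝ).prod ν).restrict (Ioo (0 : ℝ) T ×ˢ univ) =
      (volume.restrict (Ioo 0 T)).prod ν := by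
  rw [← Measure.prod_restrict, Measure.restrict_univ]

theorem memLp_zeroExt {T : ℝ} {ν : Measure ℝ} [SFinite ν] {p : ℝ → ℝ → ℝ}
    (hp : MemLp (Function.uncurry p) 2 ((volume.restrict (Ioo 0 T)).prod ν)) :
    MemLp (zeroExt T p) 2 ((volume : Measure ℝ).prod ν) := by
  rw [zeroExt_eq_indicator, memLp_indicator_iff_restrict (measurableSet_Ioo.prod .univ),
    restrict_Ioo_prod_univ]
  exact hp

theorem integral_zeroExt_mul (T : ℝ) (ν : Measure ℝ) [SFinite ν] (p q : ℝ → ℝ → ℝ) :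
    ∫ z, zeroExt T p z * zeroExt T q z ∂((volume : Measure ℝ).prod ν) =
      ∫ z, p z.1 z.2 * q z.1 z.2 ∂((volume.restrict (Ioo 0 T)).prod ν) := by
  rw [← restrict_Ioo_prod_univ, ← integral_indicator (measurableSet_Ioo.prod .univ)]
  congr 1
  funext z
  by_cases h : z.1 ∈ Ioo 0 T
  · rw [zeroExt, zeroExt, indicator_of_mem h, indicator_of_mem h,
      indicator_of_mem (mk_mem_prod h (mem_univ _))]
  · rw [zeroExt, indicator_of_notMem h, zero_mul, indicator_of_notMem (fun h' => h h'.1)]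

/-- After extension by zero, a function of class `W^{1,1}_0` in time is a primitive of its extended
derivative on the whole line, so correlations with it are differentiable in the time shift. -/
theorem hasDerivAt_integral_zeroExt {T : ℝ} (hT : 0 < T) {ν : Measure ℝ} [IsFiniteMeasure ν]
    {p pt q : ℝ → ℝ → ℝ}
    (hp : MemLp (Function.uncurry p) 2 ((volume.restrict (Ioo 0 T)).prod ν))
    (hpt : MemLp (Function.uncurry pt) 2 ((volume.restrict (Ioo 0 T)).prod ν))
    (hq : MemLp (Function.uncurry q) 2 ((volume.restrict (Ioo 0 T)).prod ν))
    (h : ∀ᵐ x ∂ν, HasZeroTraceDeriv T (fun t => p t x) (fun t => pt t x)) :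
    HasDerivAt (fun τ : ℝ => ∫ z, zeroExt T p (z.1 + τ, z.2) * zeroExt T q z
        ∂((volume : Measure ℝ).prod ν))
      (∫ z, pt z.1 z.2 * q z.1 z.2 ∂((volume.restrict (Ioo 0 T)).prod ν)) 0 := by
  rw [← integral_zeroExt_mul]
  refine hasDerivAt_integral_timeShift_mul (memLp_zeroExt hp) (memLp_zeroExt hpt)
    (memLp_zeroExt hq) ?_
  filter_upwards [h] with x ⟨u, hu, hu0, huT, hpu⟩
  have hi : Integrable (fun r => zeroExt T pt (r, x)) := by
    simp only [zeroExt]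
    exact (hu.integrableOn hT.le).integrable_indicator measurableSet_Ioo
  have hI : ∀ t, ∫ r in (0 : ℝ)..t, zeroExt T pt (r, x) = if t ∈ Ioo 0 T then u t else 0 := by
    intro t
    rcases le_or_gt t 0 with h0 | h0
    · rw [if_neg (fun h' => absurd h'.1 (not_lt.2 h0)), intervalIntegral.integral_symm,
        intervalIntegral.integral_of_le h0, integral_Ioc_eq_integral_Ioo,
        setIntegral_eq_zero_of_forall_eq_zero, neg_zero]
      intro r hr
      simp only [zeroExt]
      exact indicator_of_notMem (fun h' => absurd h'.1 (not_lt.2 hr.2.le)) _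
    · have e : ∀ s, 0 ≤ s → s ≤ T → ∫ r in Ioo 0 s, zeroExt T pt (r, x) = u s := by
        intro s hs hsT
        have hus : HasACDerivOn 0 s u (fun t => pt t x) := by
          refine ⟨hu.ac.mono ?_, ae_restrict_of_ae_restrict_of_subset
            (Ioo_subset_Ioo_right hsT) hu.hasDerivAt⟩
          rw [uIcc_of_le hs, uIcc_of_le hT.le]
          exact Icc_subset_Icc_right hsT
        have := hus.integral_eq_sub hs
        rw [hu0, sub_zero] at this
        rw [← this]
        refine setIntegral_congr_fun measurableSet_Ioo fun r hr => ?_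
        simp only [zeroExt]
        exact indicator_of_mem (s := Ioo 0 T) ⟨hr.1, hr.2.trans_le hsT⟩ _
      rw [intervalIntegral.integral_of_le h0.le, integral_Ioc_eq_integral_Ioo]
      rcases lt_or_ge t T with h1 | h1
      · rw [if_pos ⟨h0, h1⟩, e t h0.le h1.le]
      · rw [if_neg (fun h' => absurd h'.2 (not_lt.2 h1))]
        refine Eq.trans ?_ ((e T hT.le le_rfl).trans huT)
        refine (setIntegral_eq_of_subset_of_forall_sdiff_eq_zero measurableSet_Ioo
          (Ioo_subset_Ioo_right h1) fun r hr => ?_)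
        simp only [zeroExt]
        exact indicator_of_notMem (fun h' => hr.2 h') _
  refine ⟨fun t => ∫ r in (0 : ℝ)..t, zeroExt T pt (r, x), ?_, fun t t' => ?_⟩
  · rw [ae_restrict_iff' measurableSet_Ioo] at hpu
    filter_upwards [hpu] with t ht
    rw [hI]
    by_cases htm : t ∈ Ioo 0 T
    · rw [if_pos htm, zeroExt]
      simp only
      rw [indicator_of_mem htm, ht htm]
    · rw [if_neg htm, zeroExt]
      exact indicator_of_notMem htm _
  · exact intervalIntegral.integral_interval_sub_left hi.intervalIntegrable hi.intervalIntegrable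

theorem memLp_prod_dirac {T j : ℝ} {p : ℝ → ℝ → ℝ}
    (hp : MemLp (fun t => p t j) 2 (volume.restrict (Ioo 0 T))) :
    MemLp (Function.uncurry p) 2 ((volume.restrict (Ioo 0 T)).prod (Measure.dirac j)) := by
  rw [Measure.prod_dirac, (measurableEmbedding_prod_mk_right j).memLp_map_measure_iff]
  exact hp

theorem integral_prod_dirac (μ : Measure ℝ) [SFinite μ] (j : ℝ) (f : ℝ × ℝ → ℝ) :
    ∫ z, f z ∂(μ.prod (Measure.dirac j)) = ∫ t, f (t, j) ∂μ := by
  rw [Measure.prod_dirac, (measurableEmbedding_prod_mk_right j).integral_map]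

/-- Integration by parts of the mixed term `∬ ∂ₜp ∂ₓw` where `∂ₓp = κ w`: the interior contribution
is the time derivative of `½ ∫ κ w²`, which integrates to zero, so that only the lateral boundary
contributes. Since `∂ₓ∂ₜp` need not exist, the interior contribution is instead seen to vanish
because the autocorrelation `τ ↦ ∬ κ w(t + τ, x) w(t, x)` is an even function of `τ`. -/
theorem integral_timeDeriv_mul_spaceDeriv {T : ℝ} (hT : 0 < T) {p pt w wx : ℝ → ℝ → ℝ}
    {κ : ℝ → ℝ}
    (hp : MemLp (Function.uncurry p) 2 (volume.restrict (heatCylinder T)))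
    (hpt : MemLp (Function.uncurry pt) 2 (volume.restrict (heatCylinder T)))
    (hw : MemLp (Function.uncurry w) 2 (volume.restrict (heatCylinder T)))
    (hκw : MemLp (Function.uncurry fun t x => κ x * w t x) 2 (volume.restrict (heatCylinder T)))
    (hwx : MemLp (Function.uncurry wx) 2 (volume.restrict (heatCylinder T)))
    (hpj : ∀ j : Fin 2, MemLp (fun t => p t (endpt j)) 2 (volume.restrict (Ioo 0 T)))
    (hptj : ∀ j : Fin 2, MemLp (fun t => pt t (endpt j)) 2 (volume.restrict (Ioo 0 T)))
    (hwj : ∀ j : Fin 2, MemLp (fun t => w t (endpt j)) 2 (volume.restrict (Ioo 0 T)))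
    (ht : ∀ᵐ x ∂(volume.restrict (Ioo (0 : ℝ) 1)),
      HasZeroTraceDeriv T (fun t => p t x) (fun t => pt t x))
    (htj : ∀ j : Fin 2,
      HasZeroTraceDeriv T (fun t => p t (endpt j)) (fun t => pt t (endpt j)))
    (hpx : ∀ᵐ t ∂(volume.restrict (Ioo 0 T)), HasACDerivOn 0 1 (p t) (fun x => κ x * w t x))
    (hwx' : ∀ᵐ t ∂(volume.restrict (Ioo 0 T)), HasACDerivOn 0 1 (w t) (wx t)) :
    ∫ z in heatCylinder T, pt z.1 z.2 * wx z.1 z.2 =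
      ∑ j : Fin 2, ∫ t in Ioo 0 T, normalSign j * (pt t (endpt j) * w t (endpt j)) := by
  have hcyl : (volume.restrict (heatCylinder T) : Measure (ℝ × ℝ)) =
      (volume.restrict (Ioo 0 T)).prod (volume.restrict (Ioo 0 1)) := by
    rw [heatCylinder, Measure.prod_restrict]; rfl
  rw [hcyl] at hp hpt hw hκw hwx ⊢
  set ν : Measure ℝ := volume.restrict (Ioo 0 1) with hν
  have d0 := hasDerivAt_integral_zeroExt hT hp hpt hwx ht
  have dj : ∀ j : Fin 2, HasDerivAt (fun τ : ℝ => ∫ z, zeroExt T p (z.1 + τ, z.2) * zeroExt T w z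
        ∂((volume : Measure ℝ).prod (Measure.dirac (endpt j))))
      (∫ z, pt z.1 z.2 * w z.1 z.2
        ∂((volume.restrict (Ioo 0 T)).prod (Measure.dirac (endpt j)))) 0 := fun j =>
    hasDerivAt_integral_zeroExt hT (memLp_prod_dirac (hpj j)) (memLp_prod_dirac (hptj j))
      (memLp_prod_dirac (hwj j)) (by rw [ae_dirac_eq]; exact htj j)
  simp only [integral_prod_dirac] at dj
  -- the autocorrelation of `w` with weight `κ`
  set kw : ℝ → ℝ → ℝ := fun t x => κ x * w t x with hkw
  set Φ : ℝ → ℝ := fun τ => ∫ z, zeroExt T kw (z.1 + τ, z.2) * zeroExt T w z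
    ∂((volume : Measure ℝ).prod ν) with hΦ
  have hsh : ∀ {f : ℝ × ℝ → ℝ}, MemLp f 2 ((volume : Measure ℝ).prod ν) → ∀ τ,
      MemLp (fun z => f (z.1 + τ, z.2)) 2 ((volume : Measure ℝ).prod ν) :=
    fun hf τ => hf.comp_measurePreserving (measurePreserving_timeShift ν τ)
  have hkwE : ∀ t x, zeroExt T kw (t, x) = κ x * zeroExt T w (t, x) := by
    intro t x
    by_cases h : t ∈ Ioo 0 T
    · simp [zeroExt, h, hkw]
    · simp [zeroExt, h]
  have heven : ∀ τ, Φ τ = Φ (-τ) := by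
    intro τ
    have h1 := (measurePreserving_timeShift ν τ).integral_comp'
      (f := (MeasurableEquiv.addRight τ).prodCongr (MeasurableEquiv.refl ℝ))
      (fun z : ℝ × ℝ => zeroExt T kw (z.1 + -τ, z.2) * zeroExt T w z)
    rw [hΦ]
    simp only
    rw [← h1]
    refine integral_congr_ae (ae_of_all _ fun z => ?_)
    simp only [MeasurableEquiv.prodCongr, MeasurableEquiv.coe_mk, Equiv.prodCongr_apply, Prod.map]
    simp only [MeasurableEquiv.addRight, MeasurableEquiv.refl]
    simp [hkwE]
    ring
  -- integration by parts in `x` of the correlation of `p` with `∂ₓw`, at each time shift `τ`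
  have hid : ∀ τ, (∫ z, zeroExt T p (z.1 + τ, z.2) * zeroExt T wx z
        ∂((volume : Measure ℝ).prod ν)) =
      (∫ t, zeroExt T p (t + τ, endpt 1) * zeroExt T w (t, endpt 1)) -
      (∫ t, zeroExt T p (t + τ, endpt 0) * zeroExt T w (t, endpt 0)) - Φ τ := by
    intro τ
    have i1 : Integrable (fun z => zeroExt T p (z.1 + τ, z.2) * zeroExt T wx z)
        ((volume : Measure ℝ).prod ν) :=
      (hsh (memLp_zeroExt hp) τ).integrable_mul (memLp_zeroExt hwx)
    have i2 : Integrable (fun z => zeroExt T kw (z.1 + τ, z.2) * zeroExt T w z)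
        ((volume : Measure ℝ).prod ν) :=
      (hsh (memLp_zeroExt hκw) τ).integrable_mul (memLp_zeroExt hw)
    have ij : ∀ j : Fin 2, Integrable fun t =>
        zeroExt T p (t + τ, endpt j) * zeroExt T w (t, endpt j) := by
      intro j
      have e1 : ∀ {f : ℝ → ℝ → ℝ}, MemLp (fun t => f t (endpt j)) 2 (volume.restrict (Ioo 0 T)) →
          MemLp (fun t => zeroExt T f (t, endpt j)) 2 := by
        intro f hf
        exact (memLp_indicator_iff_restrict measurableSet_Ioo).2 hf
      exact ((e1 (hpj j)).comp_measurePreserving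
        (measurePreserving_add_right volume τ)).integrable_mul (e1 (hwj j))
    have i3 : Integrable fun t => zeroExt T p (t + τ, endpt 1) * zeroExt T w (t, endpt 1) -
        zeroExt T p (t + τ, endpt 0) * zeroExt T w (t, endpt 0) := (ij 1).sub (ij 0)
    have i4 : Integrable fun t => ∫ x, zeroExt T kw (t + τ, x) * zeroExt T w (t, x) ∂ν :=
      i2.integral_prod_left
    have hΦτ : Φ τ = ∫ t, ∫ x, zeroExt T kw (t + τ, x) * zeroExt T w (t, x) ∂ν :=
      integral_prod _ i2
    rw [integral_prod _ i1, hΦτ, ← integral_sub (ij 1) (ij 0), ← integral_sub i3 i4]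
    refine integral_congr_ae ?_
    rw [ae_restrict_iff' measurableSet_Ioo] at hpx hwx'
    have hpx2 : ∀ᵐ t : ℝ, t + τ ∈ Ioo 0 T →
        HasACDerivOn 0 1 (p (t + τ)) (fun x => κ x * w (t + τ) x) :=
      (measurePreserving_add_right volume τ).quasiMeasurePreserving.ae hpx
    filter_upwards [hpx2, hwx'] with t h1 h2
    by_cases m1 : t + τ ∈ Ioo 0 T
    · by_cases m2 : t ∈ Ioo 0 T
      · replace h1 := h1 m1
        replace h2 := h2 m2
        simp only [zeroExt, indicator_of_mem m1, indicator_of_mem m2, hkw]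
        have h3 := (h1.mul h2).integral_eq_sub zero_le_one
        have j1 : IntegrableOn (fun x => κ x * w (t + τ) x * w t x) (Ioo 0 1) := by
          have := (h1.integrableOn zero_le_one)
          rw [← integrableOn_Icc_iff_integrableOn_Ioo] at this ⊢
          exact this.mul_continuousOn (h2.continuousOn zero_le_one) isCompact_Icc
        have j2 : IntegrableOn (fun x => p (t + τ) x * wx t x) (Ioo 0 1) := by
          have := (h2.integrableOn zero_le_one)
          rw [← integrableOn_Icc_iff_integrableOn_Ioo] at this ⊢
          exact this.continuousOn_mul (h1.continuousOn zero_le_one) isCompact_Icc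
        rw [integral_add j1 j2] at h3
        simp only [endpt, Fin.val_one, Fin.val_zero, Nat.cast_one, Nat.cast_zero]
        linarith
      · simp [zeroExt, m2]
    · simp [zeroExt, m1]
  have hΦd := (((dj 1).sub (dj 0)).sub d0)
  have hΦd' : HasDerivAt Φ (((∫ t in Ioo 0 T, pt t (endpt 1) * w t (endpt 1)) -
      ∫ t in Ioo 0 T, pt t (endpt 0) * w t (endpt 0)) -
      ∫ z, pt z.1 z.2 * wx z.1 z.2 ∂((volume.restrict (Ioo 0 T)).prod ν)) 0 := by
    refine hΦd.congr_of_eventuallyEq (Filter.Eventually.of_forall fun τ => ?_)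
    simp only [Pi.sub_apply]
    rw [hid τ]
    ring
  -- the derivative at zero of an even function vanishes
  have hn := hΦd'.scomp_of_eq (0 : ℝ) (hasDerivAt_neg (0 : ℝ)) (by simp)
  have := hΦd'.unique
    (hn.congr_of_eventuallyEq (Filter.Eventually.of_forall fun τ => heven τ))
  simp only [neg_smul, one_smul] at this
  rw [Fin.sum_univ_two, integral_const_mul, integral_const_mul]
  simp only [normalSign, Fin.val_zero, Fin.val_one]
  norm_num
  linarith

/-! ### The pointwise interior estimate -/

theorem abs_mul_le_mul' {x y a b : ℝ} (hx : |x| ≤ a) (hy : |y| ≤ b) : |x * y| ≤ a * b := by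
  rw [abs_mul]
  exact mul_le_mul hx hy (abs_nonneg _) ((abs_nonneg _).trans hx)

theorem abs_add_le_add' {x y a b : ℝ} (hx : |x| ≤ a) (hy : |y| ≤ b) : |x + y| ≤ a + b :=
  (abs_add_le x y).trans (add_le_add hx hy)

theorem abs_sub_le_add' {x y a b : ℝ} (hx : |x| ≤ a) (hy : |y| ≤ b) : |x - y| ≤ a + b :=
  (abs_sub x y).trans (add_le_add hx hy)

/-- The coefficient of `ψ²` in the cross product of the two halves of the conjugated operator,
after integration by parts, is at least `σ³ l⁴ d² η'⁴` up to terms of relative size `1 / l + 1 / s`.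
Here `σ = sξ`, and `a₁`, `a₂`, `a₃` are `∂ₜα`, `∂ₜ²α`, `∂ₜξ` divided by the powers `ξ²`, `ξ³`, `ξ²`
that bound them. -/
theorem zeroth_order_coeff_ge {B s l σ d d' h h₂ a₁ a₂ a₃ : ℝ} (hB : 1 ≤ B) (hs : 1 ≤ s)
    (hl : 1 ≤ l) (hσ : 0 < σ) (hd : |d| ≤ B) (hd' : |d'| ≤ B) (hh : |h| ≤ B) (hh₂ : |h₂| ≤ B)
    (ha₁ : |a₁| ≤ B) (ha₂ : |a₂| ≤ B) (ha₃ : |a₃| ≤ B)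
    {β βx γ V Vx Vt : ℝ} (hβ : β = σ * l * h) (hβx : βx = σ * l * h₂ + σ * l ^ 2 * h ^ 2)
    (hγ : γ = 2 * σ * l ^ 2 * d * h ^ 2) (hV : V = d * β ^ 2 + σ ^ 2 * a₁ / s)
    (hVx : Vx = d' * β ^ 2 + 2 * d * β * βx - l * h * (σ ^ 2 * a₃ / s))
    (hVt : Vt = 2 * d * l ^ 2 * h ^ 2 * σ * (σ ^ 2 * a₃ / s) + σ ^ 3 * a₂ / s ^ 2) :
    σ ^ 3 * l ^ 4 * (d ^ 2 * h ^ 4) - 11 * B ^ 5 * (σ ^ 3 * l ^ 4) * (1 / l + 1 / s) ≤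
      -(Vt / 2) + (d' * β + d * βx) * V + d * β * Vx - γ * V := by
  have hs0 : 0 < s := by linarith
  have hl0 : 0 < l := by linarith
  have hB0 : 0 < B := by linarith
  set r₁ := (d' * h + d * h₂) * (d * (h * h)) + d * d' * (h * h * h) + 2 * (d * d * (h * h) * h₂)
    with hr₁
  set r₂ := a₁ * (d' * h + d * h₂) * l - (a₁ * (d * (h * h))) * l ^ 2
    - 2 * (d * (h * h) * a₃) * l ^ 2 - a₂ / 2 * (1 / s) with hr₂
  have key : -(Vt / 2) + (d' * β + d * βx) * V + d * β * Vx - γ * V =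
      σ ^ 3 * l ^ 4 * (d ^ 2 * h ^ 4) + σ ^ 3 * l ^ 3 * r₁ + σ ^ 3 / s * r₂ := by
    rw [hVt, hVx, hV, hγ, hβx, hβ, hr₁, hr₂]
    field_simp
    ring
  have b1 : |r₁| ≤ 5 * B ^ 5 := by
    have e1 := abs_mul_le_mul' (abs_add_le_add' (abs_mul_le_mul' hd' hh) (abs_mul_le_mul' hd hh₂))
      (abs_mul_le_mul' hd (abs_mul_le_mul' hh hh))
    have e2 := abs_mul_le_mul' (abs_mul_le_mul' hd hd')
      (abs_mul_le_mul' (abs_mul_le_mul' hh hh) hh)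
    have e3 := abs_mul_le_mul' (abs_two (α := ℝ)).le (abs_mul_le_mul' (abs_mul_le_mul'
      (abs_mul_le_mul' hd hd) (abs_mul_le_mul' hh hh)) hh₂)
    refine (abs_add_le_add' (abs_add_le_add' e1 e2) e3).trans (le_of_eq ?_)
    ring
  have b2 : |r₂| ≤ 6 * B ^ 4 * l ^ 2 := by
    have hl' : |l| ≤ l ^ 2 := by rw [abs_of_pos hl0]; exact le_self_pow₀ hl two_ne_zero
    have hl2 : |l ^ 2| ≤ l ^ 2 := by rw [abs_of_nonneg (by positivity)]
    have hs1 : |1 / s| ≤ 1 := by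
      rw [abs_of_pos (by positivity), div_le_one hs0]; exact hs
    have e1 := abs_mul_le_mul' (abs_mul_le_mul' ha₁
      (abs_add_le_add' (abs_mul_le_mul' hd' hh) (abs_mul_le_mul' hd hh₂))) hl'
    have e2 := abs_mul_le_mul' (abs_mul_le_mul' ha₁
      (abs_mul_le_mul' hd (abs_mul_le_mul' hh hh))) hl2
    have e3 := abs_mul_le_mul' (abs_mul_le_mul' (abs_two (α := ℝ)).le (abs_mul_le_mul'
      (abs_mul_le_mul' hd (abs_mul_le_mul' hh hh)) ha₃)) hl2
    have e4 : |a₂ / 2 * (1 / s)| ≤ B / 2 * 1 := by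
      refine abs_mul_le_mul' ?_ hs1
      rw [abs_div, abs_two]; linarith
    refine (abs_sub_le_add' (abs_sub_le_add' (abs_sub_le_add' e1 e2) e3) e4).trans ?_
    have hl1 : 1 ≤ l ^ 2 := one_le_pow₀ hl
    have hB3 : B ^ 3 ≤ B ^ 4 := pow_le_pow_right₀ hB (by norm_num)
    have hB1 : B ≤ B ^ 4 := by simpa using pow_le_pow_right₀ hB (show 1 ≤ 4 by norm_num)
    have f1 : B ^ 3 * l ^ 2 ≤ B ^ 4 * l ^ 2 := by gcongr
    have f2 : B ≤ B ^ 4 * l ^ 2 := hB1.trans (le_mul_of_one_le_right (by positivity) hl1)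
    calc _ = 2 * (B ^ 3 * l ^ 2) + 3 * (B ^ 4 * l ^ 2) + B / 2 := by ring
      _ ≤ 6 * (B ^ 4 * l ^ 2) := by linarith
      _ = _ := by ring
  rw [key]
  have c1 : -(5 * B ^ 5 * (σ ^ 3 * l ^ 4) * (1 / l)) ≤ σ ^ 3 * l ^ 3 * r₁ := by
    have : 5 * B ^ 5 * (σ ^ 3 * l ^ 4) * (1 / l) = σ ^ 3 * l ^ 3 * (5 * B ^ 5) := by
      field_simp
    rw [this, ← mul_neg]
    gcongr
    exact (abs_le.1 b1).1
  have c2 : -(6 * B ^ 4 * (σ ^ 3 * l ^ 4) * (1 / s)) ≤ σ ^ 3 / s * r₂ := by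
    have : 6 * B ^ 4 * (σ ^ 3 * l ^ 4) * (1 / s) = σ ^ 3 / s * (6 * B ^ 4 * l ^ 4) := by
      field_simp
    rw [this, ← mul_neg]
    gcongr
    have : l ^ 2 ≤ l ^ 4 := pow_le_pow_right₀ hl (by norm_num)
    have : 6 * B ^ 4 * l ^ 2 ≤ 6 * B ^ 4 * l ^ 4 := by gcongr
    linarith [(abs_le.1 b2).1]
  have g1 : 0 ≤ B ^ 5 * (σ ^ 3 * l ^ 4) * (1 / l) := by positivity
  have g2 : B ^ 4 * (σ ^ 3 * l ^ 4) * (1 / s) ≤ B ^ 5 * (σ ^ 3 * l ^ 4) * (1 / s) := by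
    gcongr
    norm_num
  have g3 : 0 ≤ B ^ 5 * (σ ^ 3 * l ^ 4) * (1 / s) := by positivity
  rw [mul_add]
  linarith

/-- The weights of `ψ²` and `w²` exceed the geometric mean needed for a mixed term of order
`σ l³` by one power of `σ`, which is at least `s / B`. -/
theorem cross_term_le {B s l σ ψ w : ℝ} (hσ : 0 < σ) (hl : 0 < l) (hs : 0 < s)
    (hBσ : s ≤ B * σ) :
    σ * l ^ 3 * |ψ * w| ≤ B * (1 / s) * (σ ^ 3 * l ^ 4 * ψ ^ 2 + σ * l ^ 2 * w ^ 2) := by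
  have h1 : 2 * (σ * l) * |ψ * w| ≤ σ ^ 2 * l ^ 2 * ψ ^ 2 + w ^ 2 := by
    have := two_mul_le_add_sq (σ * l * |ψ|) |w|
    rw [mul_pow, sq_abs, sq_abs] at this
    rw [abs_mul]
    linarith
  have h2 : 0 ≤ σ ^ 2 * l ^ 2 * ψ ^ 2 + w ^ 2 := by positivity
  have h3 : σ * l * |ψ * w| ≤ σ ^ 2 * l ^ 2 * ψ ^ 2 + w ^ 2 := by
    have : 0 ≤ σ * l * |ψ * w| := by positivity
    linarith
  have h4 : 1 ≤ B * (1 / s) * σ := by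
    rw [mul_one_div, div_mul_eq_mul_div, le_div_iff₀ hs]; linarith
  calc σ * l ^ 3 * |ψ * w| = l ^ 2 * (σ * l * |ψ * w|) := by ring
    _ ≤ l ^ 2 * (σ ^ 2 * l ^ 2 * ψ ^ 2 + w ^ 2) := by gcongr
    _ ≤ (B * (1 / s) * σ) * (l ^ 2 * (σ ^ 2 * l ^ 2 * ψ ^ 2 + w ^ 2)) :=
      le_mul_of_one_le_left (by positivity) h4
    _ = _ := by ring

set_option maxHeartbeats 1000000 in
/-- The pointwise estimate behind the interior part, `M₁ = ψₜ - 2βw - γψ` and `M₂ = wₓ + Vψ` being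
the two halves of the conjugated operator: `M₁²` and the weighted squares of `ψ` and `w` are
controlled by the right-hand side, the observation term, `ψₜ wₓ` and an exact divergence, up to errors
of relative size `1 / l + 1 / s`. Where `η'` may vanish the cutoff `χ` equals one, and the divergence
of `σ l² χ ψ w` supplies the missing square of `w`; half of `M₂²` absorbs the term `σ l² χ ψ wₓ`
of that divergence. -/
theorem interior_core {B s l σ d d' h h₂ a₁ a₂ a₃ χ χ' o a : ℝ} (hB : 1 ≤ B) (hs : 1 ≤ s)
    (hl : 1 ≤ l) (hσ : 0 < σ) (hBσ : s ≤ B * σ) (hdM : 1 ≤ B * d) (hd : d ≤ B) (hd' : |d'| ≤ B)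
    (hh : |h| ≤ B) (hh₂ : |h₂| ≤ B) (ha₁ : |a₁| ≤ B) (ha₂ : |a₂| ≤ B) (ha₃ : |a₃| ≤ B)
    (hχ0 : 0 ≤ χ) (hχo : χ ≤ o) (ho : o ≤ 1) (hχ' : |χ'| ≤ B) (hcrit : 1 ≤ B * h ^ 2 ∨ χ = 1)
    (ha : |a| ≤ B)
    {β βx γ γx V Vx Vt : ℝ} (hβ : β = σ * l * h) (hβx : βx = σ * l * h₂ + σ * l ^ 2 * h ^ 2)
    (hγ : γ = 2 * σ * l ^ 2 * d * h ^ 2)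
    (hγx : γx = 2 * σ * l ^ 2 * (d' * h ^ 2 + 2 * d * h * h₂ + l * d * h ^ 3))
    (hV : V = d * β ^ 2 + σ ^ 2 * a₁ / s)
    (hVx : Vx = d' * β ^ 2 + 2 * d * β * βx - l * h * (σ ^ 2 * a₃ / s))
    (hVt : Vt = 2 * d * l ^ 2 * h ^ 2 * σ * (σ ^ 2 * a₃ / s) + σ ^ 3 * a₂ / s ^ 2)
    {ψ ψt ψx w wx f DX DY : ℝ} (hw : w = d * ψx)
    (heq : ψt + wx - 2 * β * w + V * ψ - (d' * β + d * βx) * ψ = f + a * ψ)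
    (hDX : DX = 2 * (βx * w ^ 2 + 2 * β * w * wx + γx * ψ * w + γ * ψx * w + γ * ψ * wx
      + (d' * β + d * βx) * V * ψ ^ 2 + d * β * Vx * ψ ^ 2 + 2 * d * β * V * ψ * ψx)
      + σ * l ^ 2 * ((χ' + χ * l * h) * ψ * w + χ * ψx * w + χ * ψ * wx))
    (hDY : DY = Vt * ψ ^ 2 + 2 * V * ψ * ψt) :
    (ψt - 2 * β * w - γ * ψ) ^ 2
      + 1 / B ^ 6 * (σ ^ 3 * l ^ 4 * ψ ^ 2 + σ * l ^ 2 * w ^ 2) ≤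
      2 * f ^ 2 + 3 * B ^ 3 * (o * (σ ^ 3 * l ^ 4 * ψ ^ 2)) - 2 * ψt * wx + DX - DY
      + 100 * B ^ 7 * (1 / l + 1 / s) * (σ ^ 3 * l ^ 4 * ψ ^ 2 + σ * l ^ 2 * w ^ 2) := by
  have hs0 : 0 < s := by linarith
  have hl0 : 0 < l := by linarith
  have hB0 : 0 < B := by linarith
  have hd0 : 0 < d := by
    by_contra hneg
    have := mul_nonpos_of_nonneg_of_nonpos hB0.le (not_lt.1 hneg)
    linarith
  have hdabs : |d| ≤ B := by rwa [abs_of_pos hd0]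
  have hZ := zeroth_order_coeff_ge hB hs hl hσ hdabs hd' hh hh₂ ha₁ ha₂ ha₃ hβ hβx hγ hV hVx hVt
  set z := -(Vt / 2) + (d' * β + d * βx) * V + d * β * Vx - γ * V with hz
  set u := σ ^ 3 * l ^ 4 * ψ ^ 2 with hu
  set v := σ * l ^ 2 * w ^ 2 with hv
  have hu0 : 0 ≤ u := by positivity
  have hv0 : 0 ≤ v := by positivity
  set δ := 1 / l + 1 / s with hδ
  have hl1 : 0 ≤ 1 / l := by positivity
  have hs1 : 0 ≤ 1 / s := by positivity
  have hδl : 1 / l ≤ δ := by linarith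
  have hδs : 1 / s ≤ δ := by linarith
  have hδ0 : 0 ≤ δ := by linarith
  set M₁ := ψt - 2 * β * w - γ * ψ with hM₁
  set M₂ := wx + V * ψ with hM₂
  set κ := a + (d' * β + d * βx) - γ with hκ
  have hF : f + κ * ψ = M₁ + M₂ := by rw [hκ, hM₁, hM₂]; linear_combination -heq
  have hχ1 : χ ≤ 1 := hχo.trans ho
  have ho0 : 0 ≤ o := hχ0.trans hχo
  have hχabs : |χ| ≤ 1 := by rwa [abs_of_nonneg hχ0]
  -- Expansion of `(M₁ + M₂)²`, to which the divergence of `σ l² χ ψ w` is added.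
  have hident : M₁ ^ 2 + M₂ ^ 2 + 2 * (βx * w ^ 2 + γ * ψx * w + γx * ψ * w + z * ψ ^ 2)
      + σ * l ^ 2 * (χ * ψx * w) =
      (f + κ * ψ) ^ 2 - 2 * ψt * wx + DX - DY - σ * l ^ 2 * (χ' + χ * l * h) * (ψ * w)
      - σ * l ^ 2 * χ * ψ * wx := by
    rw [hF, hDX, hDY, hz, hM₁, hM₂, hw]
    ring
  -- Lower order terms.
  have hBB : ∀ n : ℕ, B ≤ B ^ (n + 1) := fun n => le_self_pow₀ hB (by omega)
  have hpow : ∀ {m n : ℕ}, m ≤ n → B ^ m ≤ B ^ n := fun hmn => pow_le_pow_right₀ hB hmn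
  have hcross := cross_term_le (ψ := ψ) (w := w) hσ hl0 hs0 hBσ
  have hcross' : σ * l ^ 3 * |ψ * w| ≤ B * δ * (u + v) :=
    hcross.trans (by gcongr)
  have hll : σ * l ^ 2 * |ψ * w| ≤ σ * l ^ 3 * |ψ * w| := by
    gcongr
    norm_num
  have hUσ : σ ^ 2 * l ^ 4 * ψ ^ 2 ≤ B * δ * u := by
    have h4 : 1 ≤ B * (1 / s) * σ := by
      rw [mul_one_div, div_mul_eq_mul_div, le_div_iff₀ hs0]; linarith
    calc σ ^ 2 * l ^ 4 * ψ ^ 2 ≤ (B * (1 / s) * σ) * (σ ^ 2 * l ^ 4 * ψ ^ 2) :=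
          le_mul_of_one_le_left (by positivity) h4
      _ = B * (1 / s) * u := by rw [hu]; ring
      _ ≤ _ := by gcongr
  -- The terms in `w²`.
  have t1 : 3 * h ^ 2 * v - B * δ * v ≤ βx * w ^ 2 + γ * ψx * w := by
    have e1 : βx * w ^ 2 + γ * ψx * w = 3 * h ^ 2 * v + (1 / l) * h₂ * v := by
      rw [hβx, hγ, hv, hw]; field_simp; ring
    have e2 : -(B * δ) ≤ (1 / l) * h₂ := by
      have : |(1 / l) * h₂| ≤ δ * B := abs_mul_le_mul' (by rwa [abs_of_nonneg hl1]) hh₂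
      linarith [(abs_le.1 this).1]
    rw [e1]
    linarith only [mul_le_mul_of_nonneg_right e2 hv0]
  -- The terms in `ψ w`.
  have t2 : -(8 * B ^ 4 * (B * δ * (u + v))) ≤ γx * ψ * w := by
    have e1 : |γx * (ψ * w)| ≤ 8 * B ^ 4 * (σ * l ^ 3 * |ψ * w|) := by
      rw [abs_mul]
      have e2 : |γx| ≤ 8 * B ^ 4 * (σ * l ^ 3) := by
        have e3 : |d' * (h * h) + 2 * (d * h * h₂) + l * (d * (h * h * h))| ≤
            B * (B * B) + 2 * (B * B * B) + l * (B * (B * B * B)) :=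
          abs_add_le_add' (abs_add_le_add' (abs_mul_le_mul' hd' (abs_mul_le_mul' hh hh))
            (abs_mul_le_mul' (abs_two (α := ℝ)).le
              (abs_mul_le_mul' (abs_mul_le_mul' hdabs hh) hh₂)))
            (abs_mul_le_mul' (abs_of_pos hl0).le (abs_mul_le_mul' hdabs
              (abs_mul_le_mul' (abs_mul_le_mul' hh hh) hh)))
        have e4 : γx = 2 * σ * l ^ 2 *
            (d' * (h * h) + 2 * (d * h * h₂) + l * (d * (h * h * h))) := by rw [hγx]; ring
        rw [e4, abs_mul, abs_of_pos (show 0 < 2 * σ * l ^ 2 by positivity)]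
        have e5 : B ^ 3 ≤ B ^ 4 * l := by
          calc B ^ 3 ≤ B ^ 4 := hpow (by norm_num)
            _ ≤ B ^ 4 * l := le_mul_of_one_le_right (by positivity) hl
        calc _ ≤ 2 * σ * l ^ 2 * (4 * (B ^ 4 * l)) := by
              refine mul_le_mul_of_nonneg_left (e3.trans ?_) (by positivity)
              calc _ = 3 * B ^ 3 + B ^ 4 * l := by ring
                _ ≤ _ := by linarith
          _ = _ := by ring
      calc _ ≤ 8 * B ^ 4 * (σ * l ^ 3) * |ψ * w| := by gcongr
        _ = _ := by ring
    have e2 : 8 * B ^ 4 * (σ * l ^ 3 * |ψ * w|) ≤ 8 * B ^ 4 * (B * δ * (u + v)) := by gcongr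
    have := (abs_le.1 (e1.trans e2)).1
    linarith
  -- The terms in `ψ²`.
  have t3 : (d ^ 2 * h ^ 4) * u - 11 * B ^ 5 * δ * u ≤ z * ψ ^ 2 := by
    have := mul_le_mul_of_nonneg_right hZ (sq_nonneg ψ)
    calc _ = (σ ^ 3 * l ^ 4 * (d ^ 2 * h ^ 4) - 11 * B ^ 5 * (σ ^ 3 * l ^ 4) * δ) * ψ ^ 2 := by
          rw [hu]; ring
      _ ≤ _ := this
  -- The terms produced by the cutoff.
  have t4 : |σ * l ^ 2 * (χ' + χ * l * h) * (ψ * w)| ≤ 2 * B * (B * δ * (u + v)) := by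
    have e1 : |χ' + χ * l * h| ≤ B + 1 * l * B :=
      abs_add_le_add' hχ' (abs_mul_le_mul' (abs_mul_le_mul' hχabs (abs_of_pos hl0).le) hh)
    have e2 : |χ' + χ * l * h| ≤ 2 * B * l := by
      have : B ≤ B * l := le_mul_of_one_le_right hB0.le hl
      linarith
    rw [abs_mul, abs_mul, abs_of_pos (show 0 < σ * l ^ 2 by positivity)]
    calc _ ≤ σ * l ^ 2 * (2 * B * l) * |ψ * w| := by gcongr
      _ = 2 * B * (σ * l ^ 3 * |ψ * w|) := by ring
      _ ≤ _ := by gcongr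
  have t5 : -(σ * l ^ 2 * χ * ψ * wx) ≤ M₂ ^ 2 / 2 + B * δ * u + 2 * B ^ 3 * (o * u) := by
    have e1 : -(σ * l ^ 2 * χ * ψ * wx) =
        -((σ * l ^ 2 * χ * ψ) * M₂) + χ * (σ * l ^ 2 * V) * ψ ^ 2 := by
      rw [hM₂]; ring
    have e2 : -((σ * l ^ 2 * χ * ψ) * M₂) ≤ M₂ ^ 2 / 2 + (σ * l ^ 2 * χ * ψ) ^ 2 / 2 := by
      linarith only [sq_nonneg (σ * l ^ 2 * χ * ψ + M₂)]
    have e3 : (σ * l ^ 2 * χ * ψ) ^ 2 ≤ σ ^ 2 * l ^ 4 * ψ ^ 2 := by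
      calc _ = χ ^ 2 * (σ ^ 2 * l ^ 4 * ψ ^ 2) := by ring
        _ ≤ 1 * (σ ^ 2 * l ^ 4 * ψ ^ 2) := by
          gcongr
          exact pow_le_one₀ hχ0 hχ1
        _ = _ := one_mul _
    have e4 : |V| ≤ 2 * B ^ 3 * (σ ^ 2 * l ^ 2) := by
      have f1 : |d * (h * h) * l ^ 2 + a₁ * (1 / s)| ≤ B * (B * B) * l ^ 2 + B * 1 := by
        refine abs_add_le_add' (abs_mul_le_mul' (abs_mul_le_mul' hdabs (abs_mul_le_mul' hh hh)) ?_)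
          (abs_mul_le_mul' ha₁ ?_)
        · rw [abs_of_nonneg (by positivity)]
        · rw [abs_of_nonneg hs1, div_le_one hs0]; exact hs
      have f2 : V = σ ^ 2 * (d * (h * h) * l ^ 2 + a₁ * (1 / s)) := by rw [hV, hβ]; ring
      have f3 : B ≤ B ^ 3 * l ^ 2 :=
        (hBB 2).trans (le_mul_of_one_le_right (by positivity) (one_le_pow₀ hl))
      rw [f2, abs_mul, abs_of_pos (show 0 < σ ^ 2 by positivity)]
      calc _ ≤ σ ^ 2 * (2 * (B ^ 3 * l ^ 2)) := by
            refine mul_le_mul_of_nonneg_left (f1.trans ?_) (by positivity)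
            calc _ = B ^ 3 * l ^ 2 + B := by ring
              _ ≤ _ := by linarith
        _ = _ := by ring
    have e5 : χ * (σ * l ^ 2 * V) * ψ ^ 2 ≤ 2 * B ^ 3 * (o * u) := by
      calc _ ≤ o * (σ * l ^ 2 * (2 * B ^ 3 * (σ ^ 2 * l ^ 2))) * ψ ^ 2 := by
            have g1 : σ * l ^ 2 * V ≤ σ * l ^ 2 * (2 * B ^ 3 * (σ ^ 2 * l ^ 2)) := by
              gcongr; exact (le_abs_self V).trans e4
            have g2 : 0 ≤ σ * l ^ 2 * (2 * B ^ 3 * (σ ^ 2 * l ^ 2)) := by positivity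
            refine mul_le_mul_of_nonneg_right ?_ (sq_nonneg ψ)
            exact (mul_le_mul_of_nonneg_left g1 hχ0).trans (mul_le_mul_of_nonneg_right hχo g2)
        _ = _ := by rw [hu]; ring
    have e6 : 0 ≤ B * δ * u := by positivity
    rw [e1]
    linarith
  -- The right-hand side.
  have t6 : (f + κ * ψ) ^ 2 ≤ 2 * f ^ 2 + 32 * B ^ 6 * (B * δ * u) := by
    have e1 : |κ| ≤ 4 * B ^ 3 * (σ * l ^ 2) := by
      have f0 : 1 ≤ B * σ * l ^ 2 := by
        have : 1 ≤ l ^ 2 := one_le_pow₀ hl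
        have : 1 ≤ B * σ := hs.trans hBσ
        exact one_le_mul_of_one_le_of_one_le ‹1 ≤ B * σ› ‹1 ≤ l ^ 2›
      have f1 : |a * 1 + σ * ((d' * h + d * h₂) * l - d * (h * h) * l ^ 2)| ≤
          B * (B * σ * l ^ 2) + σ * ((B * B + B * B) * l ^ 2 + B * (B * B) * l ^ 2) := by
        refine abs_add_le_add' (abs_mul_le_mul' ha (by rwa [abs_one])) (abs_mul_le_mul'
          (abs_of_pos hσ).le (abs_sub_le_add' (abs_mul_le_mul' (abs_add_le_add'
          (abs_mul_le_mul' hd' hh) (abs_mul_le_mul' hdabs hh₂)) ?_) (abs_mul_le_mul'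
          (abs_mul_le_mul' hdabs (abs_mul_le_mul' hh hh)) ?_)))
        · rw [abs_of_pos hl0]; exact le_self_pow₀ hl two_ne_zero
        · rw [abs_of_nonneg (by positivity)]
      have f2 : κ = a * 1 + σ * ((d' * h + d * h₂) * l - d * (h * h) * l ^ 2) := by
        rw [hκ, hγ, hβx, hβ]; ring
      rw [f2]
      refine f1.trans ?_
      have f3 : B ^ 2 * (σ * l ^ 2) ≤ B ^ 3 * (σ * l ^ 2) := by
        gcongr
        norm_num
      calc _ = 3 * (B ^ 2 * (σ * l ^ 2)) + B ^ 3 * (σ * l ^ 2) := by ring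
        _ ≤ _ := by linarith
    have e2 : κ ^ 2 ≤ (4 * B ^ 3 * (σ * l ^ 2)) ^ 2 := by
      rw [← sq_abs κ]; gcongr
    calc (f + κ * ψ) ^ 2 ≤ 2 * f ^ 2 + 2 * (κ ^ 2 * ψ ^ 2) := by
          linarith only [sq_nonneg (f - κ * ψ)]
      _ ≤ 2 * f ^ 2 + 2 * ((4 * B ^ 3 * (σ * l ^ 2)) ^ 2 * ψ ^ 2) := by gcongr
      _ = 2 * f ^ 2 + 32 * B ^ 6 * (σ ^ 2 * l ^ 4 * ψ ^ 2) := by ring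
      _ ≤ _ := by gcongr
  -- Positivity of the leading terms, inside and outside the set where the cutoff equals one.
  have t7 : 1 / B ^ 6 * v ≤ 6 * h ^ 2 * v + σ * l ^ 2 * (χ * ψx * w) := by
    have e0 : σ * l ^ 2 * (χ * ψx * w) = (χ / d) * v := by
      rw [hv, hw]; field_simp
    have e1 : 1 / B ^ 6 ≤ 6 * h ^ 2 + χ / d := by
      have f1 : 1 / B ^ 6 ≤ 1 / B := one_div_le_one_div_of_le hB0 (hBB 5)
      have f2 : 0 ≤ χ / d := by positivity
      rcases hcrit with hc | hc
      · have : 1 / B ≤ h ^ 2 := by rw [div_le_iff₀ hB0]; linarith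
        linarith only [sq_nonneg h, this, f1, f2]
      · have : 1 / B ≤ χ / d := by
          rw [hc]; exact one_div_le_one_div_of_le hd0 hd
        linarith only [sq_nonneg h, this, f1, f2]
    rw [e0, ← add_mul]
    gcongr
  have t8 : 1 / B ^ 6 * u ≤ 2 * ((d ^ 2 * h ^ 4) * u) + B ^ 3 * (o * u) := by
    have e1 : 1 / B ^ 6 ≤ 2 * (d ^ 2 * h ^ 4) + B ^ 3 * o := by
      rcases hcrit with hc | hc
      · have f1 : 1 / B ≤ h ^ 2 := by rw [div_le_iff₀ hB0]; linarith
        have f2 : 1 / B ≤ d := by rw [div_le_iff₀ hB0]; linarith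
        have f3 : (1 / B) ^ 2 * (1 / B) ^ 2 ≤ d ^ 2 * (h ^ 2) ^ 2 := by gcongr
        have f4 : 1 / B ^ 6 ≤ 1 / B ^ 4 :=
          one_div_le_one_div_of_le (by positivity) (hpow (by norm_num))
        have f5 : (1 / B) ^ 2 * (1 / B) ^ 2 = 1 / B ^ 4 := by field_simp
        have f6 : 0 ≤ B ^ 3 * o := by positivity
        have f7 : d ^ 2 * (h ^ 2) ^ 2 = d ^ 2 * h ^ 4 := by ring
        have f8 : 0 ≤ d ^ 2 * h ^ 4 := by positivity
        linarith
      · have f1 : 1 / B ^ 6 ≤ 1 := by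
          rw [div_le_one (by positivity)]; exact one_le_pow₀ hB
        have f2 : 1 ≤ B ^ 3 * o := by
          have : 1 ≤ o := hc ▸ hχo
          have : (1 : ℝ) ≤ B ^ 3 := one_le_pow₀ hB
          exact one_le_mul_of_one_le_of_one_le ‹1 ≤ B ^ 3› ‹1 ≤ o›
        have f8 : 0 ≤ d ^ 2 * h ^ 4 := by positivity
        linarith
    calc _ ≤ (2 * (d ^ 2 * h ^ 4) + B ^ 3 * o) * u := by gcongr
      _ = _ := by ring
  have t4' := (abs_le.1 t4).1
  have p0 : 0 ≤ B ^ 7 * (δ * u) := by positivity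
  have p0' : 0 ≤ B ^ 7 * (δ * v) := by positivity
  have p1 : B * (δ * u) ≤ B ^ 7 * (δ * u) := mul_le_mul_of_nonneg_right (hBB 6) (by positivity)
  have p1' : B * (δ * v) ≤ B ^ 7 * (δ * v) := mul_le_mul_of_nonneg_right (hBB 6) (by positivity)
  have p2 : B ^ 2 * (δ * u) ≤ B ^ 7 * (δ * u) :=
    mul_le_mul_of_nonneg_right (hpow (by norm_num)) (by positivity)
  have p2' : B ^ 2 * (δ * v) ≤ B ^ 7 * (δ * v) :=
    mul_le_mul_of_nonneg_right (hpow (by norm_num)) (by positivity)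
  have p5 : B ^ 5 * (δ * u) ≤ B ^ 7 * (δ * u) :=
    mul_le_mul_of_nonneg_right (hpow (by norm_num)) (by positivity)
  have p5' : B ^ 5 * (δ * v) ≤ B ^ 7 * (δ * v) :=
    mul_le_mul_of_nonneg_right (hpow (by norm_num)) (by positivity)
  have q2 : 8 * B ^ 4 * (B * δ * (u + v)) = 8 * (B ^ 5 * (δ * u)) + 8 * (B ^ 5 * (δ * v)) := by ring
  have q1 : B * δ * v = B * (δ * v) := by ring
  have q1' : B * δ * u = B * (δ * u) := by ring
  have q3 : 11 * B ^ 5 * δ * u = 11 * (B ^ 5 * (δ * u)) := by ring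
  have q4 : 2 * B * (B * δ * (u + v)) = 2 * (B ^ 2 * (δ * u)) + 2 * (B ^ 2 * (δ * v)) := by ring
  have q6 : 32 * B ^ 6 * (B * δ * u) = 32 * (B ^ 7 * (δ * u)) := by ring
  have q7 : 100 * B ^ 7 * δ * (u + v) = 100 * (B ^ 7 * (δ * u)) + 100 * (B ^ 7 * (δ * v)) := by ring
  have q8 : 0 ≤ M₂ ^ 2 := sq_nonneg _
  rw [q2] at t2
  rw [q1] at t1
  rw [q3] at t3
  rw [q4] at t4'
  rw [q1'] at t5
  rw [q6] at t6
  rw [q7, mul_add (1 / B ^ 6)]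
  clear_value u v δ z M₁ M₂ κ
  linarith only [hident, t1, t2, t3, t4', t5, t6, t7, t8, p0, p0', p1, p1', p2, p2', p5, p5', q8]

theorem sq_add_four_le (x y z w : ℝ) :
    (x + y + z + w) ^ 2 ≤ 4 * (x ^ 2 + y ^ 2 + z ^ 2 + w ^ 2) := by
  linarith only [sq_nonneg (x - y), sq_nonneg (x - z), sq_nonneg (x - w), sq_nonneg (y - z),
    sq_nonneg (y - w), sq_nonneg (z - w)]

theorem sq_add_three_le (x y z : ℝ) : (x + y + z) ^ 2 ≤ 3 * (x ^ 2 + y ^ 2 + z ^ 2) := by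
  linarith only [sq_nonneg (x - y), sq_nonneg (x - z), sq_nonneg (y - z)]

theorem sq_le_sq_of_abs_le {x b : ℝ} (h : |x| ≤ b) : x ^ 2 ≤ b ^ 2 := by
  rw [← sq_abs x]
  gcongr

/-- The weighted interior density of `∂ₜφ`, `∂ₓ(d∂ₓφ)`, `φ`, `∂ₓφ` is controlled by `M₁²` and the
weighted squares of `ψ` and `w`. -/
theorem interior_density_le {B s l σ d h a₁ a : ℝ} (hB : 1 ≤ B) (hs : 1 ≤ s)
    (hl : 1 ≤ l) (hσ : 0 < σ) (hBσ : s ≤ B * σ) (hdM : 1 ≤ B * d) (hd : d ≤ B)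
    (hh : |h| ≤ B) (ha₁ : |a₁| ≤ B) (ha : |a| ≤ B)
    {β γ : ℝ} (hβ : β = σ * l * h) (hγ : γ = 2 * σ * l ^ 2 * d * h ^ 2)
    {ψ ψx w f M₁ r₁ r₂ : ℝ} (hw : w = d * ψx)
    (hr₁ : r₁ = M₁ + 2 * β * w + γ * ψ + σ ^ 2 * a₁ / s * ψ) (hr : r₁ + r₂ = f + a * ψ) :
    σ⁻¹ * r₁ ^ 2 + σ⁻¹ * r₂ ^ 2 + σ ^ 3 * l ^ 4 * ψ ^ 2 + σ * l ^ 2 * (ψx - β * ψ) ^ 2 ≤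
      90 * B ^ 8 * (M₁ ^ 2 + (σ ^ 3 * l ^ 4 * ψ ^ 2 + σ * l ^ 2 * w ^ 2) + f ^ 2) := by
  have hs0 : 0 < s := by linarith
  have hl0 : 0 < l := by linarith
  have hB0 : 0 < B := by linarith
  have hd0 : 0 < d := by
    by_contra hneg
    have := mul_nonpos_of_nonneg_of_nonpos hB0.le (not_lt.1 hneg)
    linarith
  have hdabs : |d| ≤ B := by rwa [abs_of_pos hd0]
  set u := σ ^ 3 * l ^ 4 * ψ ^ 2 with hu
  set v := σ * l ^ 2 * w ^ 2 with hv
  have hu0 : 0 ≤ u := by positivity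
  have hv0 : 0 ≤ v := by positivity
  have hpow : ∀ {m n : ℕ}, m ≤ n → B ^ m ≤ B ^ n := fun hmn => pow_le_pow_right₀ hB hmn
  have h1σ : 1 ≤ B * σ := hs.trans hBσ
  have hσi : σ⁻¹ ≤ B := by
    rw [inv_le_comm₀ hσ hB0, inv_le_iff_one_le_mul₀' hB0]; linarith
  have hl4 : 1 ≤ l ^ 4 := one_le_pow₀ hl
  have hψ2 : ψ ^ 2 ≤ B ^ 3 * u := by
    have : 1 ≤ (B * σ) ^ 3 * l ^ 4 := one_le_mul_of_one_le_of_one_le (one_le_pow₀ h1σ) hl4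
    calc ψ ^ 2 ≤ (B * σ) ^ 3 * l ^ 4 * ψ ^ 2 := le_mul_of_one_le_left (sq_nonneg _) this
      _ = _ := by rw [hu]; ring
  have e1 : σ⁻¹ * r₁ ^ 2 ≤ 20 * B ^ 8 * (M₁ ^ 2 + (u + v)) := by
    have f1 : σ⁻¹ * M₁ ^ 2 ≤ B ^ 8 * M₁ ^ 2 := by
      gcongr
      exact hσi.trans (le_self_pow₀ hB (by norm_num))
    have f2 : σ⁻¹ * (2 * β * w) ^ 2 ≤ 4 * (B ^ 8 * v) := by
      calc _ = 4 * (h ^ 2 * v) := by rw [hβ, hv]; field_simp; ring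
        _ ≤ 4 * (B ^ 8 * v) := by
          gcongr
          exact (sq_le_sq_of_abs_le hh).trans (hpow (by norm_num))
    have f3 : σ⁻¹ * (γ * ψ) ^ 2 ≤ 4 * (B ^ 8 * u) := by
      calc _ = 4 * ((d * (h * h)) ^ 2 * (σ * l ^ 4 * ψ ^ 2)) := by rw [hγ]; field_simp; ring
        _ ≤ 4 * ((B * (B * B)) ^ 2 * (σ * l ^ 4 * ψ ^ 2)) := by
          gcongr 4 * (?_ * _)
          exact sq_le_sq_of_abs_le (abs_mul_le_mul' hdabs (abs_mul_le_mul' hh hh))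
        _ ≤ 4 * ((B * (B * B)) ^ 2 * ((B * σ) ^ 2 * (σ * l ^ 4 * ψ ^ 2))) := by
          gcongr 4 * (_ * ?_)
          exact le_mul_of_one_le_left (by positivity) (one_le_pow₀ h1σ)
        _ = _ := by rw [hu]; ring
    have f4 : σ⁻¹ * (σ ^ 2 * a₁ / s * ψ) ^ 2 ≤ B ^ 8 * u := by
      have g1 : 1 / s ^ 2 ≤ 1 := by
        rw [div_le_one (by positivity)]; exact one_le_pow₀ hs
      calc _ = a₁ ^ 2 * (1 / s ^ 2) * (σ ^ 3 * 1 * ψ ^ 2) := by field_simp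
        _ ≤ B ^ 2 * 1 * (σ ^ 3 * l ^ 4 * ψ ^ 2) := by
          gcongr ?_ * ?_ * (_ * ?_ * _)
          exact sq_le_sq_of_abs_le ha₁
        _ ≤ B ^ 8 * 1 * (σ ^ 3 * l ^ 4 * ψ ^ 2) := by
          gcongr
          norm_num
        _ = _ := by rw [mul_one]
    have f5 := mul_le_mul_of_nonneg_left
      (sq_add_four_le M₁ (2 * β * w) (γ * ψ) (σ ^ 2 * a₁ / s * ψ)) (inv_nonneg.2 hσ.le)
    rw [← hr₁] at f5
    have g1 : 0 ≤ B ^ 8 * M₁ ^ 2 := by positivity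
    have g2 : 0 ≤ B ^ 8 * v := by positivity
    linarith only [f1, f2, f3, f4, f5, g1, g2]
  have e2 : σ⁻¹ * r₂ ^ 2 ≤ 63 * B ^ 8 * (M₁ ^ 2 + (u + v)) + 3 * B ^ 8 * f ^ 2 := by
    have f0 : r₂ = f + a * ψ + -r₁ := by linarith
    have f1 : σ⁻¹ * f ^ 2 ≤ B ^ 8 * f ^ 2 := by
      gcongr
      exact hσi.trans (le_self_pow₀ hB (by norm_num))
    have f2 : σ⁻¹ * (a * ψ) ^ 2 ≤ B ^ 8 * u := by
      calc _ = σ⁻¹ * (a ^ 2 * ψ ^ 2) := by ring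
        _ ≤ B * (B ^ 2 * (B ^ 3 * u)) := by
          gcongr ?_ * (?_ * ?_)
          exact sq_le_sq_of_abs_le ha
        _ = B ^ 6 * u := by ring
        _ ≤ _ := by gcongr; norm_num
    have f5 := mul_le_mul_of_nonneg_left (sq_add_three_le f (a * ψ) (-r₁)) (inv_nonneg.2 hσ.le)
    rw [← f0, neg_sq] at f5
    have g1 : 0 ≤ B ^ 8 * M₁ ^ 2 := by positivity
    have g2 : 0 ≤ B ^ 8 * v := by positivity
    linarith only [f1, f2, f5, e1, g1, g2]
  have e3 : σ * l ^ 2 * (ψx - β * ψ) ^ 2 ≤ 2 * B ^ 8 * (u + v) := by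
    have f1 : (ψx - β * ψ) ^ 2 ≤ 2 * (ψx ^ 2 + (β * ψ) ^ 2) := by
      linarith only [sq_nonneg (ψx + β * ψ)]
    have f2 : σ * l ^ 2 * ψx ^ 2 ≤ B ^ 8 * v := by
      calc _ ≤ (B * d) ^ 2 * (σ * l ^ 2 * ψx ^ 2) :=
            le_mul_of_one_le_left (by positivity) (one_le_pow₀ hdM)
        _ = B ^ 2 * v := by rw [hv, hw]; ring
        _ ≤ _ := by gcongr; norm_num
    have f3 : σ * l ^ 2 * (β * ψ) ^ 2 ≤ B ^ 8 * u := by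
      calc _ = h ^ 2 * u := by rw [hu, hβ]; ring
        _ ≤ _ := by
          gcongr
          exact (sq_le_sq_of_abs_le hh).trans (hpow (by norm_num))
    have f4 := mul_le_mul_of_nonneg_left f1 (show 0 ≤ σ * l ^ 2 by positivity)
    linarith only [f2, f3, f4]
  have e4 : u ≤ B ^ 8 * u := le_mul_of_one_le_left hu0 (one_le_pow₀ hB)
  have g1 : 0 ≤ B ^ 8 * M₁ ^ 2 := by positivity
  have g2 : 0 ≤ B ^ 8 * v := by positivity
  have g3 : 0 ≤ B ^ 8 * u := by positivity
  have g4 : 0 ≤ B ^ 8 * f ^ 2 := by positivity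
  linarith only [e1, e2, e3, e4, g1, g2, g3, g4]

/-- The pointwise interior estimate, with all error terms absorbed. -/
theorem interior_estimate {B s l ξ d d' h h₂ αt αtt ξt χ χ' o a : ℝ} (hB : 1 ≤ B)
    (hs : 400 * B ^ 13 ≤ s) (hl : 400 * B ^ 13 ≤ l) (hξ : 0 < ξ) (hBξ : 1 ≤ B * ξ)
    (hdM : 1 ≤ B * d) (hd : d ≤ B) (hd' : |d'| ≤ B)
    (hh : |h| ≤ B) (hh₂ : |h₂| ≤ B) (hαt : |αt| ≤ B * ξ ^ 2) (hαtt : |αtt| ≤ B * ξ ^ 3)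
    (hξt : |ξt| ≤ B * ξ ^ 2)
    (hχ0 : 0 ≤ χ) (hχo : χ ≤ o) (ho : o ≤ 1) (hχ' : |χ'| ≤ B) (hcrit : 1 ≤ B * h ^ 2 ∨ χ = 1)
    (ha : |a| ≤ B)
    {β βx γ γx V Vx Vt : ℝ} (hβ : β = s * l * h * ξ)
    (hβx : βx = s * l * h₂ * ξ + s * l ^ 2 * h ^ 2 * ξ)
    (hγ : γ = 2 * s * l ^ 2 * d * h ^ 2 * ξ)
    (hγx : γx = 2 * s * l ^ 2 * (d' * h ^ 2 + 2 * d * h * h₂ + l * d * h ^ 3) * ξ)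
    (hV : V = d * β ^ 2 + s * αt)
    (hVx : Vx = d' * β ^ 2 + 2 * d * β * βx - s * l * h * ξt)
    (hVt : Vt = 2 * d * s ^ 2 * l ^ 2 * h ^ 2 * ξ * ξt + s * αtt)
    {ψ ψt ψx w wx f DX DY r₁ r₂ : ℝ} (hw : w = d * ψx)
    (hr₁ : r₁ = ψt + s * αt * ψ)
    (hr₂ : r₂ = wx - 2 * β * w + (d * β ^ 2 - (d' * β + d * βx)) * ψ)
    (heq : r₁ + r₂ = f + a * ψ)
    (hDX : DX = 2 * (βx * w ^ 2 + 2 * β * w * wx + γx * ψ * w + γ * ψx * w + γ * ψ * wx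
      + (d' * β + d * βx) * V * ψ ^ 2 + d * β * Vx * ψ ^ 2 + 2 * d * β * V * ψ * ψx)
      + s * l ^ 2 * ξ * ((χ' + χ * l * h) * ψ * w + χ * ψx * w + χ * ψ * wx))
    (hDY : DY = Vt * ψ ^ 2 + 2 * V * ψ * ψt) :
    1 / (180 * B ^ 14) * (s⁻¹ * (ξ⁻¹ * r₁ ^ 2) + s⁻¹ * (ξ⁻¹ * r₂ ^ 2)
      + s ^ 3 * l ^ 4 * (ξ ^ 3 * ψ ^ 2) + s * l ^ 2 * (ξ * (ψx - β * ψ) ^ 2)) ≤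
      3 * B ^ 3 * (f ^ 2 + s ^ 3 * l ^ 4 * (o * (ξ ^ 3 * ψ ^ 2))) - 2 * ψt * wx + DX - DY := by
  have hB0 : 0 < B := by linarith
  have hN : 1 ≤ 400 * B ^ 13 := by
    have : 1 ≤ B ^ 13 := one_le_pow₀ hB
    linarith
  have hs1 := hN.trans hs
  have hl1 := hN.trans hl
  have hs0 : 0 < s := by linarith
  have hl0 : 0 < l := by linarith
  set σ := s * ξ with hσ
  have hσ0 : 0 < σ := by positivity
  have hBσ : s ≤ B * σ := by
    calc s ≤ s * (B * ξ) := le_mul_of_one_le_right hs0.le hBξ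
      _ = _ := by rw [hσ]; ring
  have hnorm : ∀ {y : ℝ} {n : ℕ}, |y| ≤ B * ξ ^ n → |y / ξ ^ n| ≤ B := by
    intro y n hy
    rw [abs_div, abs_of_pos (show 0 < ξ ^ n by positivity), div_le_iff₀ (by positivity)]
    exact hy
  have q1 : s * αt = σ ^ 2 * (αt / ξ ^ 2) / s := by rw [hσ]; field_simp
  have q3 : s * ξt = σ ^ 2 * (ξt / ξ ^ 2) / s := by rw [hσ]; field_simp
  have q2 : s * αtt = σ ^ 3 * (αtt / ξ ^ 3) / s ^ 2 := by rw [hσ]; field_simp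
  have hβ' : β = σ * l * h := by rw [hβ, hσ]; ring
  have hγ' : γ = 2 * σ * l ^ 2 * d * h ^ 2 := by rw [hγ, hσ]; ring
  have core := interior_core (Vx := Vx) (Vt := Vt) hB hs1 hl1 hσ0 hBσ hdM hd hd' hh hh₂
    (hnorm hαt) (hnorm hαtt) (hnorm hξt) hχ0 hχo ho hχ' hcrit ha hβ'
    (show βx = σ * l * h₂ + σ * l ^ 2 * h ^ 2 by rw [hβx, hσ]; ring) hγ'
    (show γx = 2 * σ * l ^ 2 * (d' * h ^ 2 + 2 * d * h * h₂ + l * d * h ^ 3) by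
      rw [hγx, hσ]; ring)
    (by rw [hV, q1]) (by rw [hVx, ← q3]; ring) (by rw [hVt, ← q3, ← q2, hσ]; ring)
    (f := f) (ψ := ψ) (ψt := ψt) (wx := wx) hw (by linear_combination heq - hr₁ - hr₂ + ψ * hV)
    (hDX.trans (by rw [hσ]; ring)) hDY
  have dens := interior_density_le hB hs1 hl1 hσ0 hBσ hdM hd hh (hnorm hαt) ha hβ' hγ' (ψ := ψ)
    (M₁ := ψt - 2 * β * w - γ * ψ) (r₁ := r₁) hw (by rw [hr₁, q1]; ring) heq
  set G := σ ^ 3 * l ^ 4 * ψ ^ 2 + σ * l ^ 2 * w ^ 2 with hG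
  have hG0 : 0 ≤ G := by positivity
  -- the threshold on `l` and `s` lets half of the leading terms absorb the errors
  have hδ : 100 * B ^ 7 * (1 / l + 1 / s) ≤ 1 / (2 * B ^ 6) := by
    have e1 : 1 / l ≤ 1 / (400 * B ^ 13) := one_div_le_one_div_of_le (by positivity) hl
    have e2 : 1 / s ≤ 1 / (400 * B ^ 13) := one_div_le_one_div_of_le (by positivity) hs
    calc _ ≤ 100 * B ^ 7 * (1 / (400 * B ^ 13) + 1 / (400 * B ^ 13)) := by gcongr
      _ = _ := by field_simp; norm_num
  have hδG := mul_le_mul_of_nonneg_right hδ hG0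
  set M₁ := ψt - 2 * β * w - γ * ψ with hM₁
  have hid : s⁻¹ * (ξ⁻¹ * r₁ ^ 2) + s⁻¹ * (ξ⁻¹ * r₂ ^ 2) + s ^ 3 * l ^ 4 * (ξ ^ 3 * ψ ^ 2)
      + s * l ^ 2 * (ξ * (ψx - β * ψ) ^ 2) = σ⁻¹ * r₁ ^ 2 + σ⁻¹ * r₂ ^ 2 + σ ^ 3 * l ^ 4 * ψ ^ 2
      + σ * l ^ 2 * (ψx - β * ψ) ^ 2 := by
    rw [hσ, mul_inv]; ring
  rw [hid]
  have ho' : s ^ 3 * l ^ 4 * (o * (ξ ^ 3 * ψ ^ 2)) = o * (σ ^ 3 * l ^ 4 * ψ ^ 2) := by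
    rw [hσ]; ring
  rw [ho']
  have dens' := mul_le_mul_of_nonneg_left dens (show 0 ≤ 1 / (180 * B ^ 14) by positivity)
  have e5 : 1 / (180 * B ^ 14) * (90 * B ^ 8 * (M₁ ^ 2 + G + f ^ 2)) =
      1 / (2 * B ^ 6) * (M₁ ^ 2 + G + f ^ 2) := by field_simp; ring
  rw [e5] at dens'
  have e6 : 1 / (2 * B ^ 6) ≤ 1 := by
    rw [div_le_one (by positivity)]
    have : 1 ≤ B ^ 6 := one_le_pow₀ hB
    linarith
  have e7 := mul_le_mul_of_nonneg_right e6 (sq_nonneg M₁)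
  have e8 := mul_le_mul_of_nonneg_right e6 (sq_nonneg f)
  have e9 : 1 / B ^ 6 * G = 2 * (1 / (2 * B ^ 6) * G) := by field_simp
  have e10 : f ^ 2 ≤ B ^ 3 * f ^ 2 := le_mul_of_one_le_left (sq_nonneg f) (one_le_pow₀ hB)
  rw [e9] at core
  linarith only [core, dens', e7, e8, e10, hδG]

/-! ### The pointwise boundary estimate -/

set_option maxHeartbeats 1000000 in
/-- The pointwise boundary estimate: the dynamic boundary condition turns the flux `2ν∂ₜψ w` into
`2w²` plus lower order terms, and `ν∂ₓη < 0` makes the remaining boundary terms positive. -/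
theorem boundary_estimate {B s l ξ d h αt ν b : ℝ} (hB : 1 ≤ B)
    (hs : 400 * B ^ 13 ≤ s) (hl : 400 * B ^ 13 ≤ l) (hξ : 0 < ξ) (hBξ : 1 ≤ B * ξ)
    (hdM : 1 ≤ B * d) (hd : d ≤ B) (hh : |h| ≤ B) (hαt : |αt| ≤ B * ξ ^ 2)
    (hν : ν ^ 2 = 1) (hνh : 1 ≤ B * -(ν * h)) (hb : |b| ≤ B)
    {β γ V : ℝ} (hβ : β = s * l * h * ξ) (hγ : γ = 2 * s * l ^ 2 * d * h ^ 2 * ξ)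
    (hV : V = d * β ^ 2 + s * αt)
    {ψ ψt ψx w k r₁ : ℝ} (hw : w = d * ψx)
    (hr₁ : r₁ = ψt + s * αt * ψ) (heq : r₁ = k + ν * (w - d * β * ψ) + b * ψ) :
    1 / (180 * B ^ 14) * (s⁻¹ * (ξ⁻¹ * r₁ ^ 2) + s ^ 3 * l ^ 3 * (ξ ^ 3 * ψ ^ 2)
      + s * l * (ξ * (ψx - β * ψ) ^ 2)) ≤
      3 * B ^ 3 * k ^ 2 + 2 * (ν * (ψt * w))
        - 2 * (ν * (β * w ^ 2 + γ * ψ * w + d * β * V * ψ ^ 2)) := by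
  have hB0 : 0 < B := by linarith
  have hB13 : 1 ≤ B ^ 13 := one_le_pow₀ hB
  have hs1 : 1 ≤ s := by linarith
  have hl1 : 1 ≤ l := by linarith
  have hs0 : 0 < s := by linarith
  have hl0 : 0 < l := by linarith
  set σ := s * ξ with hσ
  have hσ0 : 0 < σ := by positivity
  have hBσ : s ≤ B * σ := by
    calc s ≤ s * (B * ξ) := le_mul_of_one_le_right hs0.le hBξ
      _ = _ := by rw [hσ]; ring
  have h1σ : 1 ≤ B * σ := hs1.trans hBσ
  have hσi : σ⁻¹ ≤ B := by
    rw [inv_le_comm₀ hσ0 hB0, inv_le_iff_one_le_mul₀' hB0]; linarith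
  have hσs : 1 ≤ B * (1 / s) * σ := by
    rw [mul_one_div, div_mul_eq_mul_div, le_div_iff₀ hs0]; linarith
  have ha₁ : |αt / ξ ^ 2| ≤ B := by
    rw [abs_div, abs_of_pos (show 0 < ξ ^ 2 by positivity), div_le_iff₀ (by positivity)]
    exact hαt
  have q1 : s * αt = σ ^ 2 * (αt / ξ ^ 2) / s := by rw [hσ]; field_simp
  set a₁ := αt / ξ ^ 2 with ha₁def
  have hβ' : β = σ * l * h := by rw [hβ, hσ]; ring
  have hγ' : γ = 2 * σ * l ^ 2 * d * h ^ 2 := by rw [hγ, hσ]; ring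
  have hd0 : 0 < d := by
    by_contra hneg
    have := mul_nonpos_of_nonneg_of_nonpos hB0.le (not_lt.1 hneg)
    linarith
  have hdabs : |d| ≤ B := by rwa [abs_of_pos hd0]
  have hνabs : |ν| ≤ 1 := by
    rw [← sq_le_one_iff_abs_le_one, hν]
  set g := -(ν * h) with hg
  have hgB : 1 / B ≤ g := by rw [div_le_iff₀ hB0]; linarith
  have hg0 : 0 < g := lt_of_lt_of_le (by positivity) hgB
  have hgh : g ^ 2 = h ^ 2 := by rw [hg]; linear_combination h ^ 2 * hν
  have hgabs : |g| ≤ B := by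
    rw [hg, abs_neg]
    exact (abs_mul_le_mul' hνabs hh).trans (one_mul B).le
  set u := σ ^ 3 * l ^ 3 * ψ ^ 2 with hu
  set v := σ * l * w ^ 2 with hv
  have hu0 : 0 ≤ u := by positivity
  have hv0 : 0 ≤ v := by positivity
  have hpow : ∀ {m n : ℕ}, m ≤ n → B ^ m ≤ B ^ n := fun hmn => pow_le_pow_right₀ hB hmn
  -- Bounds for the mixed terms.
  have h3 : σ * l * |ψ * w| ≤ σ ^ 2 * l ^ 2 * ψ ^ 2 + w ^ 2 := by
    have h1 := two_mul_le_add_sq (σ * l * |ψ|) |w|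
    rw [mul_pow, sq_abs, sq_abs] at h1
    have h2 : 0 ≤ σ * l * |ψ * w| := by positivity
    rw [abs_mul] at h2 ⊢
    linarith only [h1, h2]
  have hmix : σ * l ^ 2 * |ψ * w| ≤ B * (1 / s) * (u + v) := by
    calc σ * l ^ 2 * |ψ * w| = l * (σ * l * |ψ * w|) := by ring
      _ ≤ l * (σ ^ 2 * l ^ 2 * ψ ^ 2 + w ^ 2) := by gcongr
      _ ≤ (B * (1 / s) * σ) * (l * (σ ^ 2 * l ^ 2 * ψ ^ 2 + w ^ 2)) :=
        le_mul_of_one_le_left (by positivity) hσs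
      _ = _ := by rw [hu, hv]; ring
  have hmix2 : σ ^ 2 * (1 / s) * |ψ * w| ≤ 1 / s * (u + v) := by
    calc σ ^ 2 * (1 / s) * |ψ * w| ≤ l ^ 2 * (σ ^ 2 * (1 / s) * |ψ * w|) :=
          le_mul_of_one_le_left (by positivity) (one_le_pow₀ hl1)
      _ = 1 / s * (σ * l * (σ * l * |ψ * w|)) := by ring
      _ ≤ 1 / s * (σ * l * (σ ^ 2 * l ^ 2 * ψ ^ 2 + w ^ 2)) := by gcongr
      _ = _ := by rw [hu, hv]; ring
  have hmix0 : σ * l * |ψ * w| ≤ σ * l ^ 2 * |ψ * w| := by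
    gcongr
    exact le_self_pow₀ hl1 two_ne_zero
  have hmix1 : |ψ * w| ≤ B * (σ * l ^ 2 * |ψ * w|) := by
    have : 1 ≤ B * σ * l ^ 2 := one_le_mul_of_one_le_of_one_le h1σ (one_le_pow₀ hl1)
    calc _ ≤ B * σ * l ^ 2 * |ψ * w| := le_mul_of_one_le_left (abs_nonneg _) this
      _ = _ := by ring
  have hm0 : 0 ≤ |ψ * w| := abs_nonneg _
  -- The individual boundary terms.
  have s1 : -(w ^ 2) - k ^ 2 ≤ 2 * (ν * k * w) := by
    have : (ν * k) ^ 2 = k ^ 2 := by rw [mul_pow, hν, one_mul]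
    linarith only [sq_nonneg (ν * k + w), this]
  have s2 : |-2 * (d * h) * (σ * l * (ψ * w))| ≤ 2 * B ^ 3 * (1 / s * (u + v)) := by
    have e1 : |-2 * (d * h)| ≤ 2 * (B * B) :=
      abs_mul_le_mul' (by norm_num) (abs_mul_le_mul' hdabs hh)
    rw [abs_mul, abs_mul (σ * l), abs_of_pos (show 0 < σ * l by positivity)]
    calc _ ≤ 2 * (B * B) * (B * (1 / s) * (u + v)) :=
          mul_le_mul e1 (hmix0.trans hmix) (by positivity) (by positivity)
      _ = _ := by ring
  have s3 : |2 * (ν * b) * (ψ * w)| ≤ 2 * B ^ 3 * (1 / s * (u + v)) := by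
    have e1 : |2 * (ν * b)| ≤ 2 * (1 * B) :=
      abs_mul_le_mul' (abs_two (α := ℝ)).le (abs_mul_le_mul' hνabs hb)
    rw [abs_mul]
    calc _ ≤ 2 * (1 * B) * (B * (B * (1 / s) * (u + v))) := by
          gcongr
          exact hmix1.trans (by gcongr)
      _ = _ := by ring
  have s4 : |-2 * (ν * a₁) * (σ ^ 2 * (1 / s) * (ψ * w))| ≤ 2 * B * (1 / s * (u + v)) := by
    have e1 : |-2 * (ν * a₁)| ≤ 2 * (1 * B) :=
      abs_mul_le_mul' (by norm_num) (abs_mul_le_mul' hνabs ha₁)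
    rw [abs_mul, abs_mul (σ ^ 2 * (1 / s)), abs_of_pos (show 0 < σ ^ 2 * (1 / s) by positivity)]
    calc _ ≤ 2 * (1 * B) * (1 / s * (u + v)) := by gcongr
      _ = _ := by ring
  have s5 : |-4 * (ν * (d * (h * h))) * (σ * l ^ 2 * (ψ * w))| ≤ 4 * B ^ 4 * (1 / s * (u + v)) := by
    have e1 : |-4 * (ν * (d * (h * h)))| ≤ 4 * (1 * (B * (B * B))) :=
      abs_mul_le_mul' (by norm_num) (abs_mul_le_mul' hνabs (abs_mul_le_mul' hdabs
        (abs_mul_le_mul' hh hh)))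
    rw [abs_mul, abs_mul (σ * l ^ 2), abs_of_pos (show 0 < σ * l ^ 2 by positivity)]
    calc _ ≤ 4 * (1 * (B * (B * B))) * (B * (1 / s) * (u + v)) := by gcongr
      _ = _ := by ring
  have s6 : |2 * (d * g * a₁) * (1 / s * (σ ^ 3 * l * ψ ^ 2))| ≤ 2 * B ^ 3 * (1 / s * (u + v)) := by
    have e1 : |2 * (d * g * a₁)| ≤ 2 * (B * B * B) :=
      abs_mul_le_mul' (abs_two (α := ℝ)).le (abs_mul_le_mul' (abs_mul_le_mul' hdabs hgabs) ha₁)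
    have e2 : σ ^ 3 * l * ψ ^ 2 ≤ u + v := by
      have : σ ^ 3 * l * ψ ^ 2 ≤ σ ^ 3 * l ^ 3 * ψ ^ 2 := by
        gcongr
        exact le_self_pow₀ hl1 three_ne_zero
      linarith only [this, hu, hv0]
    rw [abs_mul, abs_of_nonneg (show 0 ≤ 1 / s * (σ ^ 3 * l * ψ ^ 2) by positivity)]
    calc _ ≤ 2 * (B * B * B) * (1 / s * (u + v)) := by gcongr
      _ = _ := by ring
  have hψt : ψt = k + ν * (w - d * β * ψ) + b * ψ - σ ^ 2 * a₁ / s * ψ := by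
    linear_combination heq - hr₁ - ψ * q1
  have hsum : 2 * (ν * (ψt * w)) - 2 * (ν * (β * w ^ 2 + γ * ψ * w + d * β * V * ψ ^ 2)) =
      2 * w ^ 2 + 2 * g * v + 2 * (d ^ 2 * g ^ 3) * u + 2 * (ν * k * w)
      + -2 * (d * h) * (σ * l * (ψ * w)) + 2 * (ν * b) * (ψ * w)
      + -2 * (ν * a₁) * (σ ^ 2 * (1 / s) * (ψ * w))
      + -4 * (ν * (d * (h * h))) * (σ * l ^ 2 * (ψ * w))
      + 2 * (d * g * a₁) * (1 / s * (σ ^ 3 * l * ψ ^ 2)) := by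
    have e1 : g ^ 3 = -(ν * h) * h ^ 2 := by
      calc g ^ 3 = g * g ^ 2 := by ring
        _ = _ := by rw [hgh]
    rw [hV, q1, hψt, e1, hγ', hβ', hg, hv, hu]
    linear_combination (2 * w ^ 2 - 2 * (d * h) * (σ * l * (ψ * w))) * hν
  have s7 : 2 / B ^ 5 * (u + v) ≤ 2 * g * v + 2 * (d ^ 2 * g ^ 3) * u := by
    have f1 : 1 / B ≤ d := by rw [div_le_iff₀ hB0]; linarith
    have f2 : 1 / B ^ 5 ≤ d ^ 2 * g ^ 3 := by
      calc 1 / B ^ 5 = (1 / B) ^ 2 * (1 / B) ^ 3 := by field_simp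
        _ ≤ _ := by gcongr
    have f3 : 1 / B ^ 5 ≤ g :=
      (one_div_le_one_div_of_le hB0 (le_self_pow₀ hB (by norm_num))).trans hgB
    have f4 := mul_le_mul_of_nonneg_right f2 hu0
    have f5 := mul_le_mul_of_nonneg_right f3 hv0
    have f6 : 2 / B ^ 5 * (u + v) = 2 * (1 / B ^ 5 * u) + 2 * (1 / B ^ 5 * v) := by ring
    rw [f6]
    linarith only [f4, f5]
  have s8 : 12 * B ^ 4 * (1 / s * (u + v)) ≤ 1 / B ^ 5 * (u + v) := by
    have : 12 * B ^ 4 * (1 / s) ≤ 1 / B ^ 5 := by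
      have e1 : 1 / s ≤ 1 / (400 * B ^ 13) := one_div_le_one_div_of_le (by positivity) hs
      have e2 : 1 / (400 * B ^ 13) ≤ 1 / (12 * B ^ 9) := by
        refine one_div_le_one_div_of_le (by positivity) ?_
        have := hpow (show 9 ≤ 13 by norm_num)
        have h0 : 0 ≤ B ^ 9 := by positivity
        linarith
      calc _ ≤ 12 * B ^ 4 * (1 / (12 * B ^ 9)) := by
            gcongr 12 * B ^ 4 * ?_; exact e1.trans e2
        _ = _ := by field_simp
    have := mul_le_mul_of_nonneg_right this (add_nonneg hu0 hv0)
    linarith only [this]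
  have hE0 : 0 ≤ 1 / s * (u + v) := by positivity
  have hE1 : B * (1 / s * (u + v)) ≤ B ^ 4 * (1 / s * (u + v)) := by
    gcongr; exact le_self_pow₀ hB (by norm_num)
  have hE3 : B ^ 3 * (1 / s * (u + v)) ≤ B ^ 4 * (1 / s * (u + v)) := by
    gcongr; norm_num
  have hmain : 1 / B ^ 5 * (u + v) ≤ k ^ 2 + (2 * (ν * (ψt * w))
      - 2 * (ν * (β * w ^ 2 + γ * ψ * w + d * β * V * ψ ^ 2))) := by
    rw [hsum]
    have e : 2 / B ^ 5 * (u + v) = 2 * (1 / B ^ 5 * (u + v)) := by ring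
    rw [e] at s7
    linarith only [s1, (abs_le.1 s2).1, (abs_le.1 s3).1, (abs_le.1 s4).1, (abs_le.1 s5).1,
      (abs_le.1 s6).1, s7, s8, hE0, hE1, hE3, sq_nonneg w]
  -- The boundary density.
  have hψ2 : ψ ^ 2 ≤ B ^ 3 * u := by
    have : 1 ≤ (B * σ) ^ 3 * l ^ 3 :=
      one_le_mul_of_one_le_of_one_le (one_le_pow₀ h1σ) (one_le_pow₀ hl1)
    calc ψ ^ 2 ≤ (B * σ) ^ 3 * l ^ 3 * ψ ^ 2 := le_mul_of_one_le_left (sq_nonneg _) this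
      _ = _ := by rw [hu]; ring
  have hdens : σ⁻¹ * r₁ ^ 2 + u + σ * l * (ψx - β * ψ) ^ 2 ≤ 15 * B ^ 6 * (k ^ 2 + (u + v)) := by
    have f1 : σ⁻¹ * k ^ 2 ≤ B ^ 6 * k ^ 2 := by
      gcongr
      exact hσi.trans (le_self_pow₀ hB (by norm_num))
    have f2 : σ⁻¹ * (ν * w) ^ 2 ≤ B ^ 6 * v := by
      calc σ⁻¹ * (ν * w) ^ 2 = σ⁻¹ * w ^ 2 := by rw [mul_pow, hν, one_mul]
        _ ≤ B * w ^ 2 := by gcongr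
        _ ≤ (B * σ * l) * (B * w ^ 2) :=
          le_mul_of_one_le_left (by positivity) (one_le_mul_of_one_le_of_one_le h1σ hl1)
        _ = B ^ 2 * v := by rw [hv]; ring
        _ ≤ _ := by gcongr; norm_num
    have f3 : σ⁻¹ * (-(ν * (d * β * ψ))) ^ 2 ≤ B ^ 6 * u := by
      calc σ⁻¹ * (-(ν * (d * β * ψ))) ^ 2 = (d * h) ^ 2 * (σ * l ^ 2 * ψ ^ 2) := by
            rw [neg_sq, mul_pow, hν, hβ']; field_simp
        _ ≤ (B * B) ^ 2 * (σ * l ^ 2 * ψ ^ 2) := by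
          gcongr ?_ * _
          exact sq_le_sq_of_abs_le (abs_mul_le_mul' hdabs hh)
        _ ≤ (B * B) ^ 2 * (((B * σ) ^ 2 * l) * (σ * l ^ 2 * ψ ^ 2)) := by
          gcongr _ * ?_
          exact le_mul_of_one_le_left (by positivity)
            (one_le_mul_of_one_le_of_one_le (one_le_pow₀ h1σ) hl1)
        _ = _ := by rw [hu]; ring
    have f4 : σ⁻¹ * (b * ψ) ^ 2 ≤ B ^ 6 * u := by
      calc σ⁻¹ * (b * ψ) ^ 2 = σ⁻¹ * (b ^ 2 * ψ ^ 2) := by ring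
        _ ≤ B * (B ^ 2 * (B ^ 3 * u)) := by
          gcongr ?_ * (?_ * ?_)
          exact sq_le_sq_of_abs_le hb
        _ = _ := by ring
    have f5 := mul_le_mul_of_nonneg_left
      (sq_add_four_le k (ν * w) (-(ν * (d * β * ψ))) (b * ψ)) (inv_nonneg.2 hσ0.le)
    have f6 : k + ν * w + -(ν * (d * β * ψ)) + b * ψ = r₁ := by rw [heq]; ring
    rw [f6] at f5
    have f7 : (ψx - β * ψ) ^ 2 ≤ 2 * (ψx ^ 2 + (β * ψ) ^ 2) := by
      linarith only [sq_nonneg (ψx + β * ψ)]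
    have f8 : σ * l * ψx ^ 2 ≤ B ^ 6 * v := by
      calc _ ≤ (B * d) ^ 2 * (σ * l * ψx ^ 2) :=
            le_mul_of_one_le_left (by positivity) (one_le_pow₀ hdM)
        _ = B ^ 2 * v := by rw [hv, hw]; ring
        _ ≤ _ := by gcongr; norm_num
    have f9 : σ * l * (β * ψ) ^ 2 ≤ B ^ 6 * u := by
      calc _ = h ^ 2 * u := by rw [hu, hβ']; ring
        _ ≤ _ := by
          gcongr
          exact (sq_le_sq_of_abs_le hh).trans (hpow (by norm_num))
    have f10 := mul_le_mul_of_nonneg_left f7 (show 0 ≤ σ * l by positivity)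
    have f11 : u ≤ B ^ 6 * u := le_mul_of_one_le_left hu0 (one_le_pow₀ hB)
    have g1 : 0 ≤ B ^ 6 * k ^ 2 := by positivity
    have g2 : 0 ≤ B ^ 6 * v := by positivity
    have g3 : 0 ≤ B ^ 6 * u := by positivity
    linarith only [f1, f2, f3, f4, f5, f8, f9, f10, f11, g1, g2, g3]
  have hid : s⁻¹ * (ξ⁻¹ * r₁ ^ 2) + s ^ 3 * l ^ 3 * (ξ ^ 3 * ψ ^ 2)
      + s * l * (ξ * (ψx - β * ψ) ^ 2) = σ⁻¹ * r₁ ^ 2 + u + σ * l * (ψx - β * ψ) ^ 2 := by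
    rw [hu, hσ, mul_inv]; ring
  rw [hid]
  have hK0 : 0 ≤ k ^ 2 + (u + v) := by positivity
  have c1 := mul_le_mul_of_nonneg_left hdens (show 0 ≤ 1 / (180 * B ^ 14) by positivity)
  have c2 : 1 / (180 * B ^ 14) * (15 * B ^ 6 * (k ^ 2 + (u + v))) ≤
      1 / B ^ 5 * (k ^ 2 + (u + v)) := by
    rw [← mul_assoc]
    refine mul_le_mul_of_nonneg_right ?_ hK0
    have : 1 / (180 * B ^ 14) * (15 * B ^ 6) = 1 / (12 * B ^ 8) := by field_simp; norm_num
    rw [this]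
    refine one_div_le_one_div_of_le (by positivity) ?_
    have := hpow (show 5 ≤ 8 by norm_num)
    have h0 : 0 ≤ B ^ 8 := by positivity
    linarith only [this, h0]
  have c3 : 1 / B ^ 5 * k ^ 2 ≤ 1 * k ^ 2 := by
    refine mul_le_mul_of_nonneg_right ?_ (sq_nonneg k)
    rw [div_le_one (by positivity)]; exact one_le_pow₀ hB
  have c4 : k ^ 2 ≤ B ^ 3 * k ^ 2 := le_mul_of_one_le_left (sq_nonneg k) (one_le_pow₀ hB)
  linarith only [c1, c2, c3, c4, hmain, sq_nonneg k]

/-! ### Growth and decay with respect to a weight -/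

theorem HasACDerivOn.exp {a b : ℝ} (hab : a ≤ b) {f f' : ℝ → ℝ} (hf : HasACDerivOn a b f f') :
    HasACDerivOn a b (fun x => Real.exp (f x)) (fun x => f' x * Real.exp (f x)) := by
  refine ⟨?_, ?_⟩
  · obtain ⟨r, hr⟩ := (isCompact_Icc.image_of_continuousOn
      (hf.continuousOn hab)).isBounded.subset_closedBall 0
    obtain ⟨K, hL⟩ := (Real.contDiff_exp (n := 1)).contDiffOn.exists_lipschitzOnWith (by decide)
      (convex_closedBall (0 : ℝ) r) (isCompact_closedBall 0 r)
    have hac := hf.ac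
    rw [absolutelyContinuousOnInterval_iff] at hac ⊢
    intro ε hε
    obtain ⟨δ, hδ, h1⟩ := hac (ε / (K + 1)) (by positivity)
    refine ⟨δ, hδ, fun I hI hI' => ?_⟩
    have h2 := h1 I hI hI'
    have hmem : ∀ y ∈ uIcc a b, f y ∈ Metric.closedBall (0 : ℝ) r :=
      fun y hy => hr (mem_image_of_mem _ (by rwa [uIcc_of_le hab] at hy))
    calc _ ≤ ∑ i ∈ Finset.range I.1, (K : ℝ) * dist (f (I.2 i).1) (f (I.2 i).2) :=
          Finset.sum_le_sum fun i hi => hL.dist_le_mul _ (hmem _ (hI.1 i hi).1) _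
            (hmem _ (hI.1 i hi).2)
      _ = K * ∑ i ∈ Finset.range I.1, dist (f (I.2 i).1) (f (I.2 i).2) := by rw [Finset.mul_sum]
      _ ≤ K * (ε / (K + 1)) := by gcongr
      _ < (K + 1) * (ε / (K + 1)) := by
        have : 0 < ε / ((K : ℝ) + 1) := by positivity
        gcongr
        linarith
      _ = ε := by field_simp
  · filter_upwards [hf.hasDerivAt] with x hx
    convert hx.exp using 1
    exact mul_comm _ _

/-- `c` is measurable and bounded by a power of the weight `Θ`. -/
def PolyBounded {α : Type*} [MeasurableSpace α] (μ : Measure α) (Θ c : α → ℝ) : Prop :=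
  AEStronglyMeasurable c μ ∧ ∃ (k : ℕ) (C : ℝ), 0 ≤ C ∧ ∀ᵐ z ∂μ, |c z| ≤ C * Θ z ^ k

/-- `f` is square integrable against every power of the weight `Θ`. -/
def RapidL2 {α : Type*} [MeasurableSpace α] (μ : Measure α) (Θ f : α → ℝ) : Prop :=
  ∀ k : ℕ, MemLp (fun z => Θ z ^ k * f z) 2 μ

namespace PolyBounded

variable {α : Type*} [MeasurableSpace α] {μ : Measure α} {Θ c c' : α → ℝ}

theorem of_bounded (hc : AEStronglyMeasurable c μ) (C : ℝ) (h : ∀ᵐ z ∂μ, |c z| ≤ C) :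
    PolyBounded μ Θ c := by
  refine ⟨hc, 0, |C|, abs_nonneg _, ?_⟩
  filter_upwards [h] with z hz
  simpa using hz.trans (le_abs_self C)

theorem const (a : ℝ) : PolyBounded μ Θ fun _ => a :=
  of_bounded aestronglyMeasurable_const |a| (ae_of_all _ fun _ => le_rfl)

theorem mul (hc : PolyBounded μ Θ c) (hc' : PolyBounded μ Θ c') :
    PolyBounded μ Θ fun z => c z * c' z := by
  obtain ⟨m, k, C, hC, h⟩ := hc
  obtain ⟨m', k', C', hC', h'⟩ := hc'
  refine ⟨m.mul m', k + k', C * C', mul_nonneg hC hC', ?_⟩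
  filter_upwards [h, h'] with z hz hz'
  exact (abs_mul_le_mul' hz hz').trans (le_of_eq (by ring))

theorem add (hΘ : ∀ z, 1 ≤ Θ z) (hc : PolyBounded μ Θ c) (hc' : PolyBounded μ Θ c') :
    PolyBounded μ Θ fun z => c z + c' z := by
  obtain ⟨m, k, C, hC, h⟩ := hc
  obtain ⟨m', k', C', hC', h'⟩ := hc'
  refine ⟨m.add m', k + k', C + C', add_nonneg hC hC', ?_⟩
  filter_upwards [h, h'] with z hz hz'
  have e1 : Θ z ^ k ≤ Θ z ^ (k + k') := pow_le_pow_right₀ (hΘ z) (by omega)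
  have e2 : Θ z ^ k' ≤ Θ z ^ (k + k') := pow_le_pow_right₀ (hΘ z) (by omega)
  refine (abs_add_le_add' hz hz').trans ?_
  rw [add_mul]
  gcongr

theorem neg (hc : PolyBounded μ Θ c) : PolyBounded μ Θ fun z => -c z := by
  obtain ⟨m, k, C, hC, h⟩ := hc
  exact ⟨m.neg, k, C, hC, by simpa using h⟩

theorem sub (hΘ : ∀ z, 1 ≤ Θ z) (hc : PolyBounded μ Θ c) (hc' : PolyBounded μ Θ c') :
    PolyBounded μ Θ fun z => c z - c' z := by
  simpa only [sub_eq_add_neg] using hc.add hΘ hc'.neg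

theorem pow (hc : PolyBounded μ Θ c) (n : ℕ) : PolyBounded μ Θ fun z => c z ^ n := by
  induction n with
  | zero => simpa using const (1 : ℝ)
  | succ n ih => simpa only [pow_succ] using ih.mul hc

end PolyBounded

namespace RapidL2

variable {α : Type*} [MeasurableSpace α] {μ : Measure α} {Θ c f g : α → ℝ}

theorem memLp (hf : RapidL2 μ Θ f) : MemLp f 2 μ := by simpa using hf 0

theorem add (hf : RapidL2 μ Θ f) (hg : RapidL2 μ Θ g) : RapidL2 μ Θ fun z => f z + g z := by
  intro k
  exact ((hf k).add (hg k)).ae_eq (ae_of_all _ fun z => by simp only [Pi.add_apply]; ring)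

theorem sub (hf : RapidL2 μ Θ f) (hg : RapidL2 μ Θ g) : RapidL2 μ Θ fun z => f z - g z := by
  intro k
  exact ((hf k).sub (hg k)).ae_eq (ae_of_all _ fun z => by simp only [Pi.sub_apply]; ring)

theorem smul (hf : RapidL2 μ Θ f) (hc : PolyBounded μ Θ c) : RapidL2 μ Θ fun z => c z * f z := by
  obtain ⟨m, k', C, hC, h⟩ := hc
  intro k
  refine (hf (k + k')).of_le_mul (c := C) ?_ ?_
  · have := m.mul (hf k).1
    refine this.congr (ae_of_all _ fun z => ?_)
    simp only [Pi.mul_apply]; ring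
  · filter_upwards [h] with z hz
    rw [Real.norm_eq_abs, Real.norm_eq_abs]
    calc |Θ z ^ k * (c z * f z)| = |c z| * |Θ z ^ k * f z| := by rw [← abs_mul]; ring_nf
      _ ≤ (C * Θ z ^ k') * |Θ z ^ k * f z| := by gcongr
      _ ≤ C * (|Θ z ^ k'| * |Θ z ^ k * f z|) := by
        rw [mul_assoc]; gcongr; exact le_abs_self _
      _ = _ := by rw [← abs_mul]; ring_nf

theorem integrable_mul (hf : RapidL2 μ Θ f) (hg : RapidL2 μ Θ g) :
    Integrable (fun z => f z * g z) μ :=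
  hf.memLp.integrable_mul hg.memLp

theorem integrable_coeff_mul (hc : PolyBounded μ Θ c) (hf : RapidL2 μ Θ f) (hg : RapidL2 μ Θ g) :
    Integrable (fun z => c z * (f z * g z)) μ :=
  ((hf.smul hc).integrable_mul hg).congr (ae_of_all _ fun z => by ring)

theorem integrable_coeff_mul_sq (hc : PolyBounded μ Θ c) (hf : RapidL2 μ Θ f) :
    Integrable (fun z => c z * f z ^ 2) μ :=
  (integrable_coeff_mul hc hf hf).congr (ae_of_all _ fun z => by ring)

theorem integrable_sq (hf : RapidL2 μ Θ f) : Integrable (fun z => f z ^ 2) μ :=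
  hf.memLp.integrable_sq

/-- Multiplying an `L²` function by a factor that beats every power of `Θ` gives a rapidly
decreasing one. -/
theorem of_memLp (hf : MemLp f 2 μ) (hc : AEStronglyMeasurable c μ)
    (hΘ : AEStronglyMeasurable Θ μ) (h : ∀ k : ℕ, ∃ C, ∀ᵐ z ∂μ, |Θ z ^ k * c z| ≤ C) :
    RapidL2 μ Θ fun z => c z * f z := by
  intro k
  obtain ⟨C, hC⟩ := h k
  refine hf.of_le_mul (c := C) ((hΘ.pow k).mul (hc.mul hf.1)) ?_
  filter_upwards [hC] with z hz
  rw [Real.norm_eq_abs, Real.norm_eq_abs, ← mul_assoc, abs_mul]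
  gcongr

end RapidL2

theorem exists_pow_mul_exp_neg_le {c : ℝ} (hc : 0 < c) (k : ℕ) :
    ∃ C, ∀ y : ℝ, 0 ≤ y → (1 + y) ^ k * Real.exp (-(c * y)) ≤ C := by
  refine ⟨(1 / c) ^ k * k.factorial * Real.exp c, fun y hy => ?_⟩
  have h1 := Real.pow_div_factorial_le_exp (c * (1 + y)) (by positivity) k
  rw [div_le_iff₀ (by positivity)] at h1
  have h2 : (1 + y) ^ k = (1 / c) ^ k * (c * (1 + y)) ^ k := by
    rw [← mul_pow]; congr 1; field_simp
  rw [h2]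
  calc _ ≤ (1 / c) ^ k * (Real.exp (c * (1 + y)) * k.factorial) * Real.exp (-(c * y)) := by gcongr
    _ = (1 / c) ^ k * k.factorial * (Real.exp (c * (1 + y)) * Real.exp (-(c * y))) := by ring
    _ = _ := by rw [← Real.exp_add]; ring_nf

/-! ### The weights -/

/-- The coefficients entering the conjugated operator: the final time `T`, the parameters `s`, `λ`,
the constant `E = e^{2λm‖η‖}`, the functions `e = e^{λ(m‖η‖+η)}`, `h = η'`, `h₂ = η''`, the
diffusion `d` with derivative `d'`, and a cutoff `χ` with derivative `χ'`. -/
structure CarlemanData where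
  (T s lam E : ℝ)
  (d d' h h₂ e χ χ' : ℝ → ℝ)

namespace CarlemanData

variable (D : CarlemanData)

/-- The singular time factor `1 / (t(T - t))`. -/
def θ (t : ℝ) : ℝ := (t * (D.T - t))⁻¹
/-- The time derivative of `θ` on `(0, T)`. -/
def θt (t : ℝ) : ℝ := -(D.T - 2 * t) * D.θ t ^ 2
/-- The second time derivative of `θ` on `(0, T)`. -/
def θtt (t : ℝ) : ℝ := 2 * D.θ t ^ 2 + 2 * (D.T - 2 * t) ^ 2 * D.θ t ^ 3
/-- The weight `ξ`. -/
def ξ (t x : ℝ) : ℝ := D.θ t * D.e x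
/-- The time derivative of `ξ`. -/
def ξt (t x : ℝ) : ℝ := D.θt t * D.e x
/-- The weight `α`. -/
def α (t x : ℝ) : ℝ := D.θ t * (D.E - D.e x)
/-- The time derivative of `α`. -/
def αt (t x : ℝ) : ℝ := D.θt t * (D.E - D.e x)
/-- The second time derivative of `α`. -/
def αtt (t x : ℝ) : ℝ := D.θtt t * (D.E - D.e x)
/-- The factor `e^{-sα}` used for the conjugation. -/
def ρ (t x : ℝ) : ℝ := Real.exp (-(D.s * D.α t x))
/-- `β = s λ η' ξ = - s ∂ₓα`. -/
def β (t x : ℝ) : ℝ := D.s * D.lam * D.h x * D.ξ t x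
/-- The space derivative of `β`. -/
def βx (t x : ℝ) : ℝ := D.s * D.lam * D.h₂ x * D.ξ t x + D.s * D.lam ^ 2 * D.h x ^ 2 * D.ξ t x
/-- `γ = 2 s λ² d η'² ξ`, the zeroth order coefficient of the first half of the conjugated
operator. -/
def γ (t x : ℝ) : ℝ := 2 * D.s * D.lam ^ 2 * D.d x * D.h x ^ 2 * D.ξ t x
/-- The space derivative of `γ`. -/
def γx (t x : ℝ) : ℝ := 2 * D.s * D.lam ^ 2 *
  (D.d' x * D.h x ^ 2 + 2 * D.d x * D.h x * D.h₂ x + D.lam * D.d x * D.h x ^ 3) * D.ξ t x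
/-- `V = d β² + s ∂ₜα`, the zeroth order coefficient of the second half of the conjugated
operator. -/
def V (t x : ℝ) : ℝ := D.d x * D.β t x ^ 2 + D.s * D.αt t x
/-- The space derivative of `V`. -/
def Vx (t x : ℝ) : ℝ := D.d' x * D.β t x ^ 2 + 2 * D.d x * D.β t x * D.βx t x
  - D.s * D.lam * D.h x * D.ξt t x
/-- The time derivative of `V`. -/
def Vt (t x : ℝ) : ℝ := 2 * D.d x * D.s ^ 2 * D.lam ^ 2 * D.h x ^ 2 * D.ξ t x * D.ξt t x
  + D.s * D.αtt t x
/-- The normalised weight `1 + |θ|` against which growth and decay are measured. -/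
def Θ (t : ℝ) : ℝ := 1 + |D.θ t|

/-- The properties of the coefficients on which the estimate rests, with all the bounds expressed
through one constant `B`. -/
structure Admissible (B : ℝ) : Prop where
  one_le_B : 1 ≤ B
  T_pos : 0 < D.T
  T_le : D.T ≤ B
  sq_T_le : 3 * D.T ^ 2 ≤ B
  le_s : 400 * B ^ 13 ≤ D.s
  le_lam : 400 * B ^ 13 ≤ D.lam
  d_ac : HasACDerivOn 0 1 D.d D.d'
  h_ac : HasACDerivOn 0 1 D.h D.h₂
  e_ac : HasACDerivOn 0 1 D.e (fun x => D.lam * D.h x * D.e x)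
  χ_ac : HasACDerivOn 0 1 D.χ D.χ'
  one_le_mul_d : ∀ x ∈ Icc (0 : ℝ) 1, 1 ≤ B * D.d x
  d_le : ∀ x ∈ Icc (0 : ℝ) 1, D.d x ≤ B
  abs_d'_le : ∀ x ∈ Icc (0 : ℝ) 1, |D.d' x| ≤ B
  abs_h_le : ∀ x ∈ Icc (0 : ℝ) 1, |D.h x| ≤ B
  abs_h₂_le : ∀ x ∈ Icc (0 : ℝ) 1, |D.h₂ x| ≤ B
  abs_χ'_le : ∀ x ∈ Icc (0 : ℝ) 1, |D.χ' x| ≤ B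
  χ_nonneg : ∀ x, 0 ≤ D.χ x
  χ_le : ∀ x, D.χ x ≤ 1
  χ_boundary : ∀ j : Fin 2, D.χ (endpt j) = 0
  crit : ∀ x ∈ Ioo (0 : ℝ) 1, 1 ≤ B * D.h x ^ 2 ∨ D.χ x = 1
  normal : ∀ j : Fin 2, 1 ≤ B * -(normalSign j * D.h (endpt j))
  one_le_e : ∀ x ∈ Icc (0 : ℝ) 1, 1 ≤ D.e x
  E_le : ∀ x ∈ Icc (0 : ℝ) 1, D.E ≤ D.e x ^ 2
  gap : ∃ c, 0 < c ∧ ∀ x ∈ Icc (0 : ℝ) 1, c ≤ D.E - D.e x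

variable {D} {B : ℝ}

theorem endpt_mem (j : Fin 2) : endpt j ∈ Icc (0 : ℝ) 1 := by
  fin_cases j <;> simp [endpt]

theorem one_le_Θ (D : CarlemanData) (t : ℝ) : 1 ≤ D.Θ t := by
  unfold Θ; linarith [abs_nonneg (D.θ t)]

theorem θ_pos {t : ℝ} (ht : t ∈ Ioo 0 D.T) : 0 < D.θ t :=
  inv_pos.2 (mul_pos ht.1 (sub_pos.2 ht.2))

/-- At its minimum `t = T / 2` the factor `θ` equals `4 / T²`. -/
theorem four_le_mul_θ {t : ℝ} (ht : t ∈ Ioo 0 D.T) : 4 ≤ D.T ^ 2 * D.θ t := by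
  have h0 : 0 < t * (D.T - t) := mul_pos ht.1 (sub_pos.2 ht.2)
  rw [θ, ← div_eq_mul_inv, le_div_iff₀ h0]
  nlinarith [sq_nonneg (D.T - 2 * t)]

theorem abs_T_sub_le {t : ℝ} (ht : t ∈ Ioo 0 D.T) : |D.T - 2 * t| ≤ D.T := by
  rw [abs_le]
  constructor <;> linarith [ht.1, ht.2]

theorem abs_θt_le {t : ℝ} (ht : t ∈ Ioo 0 D.T) : |D.θt t| ≤ D.T * D.θ t ^ 2 := by
  rw [θt, abs_mul, abs_neg, abs_of_nonneg (sq_nonneg (D.θ t))]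
  gcongr
  exact abs_T_sub_le ht

theorem abs_θtt_le {t : ℝ} (ht : t ∈ Ioo 0 D.T) : |D.θtt t| ≤ 3 * D.T ^ 2 * D.θ t ^ 3 := by
  have h0 := θ_pos ht
  have h1 : D.θtt t = |D.θtt t| := by
    rw [abs_of_nonneg]; unfold θtt; positivity
  rw [← h1, θtt]
  have h2 : (D.T - 2 * t) ^ 2 ≤ D.T ^ 2 := sq_le_sq_of_abs_le (abs_T_sub_le ht)
  have h3 : 2 * D.θ t ^ 2 ≤ (D.T ^ 2 * D.θ t) * D.θ t ^ 2 := by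
    gcongr
    linarith [four_le_mul_θ ht]
  have h4 : (D.T - 2 * t) ^ 2 * D.θ t ^ 3 ≤ D.T ^ 2 * D.θ t ^ 3 := by gcongr
  nlinarith

namespace Admissible

theorem s_pos (H : D.Admissible B) : 0 < D.s := by
  have := one_le_pow₀ H.one_le_B (n := 13)
  linarith [H.le_s]

theorem d_pos (H : D.Admissible B) {x : ℝ} (hx : x ∈ Icc (0 : ℝ) 1) : 0 < D.d x := by
  have h1 := H.one_le_mul_d _ hx
  by_contra hneg
  have := mul_nonpos_of_nonneg_of_nonpos (zero_le_one.trans H.one_le_B) (not_lt.1 hneg)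
  linarith

theorem ξ_pos (H : D.Admissible B) {t x : ℝ} (ht : t ∈ Ioo 0 D.T) (hx : x ∈ Icc (0 : ℝ) 1) :
    0 < D.ξ t x :=
  mul_pos (θ_pos ht) (by linarith [H.one_le_e x hx])

theorem θ_le_ξ (H : D.Admissible B) {t x : ℝ} (ht : t ∈ Ioo 0 D.T) (hx : x ∈ Icc (0 : ℝ) 1) :
    D.θ t ≤ D.ξ t x :=
  le_mul_of_one_le_right (θ_pos ht).le (H.one_le_e x hx)

theorem one_le_mul_ξ (H : D.Admissible B) {t x : ℝ} (ht : t ∈ Ioo 0 D.T) (hx : x ∈ Icc (0 : ℝ) 1) :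
    1 ≤ B * D.ξ t x := by
  have h1 := four_le_mul_θ ht
  have h2 := θ_pos ht
  have h3 := H.sq_T_le
  have h4 : D.T ^ 2 * D.θ t ≤ B * D.θ t := by
    gcongr
    nlinarith [sq_nonneg D.T]
  have h5 : B * D.θ t ≤ B * D.ξ t x :=
    mul_le_mul_of_nonneg_left (H.θ_le_ξ ht hx) (by linarith [H.one_le_B])
  linarith

theorem abs_E_sub_le (H : D.Admissible B) {x : ℝ} (hx : x ∈ Icc (0 : ℝ) 1) :
    |D.E - D.e x| ≤ D.e x ^ 2 := by
  obtain ⟨c, hc, hgap⟩ := H.gap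
  have := hgap x hx
  rw [abs_of_pos (by linarith)]
  linarith [H.E_le x hx, H.one_le_e x hx]

theorem abs_αt_le (H : D.Admissible B) {t x : ℝ} (ht : t ∈ Ioo 0 D.T) (hx : x ∈ Icc (0 : ℝ) 1) :
    |D.αt t x| ≤ B * D.ξ t x ^ 2 := by
  have h0 := θ_pos ht
  calc _ ≤ D.T * D.θ t ^ 2 * D.e x ^ 2 := abs_mul_le_mul' (abs_θt_le ht) (H.abs_E_sub_le hx)
    _ ≤ B * D.θ t ^ 2 * D.e x ^ 2 := by gcongr; exact H.T_le
    _ = _ := by unfold ξ; ring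

theorem abs_αtt_le (H : D.Admissible B) {t x : ℝ} (ht : t ∈ Ioo 0 D.T) (hx : x ∈ Icc (0 : ℝ) 1) :
    |D.αtt t x| ≤ B * D.ξ t x ^ 3 := by
  have h0 := θ_pos ht
  have h1 := H.one_le_e x hx
  calc _ ≤ 3 * D.T ^ 2 * D.θ t ^ 3 * D.e x ^ 2 :=
        abs_mul_le_mul' (abs_θtt_le ht) (H.abs_E_sub_le hx)
    _ ≤ B * D.θ t ^ 3 * D.e x ^ 3 := by
      have := H.sq_T_le
      have hB := H.one_le_B
      gcongr
      norm_num
    _ = _ := by unfold ξ; ring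

theorem abs_ξt_le (H : D.Admissible B) {t x : ℝ} (ht : t ∈ Ioo 0 D.T) (hx : x ∈ Icc (0 : ℝ) 1) :
    |D.ξt t x| ≤ B * D.ξ t x ^ 2 := by
  have h0 := θ_pos ht
  have h1 := H.one_le_e x hx
  have h2 : |D.e x| ≤ D.e x ^ 2 := by
    rw [abs_of_pos (by linarith)]; exact le_self_pow₀ h1 two_ne_zero
  calc _ ≤ D.T * D.θ t ^ 2 * D.e x ^ 2 := abs_mul_le_mul' (abs_θt_le ht) h2
    _ ≤ B * D.θ t ^ 2 * D.e x ^ 2 := by gcongr; exact H.T_le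
    _ = _ := by unfold ξ; ring

/-- The factor `e^{-sα}` beats every power of the weight, uniformly in `x`. -/
theorem exists_Θ_pow_mul_ρ_le (H : D.Admissible B) (k : ℕ) :
    ∃ C, ∀ t ∈ Ioo 0 D.T, ∀ x ∈ Icc (0 : ℝ) 1, D.Θ t ^ k * D.ρ t x ≤ C := by
  obtain ⟨c, hc, hgap⟩ := H.gap
  obtain ⟨C, hC⟩ := exists_pow_mul_exp_neg_le (mul_pos H.s_pos hc) k
  refine ⟨C, fun t ht x hx => ?_⟩
  have h0 := θ_pos ht
  have hs := H.s_pos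
  refine le_trans ?_ (hC (D.θ t) h0.le)
  rw [Θ, abs_of_pos h0]
  unfold ρ α
  gcongr _ * Real.exp ?_
  have := mul_le_mul_of_nonneg_left (hgap x hx) (mul_nonneg hs.le h0.le)
  linarith

/-! ### Space derivatives of the weights -/

theorem ξ_ac (H : D.Admissible B) (t : ℝ) :
    HasACDerivOn 0 1 (D.ξ t) (fun x => D.lam * D.h x * D.ξ t x) :=
  (H.e_ac.const_mul (D.θ t)).congr_deriv (ae_of_all _ fun x => by simp only [ξ]; ring)

theorem β_ac (H : D.Admissible B) (t : ℝ) : HasACDerivOn 0 1 (D.β t) (D.βx t) := by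
  have := ((H.h_ac.mul (H.ξ_ac t)).const_mul (D.s * D.lam)).congr_deriv (g' := D.βx t)
    (ae_of_all _ fun x => by simp only [βx]; ring)
  exact this.congr zero_le_one fun x _ => by simp only [β]; ring

theorem γ_ac (H : D.Admissible B) (t : ℝ) : HasACDerivOn 0 1 (D.γ t) (D.γx t) := by
  have := (((H.d_ac.mul (H.h_ac.mul H.h_ac)).mul (H.ξ_ac t)).const_mul
    (2 * D.s * D.lam ^ 2)).congr_deriv (g' := D.γx t)
    (ae_of_all _ fun x => by simp only [γx]; ring)
  exact this.congr zero_le_one fun x _ => by simp only [γ]; ring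

theorem V_ac (H : D.Admissible B) (t : ℝ) : HasACDerivOn 0 1 (D.V t) (D.Vx t) := by
  have := ((H.d_ac.mul ((H.β_ac t).mul (H.β_ac t))).add
    (((HasACDerivOn.const D.E).sub H.e_ac).const_mul (D.s * D.θt t))).congr_deriv (g' := D.Vx t)
    (ae_of_all _ fun x => by simp only [Vx, ξt]; ring)
  exact this.congr zero_le_one fun x _ => by simp only [V, αt]; ring

theorem ρ_ac (H : D.Admissible B) (t : ℝ) :
    HasACDerivOn 0 1 (D.ρ t) (fun x => D.β t x * D.ρ t x) := by
  have := ((((HasACDerivOn.const D.E).sub H.e_ac).const_mul (D.s * D.θ t)).neg).congr_deriv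
    (g' := D.β t) (ae_of_all _ fun x => by simp only [β, ξ]; ring)
  exact (this.congr zero_le_one fun x _ => by simp only [α]; ring).exp zero_le_one

end Admissible

end CarlemanData

/-! ### Growth of the weights and decay of the conjugated functions -/

namespace CarlemanData

/-- The factors `t` and `x` through which the weights are evaluated on a measure space: the
coordinates on the cylinder, or the time at a fixed point. -/
structure Sampling (D : CarlemanData) {Ω : Type*} [MeasurableSpace Ω] (μ : Measure Ω)
    (τ x : Ω → ℝ) : Prop where
  meas_t : AEStronglyMeasurable τ μ
  mem_t : ∀ᵐ z ∂μ, τ z ∈ Ioo 0 D.T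
  mem_x : ∀ᵐ z ∂μ, x z ∈ Icc (0 : ℝ) 1
  meas_d : AEStronglyMeasurable (fun z => D.d (x z)) μ
  meas_d' : AEStronglyMeasurable (fun z => D.d' (x z)) μ
  meas_h : AEStronglyMeasurable (fun z => D.h (x z)) μ
  meas_h₂ : AEStronglyMeasurable (fun z => D.h₂ (x z)) μ
  meas_e : AEStronglyMeasurable (fun z => D.e (x z)) μ
  meas_χ : AEStronglyMeasurable (fun z => D.χ (x z)) μ
  meas_χ' : AEStronglyMeasurable (fun z => D.χ' (x z)) μ

/-- The product measure on the space-time cylinder. -/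
def cyl (T : ℝ) : Measure (ℝ × ℝ) := (volume.restrict (Ioo 0 T)).prod (volume.restrict (Ioo 0 1))

instance (T : ℝ) : IsFiniteMeasure (cyl T) := by unfold cyl; infer_instance

theorem restrict_heatCylinder (T : ℝ) :
    (volume.restrict (heatCylinder T) : Measure (ℝ × ℝ)) = cyl T := by
  rw [heatCylinder, cyl, Measure.prod_restrict]; rfl

theorem ae_cyl_mem (T : ℝ) : ∀ᵐ z ∂(cyl T), z.1 ∈ Ioo 0 T ∧ z.2 ∈ Ioo (0 : ℝ) 1 := by
  rw [← restrict_heatCylinder]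
  exact ae_restrict_mem (measurableSet_Ioo.prod measurableSet_Ioo)

variable {D : CarlemanData} {B : ℝ}

namespace Admissible

theorem sampling_cyl (H : D.Admissible B) : D.Sampling (cyl D.T) Prod.fst Prod.snd := by
  have hc : ∀ {f f' : ℝ → ℝ}, HasACDerivOn 0 1 f f' →
      AEStronglyMeasurable (fun z : ℝ × ℝ => f z.2) (cyl D.T) := fun hf =>
    (((hf.continuousOn zero_le_one).mono Ioo_subset_Icc_self).aestronglyMeasurable
      measurableSet_Ioo).comp_snd
  have hc' : ∀ {f f' : ℝ → ℝ}, HasACDerivOn 0 1 f f' →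
      AEStronglyMeasurable (fun z : ℝ × ℝ => f' z.2) (cyl D.T) := fun hf =>
    (hf.integrableOn zero_le_one).1.comp_snd
  exact ⟨measurable_fst.aestronglyMeasurable, (ae_cyl_mem D.T).mono fun z hz => hz.1,
    (ae_cyl_mem D.T).mono fun z hz => Ioo_subset_Icc_self hz.2, hc H.d_ac, hc' H.d_ac, hc H.h_ac,
    hc' H.h_ac, hc H.e_ac, hc H.χ_ac, hc' H.χ_ac⟩

end Admissible

theorem sampling_const (D : CarlemanData) {x : ℝ} (hx : x ∈ Icc (0 : ℝ) 1) (μ : Measure ℝ) :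
    D.Sampling (μ.restrict (Ioo 0 D.T)) id (fun _ => x) :=
  ⟨measurable_id.aestronglyMeasurable, ae_restrict_mem measurableSet_Ioo,
    ae_of_all _ fun _ => hx, aestronglyMeasurable_const, aestronglyMeasurable_const,
    aestronglyMeasurable_const, aestronglyMeasurable_const, aestronglyMeasurable_const,
    aestronglyMeasurable_const, aestronglyMeasurable_const⟩

namespace Sampling

variable {Ω : Type*} [MeasurableSpace Ω] {μ : Measure Ω} {τ x : Ω → ℝ}

theorem meas_θ (S : D.Sampling μ τ x) : AEStronglyMeasurable (fun z => D.θ (τ z)) μ := by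
  have : Measurable D.θ := by unfold θ; fun_prop
  exact (this.comp_aemeasurable S.meas_t.aemeasurable).aestronglyMeasurable

theorem meas_Θ (S : D.Sampling μ τ x) : AEStronglyMeasurable (fun z => D.Θ (τ z)) μ :=
  S.meas_θ.norm.const_add 1

theorem meas_ρ (S : D.Sampling μ τ x) : AEStronglyMeasurable (fun z => D.ρ (τ z) (x z)) μ := by
  refine (Real.continuous_exp.comp_aestronglyMeasurable
    ((S.meas_θ.mul ((aestronglyMeasurable_const (b := D.E)).sub S.meas_e)).const_mul D.s).neg).congr
    (ae_of_all _ fun z => ?_)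
  simp [ρ, α]

theorem poly_θ (S : D.Sampling μ τ x) :
    PolyBounded μ (fun z => D.Θ (τ z)) fun z => D.θ (τ z) :=
  ⟨S.meas_θ, 1, 1, zero_le_one, ae_of_all _ fun z => by simp [Θ]⟩

theorem poly_linear (S : D.Sampling μ τ x) :
    PolyBounded μ (fun z => D.Θ (τ z)) fun z => D.T - 2 * τ z :=
  .of_bounded (aestronglyMeasurable_const.sub (S.meas_t.const_mul 2)) D.T
    (S.mem_t.mono fun _ hz => abs_T_sub_le hz)

theorem poly_θt (S : D.Sampling μ τ x) :
    PolyBounded μ (fun z => D.Θ (τ z)) fun z => D.θt (τ z) :=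
  S.poly_linear.neg.mul (S.poly_θ.pow 2)

theorem poly_θtt (S : D.Sampling μ τ x) :
    PolyBounded μ (fun z => D.Θ (τ z)) fun z => D.θtt (τ z) :=
  ((PolyBounded.const 2).mul (S.poly_θ.pow 2)).add (fun _ => one_le_Θ D _)
    (((PolyBounded.const 2).mul (S.poly_linear.pow 2)).mul (S.poly_θ.pow 3))

theorem poly_d (S : D.Sampling μ τ x) (H : D.Admissible B) :
    PolyBounded μ (fun z => D.Θ (τ z)) fun z => D.d (x z) := by
  refine .of_bounded S.meas_d B (S.mem_x.mono fun _ hz => ?_)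
  rw [abs_of_pos (H.d_pos hz)]
  exact H.d_le _ hz

theorem poly_d' (S : D.Sampling μ τ x) (H : D.Admissible B) :
    PolyBounded μ (fun z => D.Θ (τ z)) fun z => D.d' (x z) :=
  .of_bounded S.meas_d' B (S.mem_x.mono fun _ hz => H.abs_d'_le _ hz)

theorem poly_h (S : D.Sampling μ τ x) (H : D.Admissible B) :
    PolyBounded μ (fun z => D.Θ (τ z)) fun z => D.h (x z) :=
  .of_bounded S.meas_h B (S.mem_x.mono fun _ hz => H.abs_h_le _ hz)

theorem poly_h₂ (S : D.Sampling μ τ x) (H : D.Admissible B) :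
    PolyBounded μ (fun z => D.Θ (τ z)) fun z => D.h₂ (x z) :=
  .of_bounded S.meas_h₂ B (S.mem_x.mono fun _ hz => H.abs_h₂_le _ hz)

theorem poly_χ (S : D.Sampling μ τ x) (H : D.Admissible B) :
    PolyBounded μ (fun z => D.Θ (τ z)) fun z => D.χ (x z) :=
  .of_bounded S.meas_χ 1 (ae_of_all _ fun z => by
    rw [abs_of_nonneg (H.χ_nonneg _)]; exact H.χ_le _)

theorem poly_χ' (S : D.Sampling μ τ x) (H : D.Admissible B) :
    PolyBounded μ (fun z => D.Θ (τ z)) fun z => D.χ' (x z) :=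
  .of_bounded S.meas_χ' B (S.mem_x.mono fun _ hz => H.abs_χ'_le _ hz)

theorem poly_e (S : D.Sampling μ τ x) (H : D.Admissible B) :
    PolyBounded μ (fun z => D.Θ (τ z)) fun z => D.e (x z) := by
  obtain ⟨c, hc, hgap⟩ := H.gap
  refine .of_bounded S.meas_e D.E (S.mem_x.mono fun z hz => ?_)
  rw [abs_of_pos (by linarith [H.one_le_e _ hz])]
  linarith [hgap _ hz]

theorem poly_ξ (S : D.Sampling μ τ x) (H : D.Admissible B) :
    PolyBounded μ (fun z => D.Θ (τ z)) fun z => D.ξ (τ z) (x z) :=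
  S.poly_θ.mul (S.poly_e H)

theorem poly_ξ_inv (S : D.Sampling μ τ x) (H : D.Admissible B) :
    PolyBounded μ (fun z => D.Θ (τ z)) fun z => (D.ξ (τ z) (x z))⁻¹ := by
  refine .of_bounded (S.meas_θ.mul S.meas_e).aemeasurable.inv.aestronglyMeasurable B ?_
  filter_upwards [S.mem_t, S.mem_x] with z ht hx
  have h0 := H.ξ_pos ht hx
  rw [abs_of_pos (inv_pos.2 h0), inv_le_iff_one_le_mul₀ h0]
  exact H.one_le_mul_ξ ht hx

theorem poly_ξt (S : D.Sampling μ τ x) (H : D.Admissible B) :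
    PolyBounded μ (fun z => D.Θ (τ z)) fun z => D.ξt (τ z) (x z) :=
  S.poly_θt.mul (S.poly_e H)

theorem poly_αt (S : D.Sampling μ τ x) (H : D.Admissible B) :
    PolyBounded μ (fun z => D.Θ (τ z)) fun z => D.αt (τ z) (x z) :=
  S.poly_θt.mul ((PolyBounded.const D.E).sub (fun _ => one_le_Θ D _) (S.poly_e H))

theorem poly_αtt (S : D.Sampling μ τ x) (H : D.Admissible B) :
    PolyBounded μ (fun z => D.Θ (τ z)) fun z => D.αtt (τ z) (x z) :=
  S.poly_θtt.mul ((PolyBounded.const D.E).sub (fun _ => one_le_Θ D _) (S.poly_e H))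

theorem poly_β (S : D.Sampling μ τ x) (H : D.Admissible B) :
    PolyBounded μ (fun z => D.Θ (τ z)) fun z => D.β (τ z) (x z) :=
  ((PolyBounded.const _).mul (S.poly_h H)).mul (S.poly_ξ H)

theorem poly_βx (S : D.Sampling μ τ x) (H : D.Admissible B) :
    PolyBounded μ (fun z => D.Θ (τ z)) fun z => D.βx (τ z) (x z) :=
  (((PolyBounded.const _).mul (S.poly_h₂ H)).mul (S.poly_ξ H)).add (fun _ => one_le_Θ D _)
    (((PolyBounded.const _).mul ((S.poly_h H).pow 2)).mul (S.poly_ξ H))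

theorem poly_γ (S : D.Sampling μ τ x) (H : D.Admissible B) :
    PolyBounded μ (fun z => D.Θ (τ z)) fun z => D.γ (τ z) (x z) :=
  (((PolyBounded.const _).mul (S.poly_d H)).mul ((S.poly_h H).pow 2)).mul (S.poly_ξ H)

theorem poly_γx (S : D.Sampling μ τ x) (H : D.Admissible B) :
    PolyBounded μ (fun z => D.Θ (τ z)) fun z => D.γx (τ z) (x z) := by
  have hΘ : ∀ z, 1 ≤ D.Θ (τ z) := fun _ => one_le_Θ D _
  refine ((PolyBounded.const _).mul (.add hΘ (.add hΘ ?_ ?_) ?_)).mul (S.poly_ξ H)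
  · exact (S.poly_d' H).mul ((S.poly_h H).pow 2)
  · exact (((PolyBounded.const _).mul (S.poly_d H)).mul (S.poly_h H)).mul (S.poly_h₂ H)
  · exact ((PolyBounded.const _).mul (S.poly_d H)).mul ((S.poly_h H).pow 3)

theorem poly_V (S : D.Sampling μ τ x) (H : D.Admissible B) :
    PolyBounded μ (fun z => D.Θ (τ z)) fun z => D.V (τ z) (x z) :=
  ((S.poly_d H).mul ((S.poly_β H).pow 2)).add (fun _ => one_le_Θ D _)
    ((PolyBounded.const _).mul (S.poly_αt H))

theorem poly_Vx (S : D.Sampling μ τ x) (H : D.Admissible B) :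
    PolyBounded μ (fun z => D.Θ (τ z)) fun z => D.Vx (τ z) (x z) := by
  have hΘ : ∀ z, 1 ≤ D.Θ (τ z) := fun _ => one_le_Θ D _
  refine .sub hΘ (.add hΘ ?_ ?_) ?_
  · exact (S.poly_d' H).mul ((S.poly_β H).pow 2)
  · exact (((PolyBounded.const _).mul (S.poly_d H)).mul (S.poly_β H)).mul (S.poly_βx H)
  · exact ((PolyBounded.const _).mul (S.poly_h H)).mul (S.poly_ξt H)

theorem poly_Vt (S : D.Sampling μ τ x) (H : D.Admissible B) :
    PolyBounded μ (fun z => D.Θ (τ z)) fun z => D.Vt (τ z) (x z) := by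
  have hΘ : ∀ z, 1 ≤ D.Θ (τ z) := fun _ => one_le_Θ D _
  refine .add hΘ ?_ ((PolyBounded.const _).mul (S.poly_αtt H))
  exact ((((((PolyBounded.const _).mul (S.poly_d H)).mul (PolyBounded.const _)).mul
    (PolyBounded.const _)).mul ((S.poly_h H).pow 2)).mul (S.poly_ξ H)).mul (S.poly_ξt H)

theorem rapid_ρ_mul (S : D.Sampling μ τ x) (H : D.Admissible B) {f : Ω → ℝ} (hf : MemLp f 2 μ) :
    RapidL2 μ (fun z => D.Θ (τ z)) fun z => D.ρ (τ z) (x z) * f z := by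
  refine .of_memLp hf S.meas_ρ S.meas_Θ fun k => ?_
  obtain ⟨C, hC⟩ := H.exists_Θ_pow_mul_ρ_le k
  refine ⟨C, ?_⟩
  filter_upwards [S.mem_t, S.mem_x] with z ht hx
  have h1 := one_le_Θ D (τ z)
  have h2 : 0 < D.ρ (τ z) (x z) := Real.exp_pos _
  rw [abs_of_pos (by positivity)]
  exact hC _ ht _ hx

end Sampling

variable (D)

/-- The conjugated function `ψ = e^{-sα} φ`. -/
def ψ (φ : ℝ → ℝ → ℝ) (t x : ℝ) : ℝ := D.ρ t x * φ t x
/-- The space derivative of `ψ`. -/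
def ψx (φ φx : ℝ → ℝ → ℝ) (t x : ℝ) : ℝ := D.ρ t x * φx t x + D.β t x * D.ψ φ t x
/-- The time derivative of `ψ`. -/
def ψt (φ φt : ℝ → ℝ → ℝ) (t x : ℝ) : ℝ := D.ρ t x * φt t x - D.s * D.αt t x * D.ψ φ t x
/-- The flux `w = d ∂ₓψ`. -/
def w (φ φx : ℝ → ℝ → ℝ) (t x : ℝ) : ℝ := D.d x * D.ψx φ φx t x
/-- The space derivative of the flux `w`, where `q = ∂ₓ(d ∂ₓφ)`. -/
def wx (φ φx q : ℝ → ℝ → ℝ) (t x : ℝ) : ℝ := D.ρ t x * q t x + 2 * D.β t x * D.w φ φx t x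
  - (D.d x * D.β t x ^ 2 - (D.d' x * D.β t x + D.d x * D.βx t x)) * D.ψ φ t x
/-- The space flux whose divergence appears in the cross product of the two halves of the
conjugated operator, together with the flux of the cutoff term. -/
def fluxX (φ φx : ℝ → ℝ → ℝ) (t x : ℝ) : ℝ :=
  2 * (D.β t x * D.w φ φx t x ^ 2 + D.γ t x * D.ψ φ t x * D.w φ φx t x
    + D.d x * D.β t x * D.V t x * D.ψ φ t x ^ 2)
  + D.s * D.lam ^ 2 * D.ξ t x * (D.χ x * D.ψ φ t x * D.w φ φx t x)
/-- The space derivative of `fluxX`. -/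
def divX (φ φx q : ℝ → ℝ → ℝ) (t x : ℝ) : ℝ :=
  2 * (D.βx t x * D.w φ φx t x ^ 2 + 2 * D.β t x * D.w φ φx t x * D.wx φ φx q t x
      + D.γx t x * D.ψ φ t x * D.w φ φx t x + D.γ t x * D.ψx φ φx t x * D.w φ φx t x
      + D.γ t x * D.ψ φ t x * D.wx φ φx q t x
      + (D.d' x * D.β t x + D.d x * D.βx t x) * D.V t x * D.ψ φ t x ^ 2
      + D.d x * D.β t x * D.Vx t x * D.ψ φ t x ^ 2
      + 2 * D.d x * D.β t x * D.V t x * D.ψ φ t x * D.ψx φ φx t x)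
    + D.s * D.lam ^ 2 * D.ξ t x * ((D.χ' x + D.χ x * D.lam * D.h x) * D.ψ φ t x * D.w φ φx t x
      + D.χ x * D.ψx φ φx t x * D.w φ φx t x + D.χ x * D.ψ φ t x * D.wx φ φx q t x)
/-- The time derivative of `V ψ²`. -/
def divT (φ φt : ℝ → ℝ → ℝ) (t x : ℝ) : ℝ :=
  D.Vt t x * D.ψ φ t x ^ 2 + 2 * D.V t x * D.ψ φ t x * D.ψt φ φt t x

variable {D}

namespace Sampling

variable {Ω : Type*} [MeasurableSpace Ω] {μ : Measure Ω} {τ x : Ω → ℝ} {φ φt φx q : ℝ → ℝ → ℝ}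

theorem rapid_ψ (S : D.Sampling μ τ x) (H : D.Admissible B)
    (hφ : MemLp (fun z => φ (τ z) (x z)) 2 μ) :
    RapidL2 μ (fun z => D.Θ (τ z)) fun z => D.ψ φ (τ z) (x z) := S.rapid_ρ_mul H hφ

theorem rapid_ψx (S : D.Sampling μ τ x) (H : D.Admissible B)
    (hφ : MemLp (fun z => φ (τ z) (x z)) 2 μ) (hφx : MemLp (fun z => φx (τ z) (x z)) 2 μ) :
    RapidL2 μ (fun z => D.Θ (τ z)) fun z => D.ψx φ φx (τ z) (x z) :=
  (S.rapid_ρ_mul H hφx).add ((S.rapid_ψ H hφ).smul (S.poly_β H))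

theorem rapid_ψt (S : D.Sampling μ τ x) (H : D.Admissible B)
    (hφ : MemLp (fun z => φ (τ z) (x z)) 2 μ) (hφt : MemLp (fun z => φt (τ z) (x z)) 2 μ) :
    RapidL2 μ (fun z => D.Θ (τ z)) fun z => D.ψt φ φt (τ z) (x z) :=
  (S.rapid_ρ_mul H hφt).sub ((S.rapid_ψ H hφ).smul ((PolyBounded.const _).mul (S.poly_αt H)))

theorem rapid_w (S : D.Sampling μ τ x) (H : D.Admissible B)
    (hφ : MemLp (fun z => φ (τ z) (x z)) 2 μ) (hφx : MemLp (fun z => φx (τ z) (x z)) 2 μ) :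
    RapidL2 μ (fun z => D.Θ (τ z)) fun z => D.w φ φx (τ z) (x z) :=
  (S.rapid_ψx H hφ hφx).smul (S.poly_d H)

theorem rapid_wx (S : D.Sampling μ τ x) (H : D.Admissible B)
    (hφ : MemLp (fun z => φ (τ z) (x z)) 2 μ) (hφx : MemLp (fun z => φx (τ z) (x z)) 2 μ)
    (hq : MemLp (fun z => q (τ z) (x z)) 2 μ) :
    RapidL2 μ (fun z => D.Θ (τ z)) fun z => D.wx φ φx q (τ z) (x z) := by
  have hΘ : ∀ z, 1 ≤ D.Θ (τ z) := fun _ => one_le_Θ D _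
  refine ((S.rapid_ρ_mul H hq).add ((S.rapid_w H hφ hφx).smul
    ((PolyBounded.const _).mul (S.poly_β H)))).sub ((S.rapid_ψ H hφ).smul ?_)
  exact ((S.poly_d H).mul ((S.poly_β H).pow 2)).sub hΘ
    (((S.poly_d' H).mul (S.poly_β H)).add hΘ ((S.poly_d H).mul (S.poly_βx H)))

theorem integrable_divX (S : D.Sampling μ τ x) (H : D.Admissible B)
    (hφ : MemLp (fun z => φ (τ z) (x z)) 2 μ) (hφx : MemLp (fun z => φx (τ z) (x z)) 2 μ)
    (hq : MemLp (fun z => q (τ z) (x z)) 2 μ) :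
    Integrable (fun z => D.divX φ φx q (τ z) (x z)) μ := by
  have hΘ : ∀ z, 1 ≤ D.Θ (τ z) := fun _ => one_le_Θ D _
  have c2 := PolyBounded.const (μ := μ) (Θ := fun z => D.Θ (τ z)) 2
  have cl := PolyBounded.const (μ := μ) (Θ := fun z => D.Θ (τ z)) D.lam
  have hξ' := (PolyBounded.const (μ := μ) (Θ := fun z => D.Θ (τ z)) (D.s * D.lam ^ 2)).mul
    (S.poly_ξ H)
  have rψ := S.rapid_ψ H hφ
  have rψx := S.rapid_ψx H hφ hφx
  have rw' := S.rapid_w H hφ hφx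
  have rwx := S.rapid_wx H hφ hφx hq
  have hd := S.poly_d H
  have hβ := S.poly_β H
  have A := ((((rw'.smul (c2.mul (S.poly_βx H))).add (rwx.smul ((c2.mul c2).mul hβ))).add
    (rψ.smul (c2.mul (S.poly_γx H)))).add (rψx.smul (c2.mul (S.poly_γ H)))).add
    ((rψ.smul (hξ'.mul ((S.poly_χ' H).add hΘ (((S.poly_χ H).mul cl).mul (S.poly_h H))))).add
      (rψx.smul (hξ'.mul (S.poly_χ H))))
  have A' := (((rwx.smul (c2.mul (S.poly_γ H))).add (rψ.smul ((c2.mul (((S.poly_d' H).mul hβ).add hΘ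
    (hd.mul (S.poly_βx H)))).mul (S.poly_V H)))).add (rψ.smul (((c2.mul hd).mul hβ).mul
    (S.poly_Vx H)))).add ((rψx.smul ((((c2.mul c2).mul hd).mul hβ).mul (S.poly_V H))).add
    (rwx.smul (hξ'.mul (S.poly_χ H))))
  refine ((rw'.integrable_mul A).add (rψ.integrable_mul A')).congr (ae_of_all _ fun z => ?_)
  simp only [Pi.add_apply, divX]
  ring

theorem integrable_divT (S : D.Sampling μ τ x) (H : D.Admissible B)
    (hφ : MemLp (fun z => φ (τ z) (x z)) 2 μ) (hφt : MemLp (fun z => φt (τ z) (x z)) 2 μ) :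
    Integrable (fun z => D.divT φ φt (τ z) (x z)) μ := by
  have c2 := PolyBounded.const (μ := μ) (Θ := fun z => D.Θ (τ z)) 2
  have rψ := S.rapid_ψ H hφ
  have A := (rψ.smul (S.poly_Vt H)).add ((S.rapid_ψt H hφ hφt).smul (c2.mul (S.poly_V H)))
  refine (rψ.integrable_mul A).congr (ae_of_all _ fun z => ?_)
  simp only [divT]
  ring

end Sampling

/-! ### Space derivatives of the conjugated functions -/

namespace Admissible

variable {φ φt φx q : ℝ → ℝ → ℝ} {t : ℝ}

theorem ψ_ac (H : D.Admissible B) (hφ : HasACDerivOn 0 1 (φ t) (φx t)) :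
    HasACDerivOn 0 1 (D.ψ φ t) (D.ψx φ φx t) :=
  ((H.ρ_ac t).mul hφ).congr_deriv (ae_of_all _ fun x => by simp only [ψx, ψ]; ring)

theorem w_ac (H : D.Admissible B) (hφ : HasACDerivOn 0 1 (φ t) (φx t))
    (hq : HasACDerivOn 0 1 (fun x => D.d x * φx t x) (q t)) :
    HasACDerivOn 0 1 (D.w φ φx t) (D.wx φ φx q t) := by
  have := (((H.ρ_ac t).mul hq).add ((H.d_ac.mul (H.β_ac t)).mul (H.ψ_ac hφ))).congr_deriv
    (g' := D.wx φ φx q t) (ae_of_all _ fun x => by simp only [wx, w, ψx, ψ]; ring)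
  exact this.congr zero_le_one fun x _ => by simp only [w, ψx, ψ]; ring

theorem fluxX_ac (H : D.Admissible B) (hφ : HasACDerivOn 0 1 (φ t) (φx t))
    (hq : HasACDerivOn 0 1 (fun x => D.d x * φx t x) (q t)) :
    HasACDerivOn 0 1 (D.fluxX φ φx t) (D.divX φ φx q t) := by
  have hψ := H.ψ_ac hφ
  have hw := H.w_ac hφ hq
  have := ((((((H.β_ac t).mul (hw.mul hw)).add ((H.γ_ac t).mul (hψ.mul hw))).add
    ((H.d_ac.mul (H.β_ac t)).mul ((H.V_ac t).mul (hψ.mul hψ)))).const_mul 2).add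
    (((H.ξ_ac t).mul (H.χ_ac.mul (hψ.mul hw))).const_mul (D.s * D.lam ^ 2))).congr_deriv
    (g' := D.divX φ φx q t) (ae_of_all _ fun x => by simp only [divX]; ring)
  exact this.congr zero_le_one fun x _ => by simp only [fluxX]; ring

end Admissible

end CarlemanData

/-! ### Vanishing of the conjugated functions at the ends of the time interval -/

/-- A function on `(0, T)` vanishing linearly at both ends and with bounded derivative becomes
absolutely continuous once extended by zero. -/
theorem HasACDerivOn.indicator_of_bound {T : ℝ} (hT : 0 ≤ T) {g g' : ℝ → ℝ} {C : ℝ}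
    (hg : ∀ t ∈ Ioo 0 T, HasDerivAt g (g' t) t) (h : ∀ t ∈ Ioo 0 T, |g t| ≤ C * (t * (T - t)))
    (h' : ∀ t ∈ Ioo 0 T, |g' t| ≤ C) : HasACDerivOn 0 T ((Ioo 0 T).indicator g) g' := by
  have hd : ∀ t ∈ Ioo 0 T, HasDerivAt ((Ioo 0 T).indicator g) (g' t) t := fun t ht =>
    (hg t ht).congr_of_eventuallyEq (by
      filter_upwards [isOpen_Ioo.mem_nhds ht] with y hy using indicator_of_mem hy g)
  refine .of_hasDerivAt hT (fun t ht => ?_) hd ?_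
  · by_cases hi : t ∈ Ioo 0 T
    · exact (hd t hi).continuousAt.continuousWithinAt
    · have ht0 : t * (T - t) = 0 := by
        rcases ht.1.eq_or_lt with h0 | h0
        · rw [← h0, zero_mul]
        · have : T ≤ t := not_lt.1 fun h1 => hi ⟨h0, h1⟩
          rw [show T - t = 0 by linarith [ht.2], mul_zero]
      rw [ContinuousWithinAt, indicator_of_notMem hi]
      refine squeeze_zero_norm' (a := fun y => |C| * (y * (T - y))) ?_ ?_
      · filter_upwards [self_mem_nhdsWithin] with y hy
        have hy0 : 0 ≤ y * (T - y) := mul_nonneg hy.1 (sub_nonneg.2 hy.2)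
        by_cases hyi : y ∈ Ioo 0 T
        · rw [indicator_of_mem hyi, Real.norm_eq_abs]
          exact (h y hyi).trans (mul_le_mul_of_nonneg_right (le_abs_self C) hy0)
        · rw [indicator_of_notMem hyi, norm_zero]
          positivity
      · have hc : Continuous fun y : ℝ => |C| * (y * (T - y)) := by fun_prop
        have := hc.tendsto t
        rw [ht0, mul_zero] at this
        exact this.mono_left nhdsWithin_le_nhds
  · refine Integrable.of_bound ?_ C
      ((ae_restrict_mem measurableSet_Ioo).mono fun t ht => h' t ht)
    refine AEStronglyMeasurable.congr (μ := volume.restrict (Ioo 0 T))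
      (measurable_deriv g).aestronglyMeasurable ?_
    filter_upwards [ae_restrict_mem measurableSet_Ioo] with t ht using (hg t ht).deriv

theorem HasZeroTraceDeriv.integral_eq_zero {T : ℝ} (hT : 0 ≤ T) {w w' : ℝ → ℝ}
    (h : HasZeroTraceDeriv T w w') : ∫ t in Ioo 0 T, w' t = 0 := by
  obtain ⟨u, hu, h0, h1, -⟩ := h
  rw [hu.integral_eq_sub hT, h0, h1, sub_zero]

namespace CarlemanData

variable {D : CarlemanData} {B : ℝ}

/-! ### Time derivatives of the weights -/

theorem hasDerivAt_θ {t : ℝ} (ht : t ∈ Ioo 0 D.T) : HasDerivAt D.θ (D.θt t) t := by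
  have h0 : t * (D.T - t) ≠ 0 := (mul_pos ht.1 (sub_pos.2 ht.2)).ne'
  have h1 : HasDerivAt (fun t : ℝ => t * (D.T - t)) (1 * (D.T - t) + t * (0 - 1)) t :=
    (hasDerivAt_id t).mul ((hasDerivAt_const t D.T).sub (hasDerivAt_id t))
  refine (h1.fun_inv h0).congr_deriv ?_
  rw [θt, θ]
  field_simp
  ring

theorem hasDerivAt_θt {t : ℝ} (ht : t ∈ Ioo 0 D.T) : HasDerivAt D.θt (D.θtt t) t := by
  have h1 : HasDerivAt (fun t : ℝ => -(D.T - 2 * t)) 2 t := by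
    exact ((((hasDerivAt_id t).const_mul 2).const_sub D.T).neg).congr_deriv (by ring)
  refine (h1.mul ((hasDerivAt_θ ht).pow 2)).congr_deriv ?_
  simp only [θtt, θt, Pi.pow_apply]
  push_cast
  ring

theorem hasDerivAt_ρ {t : ℝ} (ht : t ∈ Ioo 0 D.T) (x : ℝ) :
    HasDerivAt (fun t => D.ρ t x) (-(D.s * D.αt t x) * D.ρ t x) t := by
  have h1 : HasDerivAt (fun t => -(D.s * D.α t x)) (-(D.s * D.αt t x)) t :=
    (((hasDerivAt_θ ht).mul_const (D.E - D.e x)).const_mul D.s).neg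
  exact h1.exp.congr_deriv (by simp only [ρ]; ring)

theorem hasDerivAt_V {t : ℝ} (ht : t ∈ Ioo 0 D.T) (x : ℝ) :
    HasDerivAt (fun t => D.V t x) (D.Vt t x) t := by
  have h1 : HasDerivAt (fun t => D.β t x) (D.s * D.lam * D.h x * (D.θt t * D.e x)) t :=
    ((hasDerivAt_θ ht).mul_const (D.e x)).const_mul _
  have h2 : HasDerivAt (fun t => D.αt t x) (D.αtt t x) t :=
    (hasDerivAt_θt ht).mul_const (D.E - D.e x)
  refine (((h1.pow 2).const_mul (D.d x)).add (h2.const_mul D.s)).congr_deriv ?_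
  simp only [Vt, ξt, β, ξ]
  push_cast
  ring

/-- The counting measure turns the almost everywhere bound of `PolyBounded` into a pointwise one. -/
theorem _root_.PolyBounded.exists_bound_mul_ρ (H : D.Admissible B) {x : ℝ} (hx : x ∈ Icc (0 : ℝ) 1)
    {c : ℝ → ℝ} (hc : PolyBounded (Measure.count.restrict (Ioo 0 D.T)) D.Θ c) :
    ∃ C, ∀ t ∈ Ioo 0 D.T, |c t * D.ρ t x| ≤ C := by
  obtain ⟨-, k, C, hC, h⟩ := hc
  obtain ⟨K, hK⟩ := H.exists_Θ_pow_mul_ρ_le k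
  have h' : ∀ t ∈ Ioo 0 D.T, |c t| ≤ C * D.Θ t ^ k := by
    rw [ae_restrict_iff' measurableSet_Ioo, Measure.ae_count_iff] at h
    exact h
  refine ⟨C * K, fun t ht => ?_⟩
  have hρ : 0 < D.ρ t x := Real.exp_pos _
  rw [abs_mul, abs_of_pos hρ]
  calc _ ≤ C * D.Θ t ^ k * D.ρ t x := by gcongr; exact h' t ht
    _ = C * (D.Θ t ^ k * D.ρ t x) := by ring
    _ ≤ _ := by gcongr; exact hK t ht x hx

namespace Admissible

/-- A coefficient of polynomial growth times the factor `e^{-sα}` extends by zero to an absolutely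
continuous function of time. The extension is explicit because at `t = 0` and `t = T`, where
`θ = 0⁻¹ = 0`, the definition gives `ρ = 1`. -/
theorem mul_ρ_time_ac (H : D.Admissible B) {x : ℝ} (hx : x ∈ Icc (0 : ℝ) 1) {c c' : ℝ → ℝ}
    (hd : ∀ t ∈ Ioo 0 D.T, HasDerivAt c (c' t) t)
    (hc : PolyBounded (Measure.count.restrict (Ioo 0 D.T)) D.Θ c)
    (hc' : PolyBounded (Measure.count.restrict (Ioo 0 D.T)) D.Θ c') :
    HasACDerivOn 0 D.T ((Ioo 0 D.T).indicator fun t => c t * D.ρ t x)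
      (fun t => (c' t - D.s * D.αt t x * c t) * D.ρ t x) := by
  have S := sampling_const D hx Measure.count
  obtain ⟨C, hC⟩ := (S.poly_θ.mul hc).exists_bound_mul_ρ H hx
  obtain ⟨C', hC'⟩ := (hc'.sub (fun t => one_le_Θ D t)
    (((PolyBounded.const D.s).mul (S.poly_αt H)).mul hc)).exists_bound_mul_ρ H hx
  refine .indicator_of_bound H.T_pos.le (C := max C C') (fun t ht => ?_) (fun t ht => ?_)
    fun t ht => (hC' t ht).trans (le_max_right _ _)
  · exact ((hd t ht).mul (hasDerivAt_ρ ht x)).congr_deriv (by ring)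
  · have h0 : 0 < t * (D.T - t) := mul_pos ht.1 (sub_pos.2 ht.2)
    have h1 := (hC t ht).trans (le_max_left C C')
    rw [mul_assoc, abs_mul, id, abs_of_pos (θ_pos ht), θ, ← div_eq_inv_mul, div_le_iff₀ h0] at h1
    exact h1

variable {φ φt : ℝ → ℝ → ℝ} {x : ℝ}

theorem hasZeroTraceDeriv_ψ (H : D.Admissible B) (hx : x ∈ Icc (0 : ℝ) 1) {u : ℝ → ℝ}
    (hu : HasACDerivOn 0 D.T u fun t => φt t x)
    (h : ∀ᵐ t ∂(volume.restrict (Ioo 0 D.T)), φ t x = u t) :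
    HasZeroTraceDeriv D.T (fun t => D.ψ φ t x) (fun t => D.ψt φ φt t x) := by
  have h1 := H.mul_ρ_time_ac hx (c := fun _ => 1) (c' := fun _ => 0)
    (fun t _ => hasDerivAt_const t 1) (PolyBounded.const 1) (PolyBounded.const 0)
  refine ⟨_, (h1.mul hu).congr_deriv (g' := fun t => D.ψt φ φt t x) ?_, by simp, by simp, ?_⟩
  · filter_upwards [h, ae_restrict_mem measurableSet_Ioo] with t ht hti
    simp only [indicator_of_mem hti, ψt, ψ, ht]
    ring
  · filter_upwards [h, ae_restrict_mem measurableSet_Ioo] with t ht hti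
    simp only [indicator_of_mem hti, ψ, ht]
    ring

theorem hasZeroTraceDeriv_V_mul_ψ_sq (H : D.Admissible B) (hx : x ∈ Icc (0 : ℝ) 1) {u : ℝ → ℝ}
    (hu : HasACDerivOn 0 D.T u fun t => φt t x)
    (h : ∀ᵐ t ∂(volume.restrict (Ioo 0 D.T)), φ t x = u t) :
    HasZeroTraceDeriv D.T (fun t => D.V t x * D.ψ φ t x ^ 2) (fun t => D.divT φ φt t x) := by
  have S := sampling_const D hx Measure.count
  have h1 := H.mul_ρ_time_ac hx (c := fun _ => 1) (c' := fun _ => 0)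
    (fun t _ => hasDerivAt_const t 1) (PolyBounded.const 1) (PolyBounded.const 0)
  have h2 := H.mul_ρ_time_ac hx (fun t ht => hasDerivAt_V ht x) (S.poly_V H) (S.poly_Vt H)
  refine ⟨_, ((h1.mul hu).mul (h2.mul hu)).congr_deriv (g' := fun t => D.divT φ φt t x) ?_,
    by simp, by simp, ?_⟩
  · filter_upwards [h, ae_restrict_mem measurableSet_Ioo] with t ht hti
    simp only [indicator_of_mem hti, divT, ψt, ψ, ht]
    ring
  · filter_upwards [h, ae_restrict_mem measurableSet_Ioo] with t ht hti
    simp only [indicator_of_mem hti, ψ, ht]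
    ring

end Admissible

/-! ### Square integrability of sections and traces -/

theorem _root_.MeasureTheory.MemLp.integral_right {T : ℝ} {F : ℝ × ℝ → ℝ} (hF : MemLp F 2 (cyl T)) :
    MemLp (fun t => ∫ x in Ioo 0 1, F (t, x)) 2 (volume.restrict (Ioo 0 T)) := by
  have hm := hF.1.integral_prod_right' (μ := volume.restrict (Ioo 0 T))
  rw [memLp_two_iff_integrable_sq hm]
  have hi : Integrable (fun z => F z ^ 2) ((volume.restrict (Ioo 0 T)).prod
    (volume.restrict (Ioo 0 1))) := hF.integrable_sq
  have hi1 : Integrable F ((volume.restrict (Ioo 0 T)).prod (volume.restrict (Ioo 0 1))) :=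
    MemLp.integrable (μ := cyl T) one_le_two hF
  refine hi.integral_prod_left.mono' (hm.pow 2) ?_
  filter_upwards [hi.prod_right_ae, hi1.prod_right_ae] with t h2 h1
  rw [Real.norm_eq_abs, abs_of_nonneg (sq_nonneg _)]
  set c := ∫ x in Ioo (0 : ℝ) 1, F (t, x) with hc
  have h3 : 0 ≤ ∫ x in Ioo (0 : ℝ) 1, (F (t, x) - c) ^ 2 := integral_nonneg fun _ => sq_nonneg _
  have h4 : ∫ x in Ioo (0 : ℝ) 1, (F (t, x) - c) ^ 2
      = (∫ x in Ioo (0 : ℝ) 1, F (t, x) ^ 2) - 2 * c * c + c ^ 2 := by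
    have e : ∀ x, (F (t, x) - c) ^ 2 = F (t, x) ^ 2 - 2 * c * F (t, x) + c ^ 2 := fun x => by ring
    simp_rw [e]
    rw [integral_add (f := fun x => F (t, x) ^ 2 - 2 * c * F (t, x)) (h2.sub (h1.const_mul _))
      (integrable_const _), integral_sub h2 (h1.const_mul _), integral_const_mul, ← hc]
    simp
  nlinarith

/-- The traces at the endpoints of an `L²(0, T; H¹(0, 1))` function are square integrable. -/
theorem memLp_trace {T : ℝ} {p q : ℝ → ℝ → ℝ} (hp : MemLp (Function.uncurry p) 2 (cyl T))
    (hq : MemLp (Function.uncurry q) 2 (cyl T))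
    (h : ∀ᵐ t ∂(volume.restrict (Ioo 0 T)), HasACDerivOn 0 1 (p t) (q t)) (j : Fin 2) :
    MemLp (fun t => p t (endpt j)) 2 (volume.restrict (Ioo 0 T)) := by
  -- `κ` has slope one and vanishes at the endpoint opposite to `j`
  set κ : ℝ → ℝ := fun x => x - (1 - endpt j) with hκ
  have hκd : HasACDerivOn 0 1 κ fun _ => 1 :=
    .of_hasDerivAt zero_le_one (by fun_prop) (fun x _ =>
      (hasDerivAt_id x).sub_const (1 - endpt j)) (by simp)
  have hκq : MemLp (fun z : ℝ × ℝ => κ z.2 * q z.1 z.2) 2 (cyl T) := by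
    refine hq.of_le_mul (c := 1) (AEStronglyMeasurable.mul ?_ hq.1) ?_
    · exact (by fun_prop : Continuous fun z : ℝ × ℝ => κ z.2).aestronglyMeasurable
    · filter_upwards [ae_cyl_mem T] with z hz
      rw [norm_mul]
      refine mul_le_mul_of_nonneg_right ?_ (norm_nonneg _)
      rw [Real.norm_eq_abs, abs_le]
      have hj := endpt_mem j
      constructor <;> simp only [hκ] <;> linarith [hz.2.1, hz.2.2, hj.1, hj.2]
  refine (hp.add hκq).integral_right.ae_eq ?_
  filter_upwards [h] with t ht
  have h1 := (hκd.mul ht).integral_eq_sub zero_le_one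
  simp only [one_mul] at h1
  simp only [Pi.add_apply, Function.uncurry]
  rw [h1]
  fin_cases j <;> simp [hκ, endpt]

end CarlemanData

/-! ### Integration of the pointwise estimates -/

theorem normalSign_sq (j : Fin 2) : normalSign j ^ 2 = 1 := by
  fin_cases j <;> norm_num [normalSign]

theorem sum_normalSign_mul (f : ℝ → ℝ) : ∑ j : Fin 2, normalSign j * f (endpt j) = f 1 - f 0 := by
  simp [Fin.sum_univ_two, normalSign, endpt]
  ring

/-- `f` is integrable with integral `I`. -/
def HasIntegralEq {α : Type*} [MeasurableSpace α] (μ : Measure α) (f : α → ℝ) (I : ℝ) : Prop :=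
  Integrable f μ ∧ ∫ z, f z ∂μ = I

theorem MeasureTheory.Integrable.hasIntegralEq {α : Type*} [MeasurableSpace α] {μ : Measure α}
    {f : α → ℝ} (hf : Integrable f μ) : HasIntegralEq μ f (∫ z, f z ∂μ) := ⟨hf, rfl⟩

namespace HasIntegralEq

variable {α : Type*} [MeasurableSpace α] {μ : Measure α} {f g : α → ℝ} {I J : ℝ}

theorem add (hf : HasIntegralEq μ f I) (hg : HasIntegralEq μ g J) :
    HasIntegralEq μ (fun z => f z + g z) (I + J) :=
  ⟨hf.1.add hg.1, by rw [integral_add hf.1 hg.1, hf.2, hg.2]⟩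

theorem sub (hf : HasIntegralEq μ f I) (hg : HasIntegralEq μ g J) :
    HasIntegralEq μ (fun z => f z - g z) (I - J) :=
  ⟨hf.1.sub hg.1, by rw [integral_sub hf.1 hg.1, hf.2, hg.2]⟩

theorem const_mul (c : ℝ) (hf : HasIntegralEq μ f I) :
    HasIntegralEq μ (fun z => c * f z) (c * I) :=
  ⟨hf.1.const_mul c, by rw [integral_const_mul, hf.2]⟩

theorem mono (hf : HasIntegralEq μ f I) (hg : HasIntegralEq μ g J) (h : ∀ᵐ z ∂μ, f z ≤ g z) :
    I ≤ J := by
  rw [← hf.2, ← hg.2]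
  exact integral_mono_ae hf.1 hg.1 h

end HasIntegralEq

namespace CarlemanData

variable {D : CarlemanData} {B : ℝ}

namespace Sampling

variable {Ω : Type*} [MeasurableSpace Ω] {μ : Measure Ω} {τ x : Ω → ℝ} {φ φt φx q : ℝ → ℝ → ℝ}

theorem integrable_fluxX (S : D.Sampling μ τ x) (H : D.Admissible B)
    (hφ : MemLp (fun z => φ (τ z) (x z)) 2 μ) (hφx : MemLp (fun z => φx (τ z) (x z)) 2 μ) :
    Integrable (fun z => D.fluxX φ φx (τ z) (x z)) μ := by
  have c2 := PolyBounded.const (μ := μ) (Θ := fun z => D.Θ (τ z)) 2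
  have hξ' := (PolyBounded.const (μ := μ) (Θ := fun z => D.Θ (τ z)) (D.s * D.lam ^ 2)).mul
    (S.poly_ξ H)
  have rψ := S.rapid_ψ H hφ
  have rw' := S.rapid_w H hφ hφx
  have A := ((rw'.smul (c2.mul (S.poly_β H))).add (rψ.smul (c2.mul (S.poly_γ H)))).add
    (rψ.smul (hξ'.mul (S.poly_χ H)))
  have A' := rψ.smul (c2.mul (((S.poly_d H).mul (S.poly_β H)).mul (S.poly_V H)))
  refine ((rw'.integrable_mul A).add (rψ.integrable_mul A')).congr (ae_of_all _ fun z => ?_)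
  simp only [Pi.add_apply, fluxX]
  ring

end Sampling

namespace Admissible

variable {φ φt φx q a : ℝ → ℝ → ℝ} {b : Fin 2 → ℝ → ℝ} {o : ℝ → ℝ}

/-- The pointwise interior estimate, integrated over the cylinder. -/
theorem integral_interior_estimate (H : D.Admissible B)
    (hφ : MemLp (fun z : ℝ × ℝ => φ z.1 z.2) 2 (cyl D.T))
    (hφt : MemLp (fun z : ℝ × ℝ => φt z.1 z.2) 2 (cyl D.T))
    (hφx : MemLp (fun z : ℝ × ℝ => φx z.1 z.2) 2 (cyl D.T))
    (hq : MemLp (fun z : ℝ × ℝ => q z.1 z.2) 2 (cyl D.T))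
    (ham : AEStronglyMeasurable (fun z : ℝ × ℝ => a z.1 z.2) (cyl D.T))
    (ha : ∀ᵐ z ∂(cyl D.T), |a z.1 z.2| ≤ B)
    (hom : Measurable o) (hχo : ∀ x, D.χ x ≤ o x) (ho : ∀ x, o x ≤ 1) :
    1 / (180 * B ^ 14) *
      (D.s⁻¹ * (∫ z, (D.ξ z.1 z.2)⁻¹ * (D.ρ z.1 z.2 * φt z.1 z.2) ^ 2 ∂(cyl D.T))
      + D.s⁻¹ * (∫ z, (D.ξ z.1 z.2)⁻¹ * (D.ρ z.1 z.2 * q z.1 z.2) ^ 2 ∂(cyl D.T))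
      + D.s ^ 3 * D.lam ^ 4 * (∫ z, D.ξ z.1 z.2 ^ 3 * (D.ρ z.1 z.2 * φ z.1 z.2) ^ 2 ∂(cyl D.T))
      + D.s * D.lam ^ 2 * (∫ z, D.ξ z.1 z.2 * (D.ρ z.1 z.2 * φx z.1 z.2) ^ 2 ∂(cyl D.T))) ≤
    3 * B ^ 3 * ((∫ z, (D.ρ z.1 z.2 * opL a φ φt q z.1 z.2) ^ 2 ∂(cyl D.T))
      + D.s ^ 3 * D.lam ^ 4 *
        (∫ z, o z.2 * D.ξ z.1 z.2 ^ 3 * (D.ρ z.1 z.2 * φ z.1 z.2) ^ 2 ∂(cyl D.T)))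
      - 2 * (∫ z, D.ψt φ φt z.1 z.2 * D.wx φ φx q z.1 z.2 ∂(cyl D.T))
      + (∫ z, D.divX φ φx q z.1 z.2 ∂(cyl D.T)) - (∫ z, D.divT φ φt z.1 z.2 ∂(cyl D.T)) := by
  have S := H.sampling_cyl
  have hB0 : 0 ≤ B := zero_le_one.trans H.one_le_B
  have hL : MemLp (fun z : ℝ × ℝ => opL a φ φt q z.1 z.2) 2 (cyl D.T) := by
    refine (hφt.add hq).sub (hφ.of_le_mul (c := B) (ham.mul hφ.1) ?_)
    filter_upwards [ha] with z hz
    rw [norm_mul]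
    exact mul_le_mul_of_nonneg_right hz (norm_nonneg _)
  have po : PolyBounded (cyl D.T) (fun z => D.Θ z.1) fun z => o z.2 := by
    refine .of_bounded (hom.comp measurable_snd).aestronglyMeasurable 1 (ae_of_all _ fun z => ?_)
    rw [abs_of_nonneg ((H.χ_nonneg _).trans (hχo _))]
    exact ho _
  have i0 := RapidL2.integrable_coeff_mul_sq (S.poly_ξ_inv H) (S.rapid_ρ_mul H hφt)
  have i1 := RapidL2.integrable_coeff_mul_sq (S.poly_ξ_inv H) (S.rapid_ρ_mul H hq)
  have i2 := RapidL2.integrable_coeff_mul_sq ((S.poly_ξ H).pow 3) (S.rapid_ρ_mul H hφ)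
  have i3 := RapidL2.integrable_coeff_mul_sq (S.poly_ξ H) (S.rapid_ρ_mul H hφx)
  have iF := (S.rapid_ρ_mul H hL).integrable_sq
  have iO := RapidL2.integrable_coeff_mul_sq (po.mul ((S.poly_ξ H).pow 3)) (S.rapid_ρ_mul H hφ)
  have iP := (S.rapid_ψt H hφ hφt).integrable_mul (S.rapid_wx H hφ hφx hq)
  have iX := S.integrable_divX H hφ hφx hq
  have iT := S.integrable_divT H hφ hφt
  refine HasIntegralEq.mono (((((i0.hasIntegralEq.const_mul _).add
    (i1.hasIntegralEq.const_mul _)).add (i2.hasIntegralEq.const_mul _)).add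
    (i3.hasIntegralEq.const_mul _)).const_mul _)
    (((((iF.hasIntegralEq.add (iO.hasIntegralEq.const_mul _)).const_mul _).sub
    (iP.hasIntegralEq.const_mul _)).add iX.hasIntegralEq).sub iT.hasIntegralEq) ?_
  filter_upwards [ha, ae_cyl_mem D.T] with z hz hzQ
  have hx := Ioo_subset_Icc_self hzQ.2
  have key := interior_estimate (o := o z.2) H.one_le_B H.le_s H.le_lam (H.ξ_pos hzQ.1 hx)
    (H.one_le_mul_ξ hzQ.1 hx) (H.one_le_mul_d _ hx) (H.d_le _ hx) (H.abs_d'_le _ hx)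
    (H.abs_h_le _ hx) (H.abs_h₂_le _ hx) (H.abs_αt_le hzQ.1 hx) (H.abs_αtt_le hzQ.1 hx)
    (H.abs_ξt_le hzQ.1 hx) (H.χ_nonneg z.2) (hχo z.2) (ho z.2) (H.abs_χ'_le _ hx)
    (H.crit _ hzQ.2) hz rfl rfl rfl rfl rfl rfl rfl
    (ψ := D.ψ φ z.1 z.2) (ψt := D.ψt φ φt z.1 z.2) (ψx := D.ψx φ φx z.1 z.2)
    (wx := D.wx φ φx q z.1 z.2) (f := D.ρ z.1 z.2 * opL a φ φt q z.1 z.2)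
    (r₁ := D.ρ z.1 z.2 * φt z.1 z.2) (r₂ := D.ρ z.1 z.2 * q z.1 z.2)
    (w := D.w φ φx z.1 z.2) (DX := D.divX φ φx q z.1 z.2) (DY := D.divT φ φt z.1 z.2) rfl
    (by simp only [ψt]; ring) (by simp only [wx, β, βx]; ring)
    (by simp only [opL, ψ]; ring) rfl rfl
  have e : D.ψx φ φx z.1 z.2 - D.s * D.lam * D.h z.2 * D.ξ z.1 z.2 * D.ψ φ z.1 z.2 =
      D.ρ z.1 z.2 * φx z.1 z.2 := by simp only [ψx, β]; ring
  rw [e] at key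
  simp only [ψ] at key ⊢
  linarith

/-- The pointwise boundary estimate, integrated in time. -/
theorem integral_boundary_estimate (H : D.Admissible B) (j : Fin 2)
    (hφ : MemLp (fun t => φ t (endpt j)) 2 (volume.restrict (Ioo 0 D.T)))
    (hφt : MemLp (fun t => φt t (endpt j)) 2 (volume.restrict (Ioo 0 D.T)))
    (hφx : MemLp (fun t => φx t (endpt j)) 2 (volume.restrict (Ioo 0 D.T)))
    (hbm : AEStronglyMeasurable (b j) (volume.restrict (Ioo 0 D.T)))
    (hb : ∀ᵐ t ∂(volume.restrict (Ioo 0 D.T)), |b j t| ≤ B) :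
    1 / (180 * B ^ 14) *
      (D.s⁻¹ * (∫ t in Ioo 0 D.T, (D.ξ t (endpt j))⁻¹ * (D.ρ t (endpt j) * φt t (endpt j)) ^ 2)
      + D.s ^ 3 * D.lam ^ 3 *
        (∫ t in Ioo 0 D.T, D.ξ t (endpt j) ^ 3 * (D.ρ t (endpt j) * φ t (endpt j)) ^ 2)
      + D.s * D.lam *
        (∫ t in Ioo 0 D.T, D.ξ t (endpt j) * (D.ρ t (endpt j) * φx t (endpt j)) ^ 2)) ≤
    3 * B ^ 3 * (∫ t in Ioo 0 D.T, (D.ρ t (endpt j) * opK D.d b φ φt φx t j) ^ 2)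
      + 2 * (∫ t in Ioo 0 D.T, normalSign j * (D.ψt φ φt t (endpt j) * D.w φ φx t (endpt j)))
      - (∫ t in Ioo 0 D.T, normalSign j * D.fluxX φ φx t (endpt j)) := by
  have S := sampling_const D (endpt_mem j) volume
  have hK : MemLp (fun t => opK D.d b φ φt φx t j) 2 (volume.restrict (Ioo 0 D.T)) := by
    refine (hφt.sub (hφx.const_mul _)).sub (hφ.of_le_mul (c := B) (hbm.mul hφ.1) ?_)
    filter_upwards [hb] with z hz
    rw [norm_mul]
    exact mul_le_mul_of_nonneg_right hz (norm_nonneg _)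
  have i0 := RapidL2.integrable_coeff_mul_sq (S.poly_ξ_inv H) (S.rapid_ρ_mul H hφt)
  have i2 := RapidL2.integrable_coeff_mul_sq ((S.poly_ξ H).pow 3) (S.rapid_ρ_mul H hφ)
  have i3 := RapidL2.integrable_coeff_mul_sq (S.poly_ξ H) (S.rapid_ρ_mul H hφx)
  have iK := (S.rapid_ρ_mul H hK).integrable_sq
  have iP := ((S.rapid_ψt H hφ hφt).integrable_mul (S.rapid_w H hφ hφx)).const_mul (normalSign j)
  have iX := (S.integrable_fluxX H hφ hφx).const_mul (normalSign j)
  simp only [id] at i0 i2 i3 iK iP iX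
  refine HasIntegralEq.mono ((((i0.hasIntegralEq.const_mul _).add
    (i2.hasIntegralEq.const_mul _)).add (i3.hasIntegralEq.const_mul _)).const_mul _)
    (((iK.hasIntegralEq.const_mul _).add (iP.hasIntegralEq.const_mul _)).sub iX.hasIntegralEq) ?_
  filter_upwards [hb, ae_restrict_mem measurableSet_Ioo] with t hbt ht
  have hx := endpt_mem j
  have key := boundary_estimate H.one_le_B H.le_s H.le_lam (H.ξ_pos ht hx) (H.one_le_mul_ξ ht hx)
    (H.one_le_mul_d _ hx) (H.d_le _ hx) (H.abs_h_le _ hx) (H.abs_αt_le ht hx) (normalSign_sq j)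
    (H.normal j) hbt rfl rfl rfl
    (ψ := D.ψ φ t (endpt j)) (ψt := D.ψt φ φt t (endpt j)) (ψx := D.ψx φ φx t (endpt j))
    (k := D.ρ t (endpt j) * opK D.d b φ φt φx t j) (w := D.w φ φx t (endpt j))
    (r₁ := D.ρ t (endpt j) * φt t (endpt j)) rfl
    (by simp only [ψt]; ring) (by simp only [opK, w, ψx, ψ, β]; ring)
  have e : D.ψx φ φx t (endpt j) - D.s * D.lam * D.h (endpt j) * D.ξ t (endpt j) *
      D.ψ φ t (endpt j) = D.ρ t (endpt j) * φx t (endpt j) := by simp only [ψx, β]; ring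
  rw [e] at key
  simp only [fluxX, H.χ_boundary j, V, β, γ, ψ] at key ⊢
  linarith

end Admissible

end CarlemanData

/-! ### The estimate for admissible coefficients -/

namespace CarlemanData

variable {D : CarlemanData} {B : ℝ} {φ φt φx φxx q a : ℝ → ℝ → ℝ} {b : Fin 2 → ℝ → ℝ}

theorem ρ_sq (D : CarlemanData) (t x : ℝ) : D.ρ t x ^ 2 = Real.exp (-2 * D.s * D.α t x) := by
  rw [ρ, ← Real.exp_nat_mul]
  congr 1
  push_cast
  ring

namespace Admissible

/-- The flux `fluxX` only contributes through the lateral boundary. -/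
theorem integral_divX (H : D.Admissible B)
    (hφ : MemLp (fun z : ℝ × ℝ => φ z.1 z.2) 2 (cyl D.T))
    (hφx : MemLp (fun z : ℝ × ℝ => φx z.1 z.2) 2 (cyl D.T))
    (hq : MemLp (fun z : ℝ × ℝ => q z.1 z.2) 2 (cyl D.T))
    (hφj : ∀ j, MemLp (fun t => φ t (endpt j)) 2 (volume.restrict (Ioo 0 D.T)))
    (hφxj : ∀ j, MemLp (fun t => φx t (endpt j)) 2 (volume.restrict (Ioo 0 D.T)))
    (hac : ∀ᵐ t ∂(volume.restrict (Ioo 0 D.T)), HasACDerivOn 0 1 (φ t) (φx t))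
    (hacq : ∀ᵐ t ∂(volume.restrict (Ioo 0 D.T)),
      HasACDerivOn 0 1 (fun x => D.d x * φx t x) (q t)) :
    ∫ z, D.divX φ φx q z.1 z.2 ∂(cyl D.T) =
      ∑ j : Fin 2, ∫ t in Ioo 0 D.T, normalSign j * D.fluxX φ φx t (endpt j) := by
  have hF : ∀ j, Integrable (fun t => normalSign j * D.fluxX φ φx t (endpt j))
      (volume.restrict (Ioo 0 D.T)) := fun j =>
    ((sampling_const D (endpt_mem j) volume).integrable_fluxX H (hφj j) (hφxj j)).const_mul _
  rw [← integral_finsetSum _ fun j _ => hF j]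
  have hi := H.sampling_cyl.integrable_divX H hφ hφx hq
  rw [cyl] at hi ⊢
  rw [integral_prod _ hi]
  refine integral_congr_ae ?_
  filter_upwards [hac, hacq] with t h1 h2
  rw [(H.fluxX_ac h1 h2).integral_eq_sub zero_le_one]
  exact (sum_normalSign_mul (D.fluxX φ φx t)).symm

/-- `V ψ²` vanishes at the ends of the time interval. -/
theorem integral_divT (H : D.Admissible B)
    (hφ : MemLp (fun z : ℝ × ℝ => φ z.1 z.2) 2 (cyl D.T))
    (hφt : MemLp (fun z : ℝ × ℝ => φt z.1 z.2) 2 (cyl D.T))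
    (hact : ∀ᵐ x ∂(volume.restrict (Ioo (0 : ℝ) 1)), ∃ u,
      HasACDerivOn 0 D.T u (fun t => φt t x) ∧ ∀ᵐ t ∂(volume.restrict (Ioo 0 D.T)), φ t x = u t) :
    ∫ z, D.divT φ φt z.1 z.2 ∂(cyl D.T) = 0 := by
  have hi := H.sampling_cyl.integrable_divT H hφ hφt
  rw [cyl] at hi ⊢
  rw [integral_prod_symm _ hi]
  refine (integral_congr_ae (g := fun _ => 0) ?_).trans (integral_zero _ _)
  filter_upwards [hact, ae_restrict_mem measurableSet_Ioo] with x hx hxi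
  obtain ⟨u, hu, h⟩ := hx
  exact (H.hasZeroTraceDeriv_V_mul_ψ_sq (Ioo_subset_Icc_self hxi) hu h).integral_eq_zero H.T_pos.le

/-- The mixed term only contributes through the lateral boundary, since `∂ₓψ = d⁻¹ w`. -/
theorem integral_ψt_mul_wx (H : D.Admissible B)
    (hφ : MemLp (fun z : ℝ × ℝ => φ z.1 z.2) 2 (cyl D.T))
    (hφt : MemLp (fun z : ℝ × ℝ => φt z.1 z.2) 2 (cyl D.T))
    (hφx : MemLp (fun z : ℝ × ℝ => φx z.1 z.2) 2 (cyl D.T))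
    (hq : MemLp (fun z : ℝ × ℝ => q z.1 z.2) 2 (cyl D.T))
    (hφj : ∀ j, MemLp (fun t => φ t (endpt j)) 2 (volume.restrict (Ioo 0 D.T)))
    (hφtj : ∀ j, MemLp (fun t => φt t (endpt j)) 2 (volume.restrict (Ioo 0 D.T)))
    (hφxj : ∀ j, MemLp (fun t => φx t (endpt j)) 2 (volume.restrict (Ioo 0 D.T)))
    (hac : ∀ᵐ t ∂(volume.restrict (Ioo 0 D.T)), HasACDerivOn 0 1 (φ t) (φx t))
    (hacq : ∀ᵐ t ∂(volume.restrict (Ioo 0 D.T)),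
      HasACDerivOn 0 1 (fun x => D.d x * φx t x) (q t))
    (hact : ∀ᵐ x ∂(volume.restrict (Ioo (0 : ℝ) 1)), ∃ u,
      HasACDerivOn 0 D.T u (fun t => φt t x) ∧ ∀ᵐ t ∂(volume.restrict (Ioo 0 D.T)), φ t x = u t)
    (hactj : ∀ j, ∃ u, HasACDerivOn 0 D.T u (fun t => φt t (endpt j)) ∧
      ∀ᵐ t ∂(volume.restrict (Ioo 0 D.T)), φ t (endpt j) = u t) :
    ∫ z, D.ψt φ φt z.1 z.2 * D.wx φ φx q z.1 z.2 ∂(cyl D.T) =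
      ∑ j : Fin 2, ∫ t in Ioo 0 D.T,
        normalSign j * (D.ψt φ φt t (endpt j) * D.w φ φx t (endpt j)) := by
  have S := H.sampling_cyl
  have Sj := fun j => sampling_const D (endpt_mem j) volume
  have hκ : ∀ t, ∀ x ∈ Icc (0 : ℝ) 1, (D.d x)⁻¹ * D.w φ φx t x = D.ψx φ φx t x := fun t x hx => by
    rw [w, inv_mul_cancel_left₀ (H.d_pos hx).ne']
  rw [← restrict_heatCylinder]
  refine integral_timeDeriv_mul_spaceDeriv H.T_pos (κ := fun x => (D.d x)⁻¹)
    (p := D.ψ φ) (pt := D.ψt φ φt) (w := D.w φ φx) (wx := D.wx φ φx q) ?_ ?_ ?_ ?_ ?_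
    (fun j => ((Sj j).rapid_ψ H (hφj j)).memLp)
    (fun j => ((Sj j).rapid_ψt H (hφj j) (hφtj j)).memLp)
    (fun j => ((Sj j).rapid_w H (hφj j) (hφxj j)).memLp) ?_ ?_ ?_ ?_
  · rw [restrict_heatCylinder]; exact (S.rapid_ψ H hφ).memLp
  · rw [restrict_heatCylinder]; exact (S.rapid_ψt H hφ hφt).memLp
  · rw [restrict_heatCylinder]; exact (S.rapid_w H hφ hφx).memLp
  · rw [restrict_heatCylinder]
    refine (S.rapid_ψx H hφ hφx).memLp.ae_eq ?_
    filter_upwards [ae_cyl_mem D.T] with z hz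
    exact (hκ z.1 z.2 (Ioo_subset_Icc_self hz.2)).symm
  · rw [restrict_heatCylinder]; exact (S.rapid_wx H hφ hφx hq).memLp
  · filter_upwards [hact, ae_restrict_mem measurableSet_Ioo] with x ⟨u, hu, h⟩ hxi
    exact H.hasZeroTraceDeriv_ψ (Ioo_subset_Icc_self hxi) hu h
  · intro j
    obtain ⟨u, hu, h⟩ := hactj j
    exact H.hasZeroTraceDeriv_ψ (endpt_mem j) hu h
  · filter_upwards [hac] with t ht
    refine (H.ψ_ac ht).congr_deriv ?_
    filter_upwards [ae_restrict_mem measurableSet_Ioo] with x hx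
    exact hκ t x (Ioo_subset_Icc_self hx)
  · filter_upwards [hac, hacq] with t h1 h2 using H.w_ac h1 h2

theorem integral_observation (f : ℝ × ℝ → ℝ) {ω : Set ℝ} (hω : IsOpen ω) (hω01 : ω ⊆ Ioo 0 1)
    (T : ℝ) : ∫ z, ω.indicator (fun _ => (1 : ℝ)) z.2 * f z ∂(cyl T) =
      ∫ z in Ioo 0 T ×ˢ ω, f z := by
  have e : Ioo 0 T ×ˢ ω = heatCylinder T ∩ Prod.snd ⁻¹' ω := by
    ext z
    simp only [heatCylinder, mem_prod, mem_inter_iff, mem_preimage]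
    exact ⟨fun h => ⟨⟨h.1, hω01 h.2⟩, h.2⟩, fun h => ⟨h.1.1, h.2⟩⟩
  rw [e, ← setIntegral_indicator (measurable_snd hω.measurableSet), restrict_heatCylinder]
  refine integral_congr_ae (ae_of_all _ fun z => ?_)
  by_cases hz : z.2 ∈ ω
  · simp [hz]
  · simp [hz]

/-- The Carleman estimate for coefficients satisfying the quantitative bounds. -/
theorem carleman_estimate (H : D.Admissible B) {ω : Set ℝ} (hω : IsOpen ω) (hω01 : ω ⊆ Ioo 0 1)
    (hχω : ∀ x, x ∉ ω → D.χ x = 0)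
    (ham : AEStronglyMeasurable (fun z : ℝ × ℝ => a z.1 z.2) (cyl D.T))
    (ha : ∀ᵐ z ∂(cyl D.T), |a z.1 z.2| ≤ B)
    (hbm : ∀ j, AEStronglyMeasurable (b j) (volume.restrict (Ioo 0 D.T)))
    (hb : ∀ j, ∀ᵐ t ∂(volume.restrict (Ioo 0 D.T)), |b j t| ≤ B)
    (hE : IsE1 D.T φ φt φx φxx) (hfl : IsFluxDeriv D.T D.d φx q) :
    D.s⁻¹ * (∫ p in heatCylinder D.T, (D.ξ p.1 p.2)⁻¹ *
        Real.exp (-2 * D.s * D.α p.1 p.2) * |φt p.1 p.2| ^ 2)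
    + D.s⁻¹ * (∫ p in heatCylinder D.T, (D.ξ p.1 p.2)⁻¹ *
        Real.exp (-2 * D.s * D.α p.1 p.2) * |q p.1 p.2| ^ 2)
    + D.s⁻¹ * (∑ j : Fin 2, ∫ t in Ioo 0 D.T, (D.ξ t (endpt j))⁻¹ *
        Real.exp (-2 * D.s * D.α t (endpt j)) * |φt t (endpt j)| ^ 2)
    + D.s ^ 3 * D.lam ^ 4 * (∫ p in heatCylinder D.T, D.ξ p.1 p.2 ^ 3 *
        Real.exp (-2 * D.s * D.α p.1 p.2) * |φ p.1 p.2| ^ 2)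
    + D.s * D.lam ^ 2 * (∫ p in heatCylinder D.T, D.ξ p.1 p.2 *
        Real.exp (-2 * D.s * D.α p.1 p.2) * |φx p.1 p.2| ^ 2)
    + D.s ^ 3 * D.lam ^ 3 * (∑ j : Fin 2, ∫ t in Ioo 0 D.T, D.ξ t (endpt j) ^ 3 *
        Real.exp (-2 * D.s * D.α t (endpt j)) * |φ t (endpt j)| ^ 2)
    + D.s * D.lam * (∑ j : Fin 2, ∫ t in Ioo 0 D.T, D.ξ t (endpt j) *
        Real.exp (-2 * D.s * D.α t (endpt j)) * |φx t (endpt j)| ^ 2)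
    ≤ 540 * B ^ 17 * (
      (∫ p in heatCylinder D.T, Real.exp (-2 * D.s * D.α p.1 p.2) * |opL a φ φt q p.1 p.2| ^ 2)
      + (∑ j : Fin 2, ∫ t in Ioo 0 D.T, Real.exp (-2 * D.s * D.α t (endpt j)) *
          |opK D.d b φ φt φx t j| ^ 2)
      + D.s ^ 3 * D.lam ^ 4 * (∫ p in Ioo 0 D.T ×ˢ ω, D.ξ p.1 p.2 ^ 3 *
          Real.exp (-2 * D.s * D.α p.1 p.2) * |φ p.1 p.2| ^ 2)) := by
  have S := H.sampling_cyl
  have hB0 : 0 < B := zero_lt_one.trans_le H.one_le_B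
  have hφ : MemLp (fun z : ℝ × ℝ => φ z.1 z.2) 2 (cyl D.T) := by
    rw [← restrict_heatCylinder]; exact hE.memLp
  have hφt : MemLp (fun z : ℝ × ℝ => φt z.1 z.2) 2 (cyl D.T) := by
    rw [← restrict_heatCylinder]; exact hE.memLp_t
  have hφx : MemLp (fun z : ℝ × ℝ => φx z.1 z.2) 2 (cyl D.T) := by
    rw [← restrict_heatCylinder]; exact hE.memLp_x
  have hq : MemLp (fun z : ℝ × ℝ => q z.1 z.2) 2 (cyl D.T) := by
    rw [← restrict_heatCylinder]; exact hfl.1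
  have hdφx : MemLp (fun z : ℝ × ℝ => D.d z.2 * φx z.1 z.2) 2 (cyl D.T) := by
    refine hφx.of_le_mul (c := B) (S.meas_d.mul hφx.1) ?_
    filter_upwards [S.mem_x] with z hz
    rw [norm_mul, Real.norm_eq_abs, abs_of_pos (H.d_pos hz)]
    exact mul_le_mul_of_nonneg_right (H.d_le _ hz) (norm_nonneg _)
  -- regularity of the sections in space and in time
  have hac : ∀ᵐ t ∂(volume.restrict (Ioo 0 D.T)), HasACDerivOn 0 1 (φ t) (φx t) := by
    filter_upwards [hE.weakDeriv_x, hE.continuousOn, hE.continuousOn_x] with t h1 h2 h3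
    exact h1.hasACDerivOn zero_lt_one
      ((h3.integrableOn_Icc (μ := volume)).mono_set Ioo_subset_Icc_self) h2
  have hacq : ∀ᵐ t ∂(volume.restrict (Ioo 0 D.T)),
      HasACDerivOn 0 1 (fun x => D.d x * φx t x) (q t) := by
    have hi : Integrable (fun z : ℝ × ℝ => q z.1 z.2) (cyl D.T) := hq.integrable one_le_two
    filter_upwards [hfl.2, hE.continuousOn_x, Integrable.prod_right_ae hi] with t h1 h2 h3
    exact h1.hasACDerivOn zero_lt_one h3 ((H.d_ac.continuousOn zero_le_one).mul h2)
  have hact : ∀ᵐ x ∂(volume.restrict (Ioo (0 : ℝ) 1)),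
      ∃ u, HasACDerivOn 0 D.T u (fun t => φt t x) ∧
        ∀ᵐ t ∂(volume.restrict (Ioo 0 D.T)), φ t x = u t := by
    have hi : Integrable (fun z : ℝ × ℝ => φt z.1 z.2) (cyl D.T) := hφt.integrable one_le_two
    filter_upwards [hE.weakDeriv_t, Integrable.prod_left_ae hi] with x h1 h2
    exact h1.exists_hasACDerivOn H.T_pos h2
  have hactj : ∀ j, ∃ u, HasACDerivOn 0 D.T u (fun t => φt t (endpt j)) ∧
      ∀ᵐ t ∂(volume.restrict (Ioo 0 D.T)), φ t (endpt j) = u t := fun j =>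
    (hE.weakDeriv_boundary_t j).exists_hasACDerivOn H.T_pos
      ((hE.memLp_boundary_t j).integrable one_le_two)
  have hφxj : ∀ j, MemLp (fun t => φx t (endpt j)) 2 (volume.restrict (Ioo 0 D.T)) := fun j => by
    refine ((memLp_trace (p := fun t x => D.d x * φx t x) hdφx hq hacq j).const_mul
      (D.d (endpt j))⁻¹).ae_eq (ae_of_all _ fun t => ?_)
    exact inv_mul_cancel_left₀ (H.d_pos (endpt_mem j)).ne' _
  have hI := H.integral_interior_estimate (o := ω.indicator fun _ => 1) hφ hφt hφx hq ham ha
    (measurable_const.indicator hω.measurableSet)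
    (fun x => by
      by_cases hx : x ∈ ω
      · rw [indicator_of_mem hx]; exact H.χ_le x
      · rw [indicator_of_notMem hx, hχω x hx])
    (fun x => indicator_le_self' (fun _ _ => zero_le_one) x)
  -- the boundary terms of both sides are the same up to sign, so that adding the two integrated
  -- estimates cancels them
  have hJ := Finset.sum_le_sum fun j (_ : j ∈ Finset.univ) =>
    H.integral_boundary_estimate j (hE.memLp_boundary j) (hE.memLp_boundary_t j) (hφxj j) (hbm j)
      (hb j)
  rw [H.integral_divX hφ hφx hq hE.memLp_boundary hφxj hac hacq, H.integral_divT hφ hφt hact,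
    H.integral_ψt_mul_wx hφ hφt hφx hq hE.memLp_boundary hE.memLp_boundary_t hφxj hac hacq hact
      hactj] at hI
  simp only [mul_assoc (ω.indicator (fun _ => (1 : ℝ)) _)] at hI
  rw [integral_observation (fun z => D.ξ z.1 z.2 ^ 3 * (D.ρ z.1 z.2 * φ z.1 z.2) ^ 2) hω hω01]
    at hI
  simp only [mul_pow, ρ_sq, ← mul_assoc, ← restrict_heatCylinder] at hI hJ
  simp only [Finset.sum_add_distrib, Finset.sum_sub_distrib, ← Finset.mul_sum] at hJ
  simp only [sq_abs]
  have hc : 540 * B ^ 17 = 180 * B ^ 14 * (3 * B ^ 3) := by ring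
  rw [hc, mul_assoc (180 * B ^ 14), ← div_le_iff₀' (by positivity)]
  rw [div_eq_inv_mul, ← one_div]
  linarith

end Admissible

end CarlemanData

/-! ### Bounds on the data and choice of the cutoff -/

theorem ae_abs_le_of_eLpNorm_top_le {α : Type*} [MeasurableSpace α] {μ : Measure α} {f : α → ℝ}
    {R : ℝ} (hR : 0 ≤ R) (h : eLpNorm f ∞ μ ≤ ENNReal.ofReal R) : ∀ᵐ z ∂μ, |f z| ≤ R := by
  rw [eLpNorm_exponent_top] at h
  filter_upwards [ae_le_eLpNormEssSup (f := f) (μ := μ)] with z hz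
  have := hz.trans h
  rwa [Real.enorm_eq_ofReal_abs, ENNReal.ofReal_le_ofReal_iff hR] at this

/-- The weak derivative has a representative that is bounded everywhere. -/
theorem MemW1Infty.exists_bounded_deriv {a b : ℝ} (hab : a < b) {d : ℝ → ℝ} (hd : MemW1Infty a b d)
    (hdc : ContinuousOn d (Icc a b)) :
    ∃ (d' : ℝ → ℝ) (K : ℝ), HasACDerivOn a b d d' ∧ ∀ x, |d' x| ≤ K := by
  obtain ⟨-, d', hd', hw⟩ := hd
  have h1 := hw.hasACDerivOn hab (hd'.integrable le_top) hdc
  set K := (eLpNorm d' ∞ (volume.restrict (Ioo a b))).toReal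
  have h2 : ∀ᵐ x ∂(volume.restrict (Ioo a b)), |d' x| ≤ K :=
    ae_abs_le_of_eLpNorm_top_le ENNReal.toReal_nonneg (ENNReal.ofReal_toReal hd'.2.ne).ge
  refine ⟨fun x => max (-K) (min K (d' x)), K, h1.congr_deriv ?_, fun x => ?_⟩
  · filter_upwards [h2] with x hx
    rw [min_eq_right (abs_le.1 hx).2, max_eq_right (abs_le.1 hx).1]
  · have : 0 ≤ K := ENNReal.toReal_nonneg
    rw [abs_le]
    exact ⟨le_max_left _ _, max_le (by linarith) (min_le_left _ _)⟩

theorem HasACDerivOn.of_contDiffOn {a b : ℝ} (hab : a < b) {f : ℝ → ℝ}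
    (hf : ContDiffOn ℝ 1 f (Icc a b)) : HasACDerivOn a b f (derivWithin f (Icc a b)) := by
  have hu := uniqueDiffOn_Icc hab
  have hc := hf.continuousOn_derivWithin hu le_rfl
  refine .of_hasDerivAt hab.le hf.continuousOn (fun x hx => ?_)
    (hc.integrableOn_Icc.mono_set Ioo_subset_Icc_self)
  exact ((hf.differentiableOn one_ne_zero x (Ioo_subset_Icc_self hx)).hasDerivWithinAt).hasDerivAt
    (Icc_mem_nhds hx.1 hx.2)

theorem exists_cutoff {ω ω' : Set ℝ} (hω : IsOpen ω) (h : closure ω' ⊆ ω) :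
    ∃ χ : ℝ → ℝ, ContDiff ℝ 1 χ ∧ (∀ x, 0 ≤ χ x) ∧ (∀ x, χ x ≤ 1) ∧ (∀ x ∉ ω, χ x = 0) ∧
      ∀ x ∈ ω', χ x = 1 := by
  obtain ⟨f, h0, h1, h01⟩ := exists_contMDiffMap_zero_one_of_isClosed (n := 1)
    (modelWithCornersSelf ℝ ℝ) hω.isClosed_compl (isClosed_closure (s := ω'))
    (disjoint_compl_left_iff_subset.2 h)
  exact ⟨f, f.contMDiff.contDiff, fun x => (h01 x).1, fun x => (h01 x).2, fun x hx => h0 hx,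
    fun x hx => h1 (subset_closure hx)⟩

namespace IsAuxFunction

variable {ω' : Set ℝ} {η : ℝ → ℝ}

theorem nonneg (hη : IsAuxFunction ω' η) {x : ℝ} (hx : x ∈ Icc (0 : ℝ) 1) : 0 ≤ η x := by
  have h0 := hη.boundary 0
  have h1 := hη.boundary 1
  simp only [endpt, Fin.val_zero, Nat.cast_zero, Fin.val_one, Nat.cast_one] at h0 h1
  rcases hx.1.eq_or_lt with h | h
  · rw [← h, h0]
  · rcases hx.2.eq_or_lt with h' | h'
    · rw [h', h1]
    · exact (hη.pos x ⟨h, h'⟩).le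

theorem le_supNorm01 (hη : IsAuxFunction ω' η) {x : ℝ} (hx : x ∈ Icc (0 : ℝ) 1) :
    η x ≤ supNorm01 η :=
  (le_abs_self _).trans (le_csSup (isCompact_Icc.bddAbove_image hη.contDiffOn.continuousOn.abs)
    (mem_image_of_mem _ hx))

theorem supNorm01_pos (hη : IsAuxFunction ω' η) : 0 < supNorm01 η :=
  (hη.pos (1 / 2) (by norm_num)).trans_le (hη.le_supNorm01 (by norm_num))

theorem contDiffOn_derivWithin (hη : IsAuxFunction ω' η) :
    ContDiffOn ℝ 1 (derivWithin η (Icc 0 1)) (Icc 0 1) :=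
  hη.contDiffOn.derivWithin (uniqueDiffOn_Icc zero_lt_one) (by norm_num)

/-- `η'²` is bounded below away from `ω'`, by compactness. -/
theorem exists_one_le_mul_sq (hη : IsAuxFunction ω' η) :
    ∃ K, ∀ x ∈ Ioo (0 : ℝ) 1 \ ω', 1 ≤ K * derivWithin η (Icc 0 1) x ^ 2 := by
  have hsub : closure (Ioo (0 : ℝ) 1 \ ω') ⊆ Icc 0 1 :=
    closure_minimal (sdiff_subset.trans Ioo_subset_Icc_self) isClosed_Icc
  have hne : ∀ x ∈ closure (Ioo (0 : ℝ) 1 \ ω'), derivWithin η (Icc 0 1) x ^ 2 ≠ 0 := fun x hx =>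
    pow_ne_zero _ (abs_pos.1 (hη.deriv_pos x hx))
  obtain ⟨K, hK⟩ := (isCompact_Icc.of_isClosed_subset isClosed_closure
    hsub).exists_bound_of_continuousOn
    (((hη.contDiffOn_derivWithin.continuousOn.mono hsub).pow 2).inv₀ hne)
  refine ⟨K, fun x hx => ?_⟩
  have hx' := subset_closure hx
  have h1 : (derivWithin η (Icc 0 1) x ^ 2)⁻¹ ≤ K := (le_abs_self _).trans (hK x hx')
  rwa [inv_le_iff_one_le_mul₀ (lt_of_le_of_ne (sq_nonneg _) (hne x hx').symm)] at h1

end IsAuxFunction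

/-- The coefficients of the conjugated operator attached to the diffusion `d`, with derivative `d'`,
the auxiliary function `η` and a cutoff `χ`. -/
def carlemanData (T m : ℝ) (d d' η χ : ℝ → ℝ) (s lam : ℝ) : CarlemanData where
  T := T
  s := s
  lam := lam
  E := Real.exp (2 * lam * m * supNorm01 η)
  d := d
  d' := d'
  h := derivWithin η (Icc 0 1)
  h₂ := derivWithin (derivWithin η (Icc 0 1)) (Icc 0 1)
  e x := Real.exp (lam * (m * supNorm01 η + η x))
  χ := χ
  χ' := derivWithin χ (Icc 0 1)

/-- The bounds of `CarlemanData.Admissible` hold with one constant `B` independent of `λ`, `s`. -/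
theorem exists_carlemanData_admissible {T : ℝ} (hT : 0 < T) {d : ℝ → ℝ} (hd : MemW1Infty 0 1 d)
    (hdc : ContinuousOn d (Icc 0 1)) {M : ℝ} (hM : 0 < M) (hdM : ∀ x ∈ Icc (0 : ℝ) 1, M ≤ d x)
    {ω ω' : Set ℝ} (hω : IsOpen ω) (hω01 : ω ⊆ Ioo 0 1) (hω'ω : closure ω' ⊆ ω) {η : ℝ → ℝ}
    (hη : IsAuxFunction ω' η) {m : ℝ} (hm : 1 < m) (R : ℝ) :
    ∃ (B : ℝ) (d' χ : ℝ → ℝ), 1 ≤ B ∧ R ≤ B ∧ (∀ x ∉ ω, χ x = 0) ∧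
      ∀ lam s, 400 * B ^ 13 ≤ lam → 400 * B ^ 13 ≤ s →
        (carlemanData T m d d' η χ s lam).Admissible B := by
  obtain ⟨d', K, hdac, hd'K⟩ := hd.exists_bounded_deriv zero_lt_one hdc
  obtain ⟨χ, hχ, hχ0, hχ1, hχω, hχω'⟩ := exists_cutoff hω hω'ω
  have hu := uniqueDiffOn_Icc (zero_lt_one (α := ℝ))
  have hh := hη.contDiffOn_derivWithin
  obtain ⟨Kd, hKd⟩ := isCompact_Icc.exists_bound_of_continuousOn hdc
  obtain ⟨Kh, hKh⟩ := isCompact_Icc.exists_bound_of_continuousOn hh.continuousOn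
  obtain ⟨Kh₂, hKh₂⟩ := isCompact_Icc.exists_bound_of_continuousOn
    (hh.continuousOn_derivWithin hu le_rfl)
  obtain ⟨Kχ, hKχ⟩ := isCompact_Icc.exists_bound_of_continuousOn
    (hχ.contDiffOn.continuousOn_derivWithin hu le_rfl)
  obtain ⟨Kc, hKc⟩ := hη.exists_one_le_mul_sq
  set n : Fin 2 → ℝ := fun j => -(normalSign j * derivWithin η (Icc 0 1) (endpt j))
  have hn : ∀ j, 0 < n j := fun j => neg_pos.2 (hη.normal_deriv_neg j)
  obtain ⟨B, hB⟩ := (Set.toFinite ({1, R, T, 3 * T ^ 2, M⁻¹, K, Kd, Kh, Kh₂, Kχ, Kc, (n 0)⁻¹,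
    (n 1)⁻¹} : Set ℝ)).bddAbove
  have hB1 : 1 ≤ B := hB (by simp)
  refine ⟨B, d', χ, hB1, hB (by simp), hχω, fun lam s hlam hs => ?_⟩
  have hlam0 : 0 < lam := by
    have := one_le_pow₀ hB1 (n := 13)
    linarith
  have hN := hη.supNorm01_pos
  have hmN : 0 < m * supNorm01 η := by positivity
  have hηac := HasACDerivOn.of_contDiffOn zero_lt_one (hη.contDiffOn.of_le one_le_two)
  refine
    { one_le_B := hB1
      T_pos := hT
      T_le := hB (by simp [carlemanData])
      sq_T_le := hB (by simp [carlemanData])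
      le_s := hs
      le_lam := hlam
      d_ac := hdac
      h_ac := .of_contDiffOn zero_lt_one hh
      e_ac := ?_
      χ_ac := .of_contDiffOn zero_lt_one hχ.contDiffOn
      one_le_mul_d := fun x hx => ?_
      d_le := fun x hx => ((le_abs_self _).trans (hKd x hx)).trans (hB (by simp))
      abs_d'_le := fun x _ => (hd'K x).trans (hB (by simp))
      abs_h_le := fun x hx => (hKh x hx).trans (hB (by simp))
      abs_h₂_le := fun x hx => (hKh₂ x hx).trans (hB (by simp))
      abs_χ'_le := fun x hx => (hKχ x hx).trans (hB (by simp))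
      χ_nonneg := hχ0
      χ_le := hχ1
      χ_boundary := fun j => hχω _ fun hj => ?_
      crit := fun x hx => ?_
      normal := fun j => ?_
      one_le_e := fun x hx => ?_
      E_le := fun x hx => ?_
      gap := ?_ }
  · refine HasACDerivOn.exp zero_le_one ?_
    simpa [carlemanData] using ((HasACDerivOn.const (m * supNorm01 η)).add hηac).const_mul lam
  · have h1 : M⁻¹ ≤ B := hB (by simp)
    rw [← inv_mul_cancel₀ hM.ne']
    exact mul_le_mul h1 (hdM x hx) hM.le (by linarith)
  · have := hω01 hj
    fin_cases j <;> simp [endpt] at this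
  · by_cases hxω : x ∈ ω'
    · exact .inr (hχω' x hxω)
    · exact .inl ((hKc x ⟨hx, hxω⟩).trans
        (mul_le_mul_of_nonneg_right (hB (by simp)) (sq_nonneg _)))
  · rw [← inv_mul_cancel₀ (hn j).ne']
    refine mul_le_mul_of_nonneg_right (hB ?_) (hn j).le
    fin_cases j <;> simp
  · exact Real.one_le_exp (mul_nonneg hlam0.le (add_nonneg hmN.le (hη.nonneg hx)))
  · simp only [carlemanData]
    rw [← Real.exp_nat_mul]
    have := mul_nonneg hlam0.le (hη.nonneg hx)
    refine Real.exp_le_exp.2 ?_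
    push_cast
    linarith
  -- this is where `m > 1` enters
  · refine ⟨Real.exp (2 * lam * m * supNorm01 η) - Real.exp (lam * (m * supNorm01 η + supNorm01 η)),
      sub_pos.2 (Real.exp_lt_exp.2 ?_), fun x hx => sub_le_sub_left (Real.exp_le_exp.2 ?_) _⟩
    · have : 0 < lam * ((m - 1) * supNorm01 η) := by
        have := sub_pos.2 hm
        positivity
      linarith
    · have := hη.le_supNorm01 hx
      gcongr

/-! ### The Carleman estimate -/

theorem lemma4p2
    (T : ℝ) (hT : 0 < T)
    (d : ℝ → ℝ) (hd : MemW1Infty 0 1 d) (hdc : ContinuousOn d (Icc 0 1))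
    (M : ℝ) (hM : 0 < M) (hdM : ∀ x ∈ Icc (0 : ℝ) 1, M ≤ d x)
    (ω : Set ℝ) (hω : IsOpen ω) (hωne : ω.Nonempty) (hω01 : ω ⊆ Ioo 0 1)
    (ω' : Set ℝ) (hω' : IsOpen ω') (hω'ne : ω'.Nonempty) (hω'ω : closure ω' ⊆ ω)
    (η : ℝ → ℝ) (hη : IsAuxFunction ω' η) (m : ℝ) (hm : 1 < m)
    (R : ℝ) (hR : 0 < R) :
    ∃ C lam₁ s₁ : ℝ, 0 < C ∧ 1 ≤ lam₁ ∧ 1 ≤ s₁ ∧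
      ∀ (a : ℝ → ℝ → ℝ) (b : Fin 2 → ℝ → ℝ),
        MemLp (Function.uncurry a) ∞ (volume.restrict (heatCylinder T)) →
        eLpNorm (Function.uncurry a) ∞ (volume.restrict (heatCylinder T)) ≤ ENNReal.ofReal R →
        (∀ j, MemLp (b j) ∞ (volume.restrict (Ioo 0 T))) →
        (∀ j, eLpNorm (b j) ∞ (volume.restrict (Ioo 0 T)) ≤ ENNReal.ofReal R) →
        ∀ lam s : ℝ, lam₁ ≤ lam → s₁ ≤ s →
        ∀ φ φt φx φxx q : ℝ → ℝ → ℝ, IsE1 T φ φt φx φxx → IsFluxDeriv T d φx q →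
          s⁻¹ * (∫ p in heatCylinder T, (weightXi T m η lam p.1 p.2)⁻¹ *
              Real.exp (-2 * s * weightAlpha T m η lam p.1 p.2) * |φt p.1 p.2| ^ 2)
          + s⁻¹ * (∫ p in heatCylinder T, (weightXi T m η lam p.1 p.2)⁻¹ *
              Real.exp (-2 * s * weightAlpha T m η lam p.1 p.2) * |q p.1 p.2| ^ 2)
          + s⁻¹ * (∑ j : Fin 2, ∫ t in Ioo 0 T, (weightXi T m η lam t (endpt j))⁻¹ *
              Real.exp (-2 * s * weightAlpha T m η lam t (endpt j)) * |φt t (endpt j)| ^ 2)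
          + s ^ 3 * lam ^ 4 * (∫ p in heatCylinder T, weightXi T m η lam p.1 p.2 ^ 3 *
              Real.exp (-2 * s * weightAlpha T m η lam p.1 p.2) * |φ p.1 p.2| ^ 2)
          + s * lam ^ 2 * (∫ p in heatCylinder T, weightXi T m η lam p.1 p.2 *
              Real.exp (-2 * s * weightAlpha T m η lam p.1 p.2) * |φx p.1 p.2| ^ 2)
          + s ^ 3 * lam ^ 3 * (∑ j : Fin 2, ∫ t in Ioo 0 T, weightXi T m η lam t (endpt j) ^ 3 *
              Real.exp (-2 * s * weightAlpha T m η lam t (endpt j)) * |φ t (endpt j)| ^ 2)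
          + s * lam * (∑ j : Fin 2, ∫ t in Ioo 0 T, weightXi T m η lam t (endpt j) *
              Real.exp (-2 * s * weightAlpha T m η lam t (endpt j)) * |φx t (endpt j)| ^ 2)
          ≤ C * (
            (∫ p in heatCylinder T, Real.exp (-2 * s * weightAlpha T m η lam p.1 p.2) *
                |opL a φ φt q p.1 p.2| ^ 2)
            + (∑ j : Fin 2, ∫ t in Ioo 0 T,
                Real.exp (-2 * s * weightAlpha T m η lam t (endpt j)) *
                |opK d b φ φt φx t j| ^ 2)
            + s ^ 3 * lam ^ 4 * (∫ p in Ioo 0 T ×ˢ ω, weightXi T m η lam p.1 p.2 ^ 3 *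
                Real.exp (-2 * s * weightAlpha T m η lam p.1 p.2) * |φ p.1 p.2| ^ 2)) := by
  obtain ⟨B, d', χ, hB1, hRB, hχω, H⟩ :=
    exists_carlemanData_admissible hT hd hdc hM hdM hω hω01 hω'ω hη hm R
  have h1 : 1 ≤ 400 * B ^ 13 := by
    have := one_le_pow₀ hB1 (n := 13)
    linarith
  refine ⟨540 * B ^ 17, 400 * B ^ 13, 400 * B ^ 13, by positivity, h1, h1, ?_⟩
  intro a b ha haR hb hbR lam s hlam hs φ φt φx φxx q hE hq
  rw [CarlemanData.restrict_heatCylinder] at ha haR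
  exact (H lam s hlam hs).carleman_estimate hω hω01 hχω ha.1
    ((ae_abs_le_of_eLpNorm_top_le hR.le haR).mono fun _ h => h.trans hRB) (fun j => (hb j).1)
    (fun j => (ae_abs_le_of_eLpNorm_top_le hR.le (hbR j)).mono fun _ h => h.trans hRB) hE hq

end
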